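/- Let $G$ be a finite group. For a positive multiple $n$ of $|G|$, the Galois group of the $n$-th cyclotomic field $\mathbb{Q}_n\subseteq\mathbb{C}$ over $\mathbb{Q}$ acts on the set $\mathrm{Irr}(G)$ of irreducible complex characters of $G$ by $\chi^{\alpha}(g)=\chi(g)^{\alpha}$; two irreducible characters are called Galois conjugate if they lie in the same orbit for some such $n$ (this does not depend on $n$). Call $G$ a $\mathbf{GC}^*$-group if any two non-linear irreducible characters of $G$ of the same degree are Galois conjugate. Let $G_\infty$ denote the nilpotent residual of $G$, i.e. the smallest term of its lower central series. A non-abelian $2$-group $K$ is a Suzuki $2$-group if it has more than one involution and there is a soluble group of automorphisms of $K$ that is transitive on the set of involutions of $K$. **Theorem.** Let $G=KL$ be a finite solvable Frobenius group with Frobenius kernel $K$ and complement $L$. Assume that $G$ is a $\mathbf{GC}^*$-group and that $K=G_\infty$. Then either 1. $K$ is an elementary abelian $q$-group for some prime $q$; or 2. $K$ is a Suzuki $2$-group such that $|K|=|K'|^2$, and $L$ is cyclic of order $|K'|-1$, where $K'$ is the commutator subgroup of $K$. -/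

import Mathlib

/-- `χ : G → ℂ` is an irreducible complex character of `G`: it is the trace function of an
irreducible representation of `G` on some `ℂⁿ`. -/
def IsIrreducibleCharacter {G : Type*} [Group G] (χ : G → ℂ) : Prop :=
  ∃ (n : ℕ) (ρ : Representation ℂ G (Fin n → ℂ)), ρ.IsIrreducible ∧ ρ.character = χ

/-- The `n`-th cyclotomic field, as a subfield of `ℂ`. -/
noncomputable def cyclotomicSubfield (n : ℕ) : IntermediateField ℚ ℂ :=
  IntermediateField.adjoin ℚ {z : ℂ | z ^ n = 1}

/-- `ψ = χ^α` for some `α` in the Galois group over `ℚ` of the `n`-th cyclotomic field (both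
functions taking their values in that field). -/
def GaloisConjugateIn {G : Type*} (n : ℕ) (χ ψ : G → ℂ) : Prop :=
  ∃ α : cyclotomicSubfield n ≃ₐ[ℚ] cyclotomicSubfield n,
    ∀ g : G, ∃ z : cyclotomicSubfield n, (z : ℂ) = χ g ∧ (α z : ℂ) = ψ g

/-- Two characters of `G` are Galois conjugate if they are so in the `n`-th cyclotomic field for
some positive multiple `n` of `|G|`. -/
def GaloisConjugate {G : Type*} [Group G] (χ ψ : G → ℂ) : Prop :=
  ∃ n : ℕ, 0 < n ∧ Nat.card G ∣ n ∧ GaloisConjugateIn n χ ψ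

/-- `GC*`-groups: any two non-linear irreducible characters of the same degree are Galois
conjugate. -/
def IsGCStar (G : Type*) [Group G] : Prop :=
  ∀ χ ψ : G → ℂ, IsIrreducibleCharacter χ → IsIrreducibleCharacter ψ →
    χ 1 ≠ 1 → ψ 1 ≠ 1 → χ 1 = ψ 1 → GaloisConjugate χ ψ

/-- The nilpotent residual: the intersection (for finite `G`, the smallest term) of the lower
central series of `G`. -/
def nilpotentResidual (G : Type*) [Group G] : Subgroup G :=
  ⨅ n : ℕ, (⊤ : Subgroup G).lowerCentralSeries n

/-- `G` is a Frobenius group with complement `L` and kernel `K`: `L` is a proper nontrivial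
subgroup meeting each of its conjugates `g L g⁻¹`, `g ∉ L`, trivially, and `K` consists of the
identity and the elements lying in no conjugate of `L`. -/
structure IsFrobeniusGroup {G : Type*} [Group G] (K L : Subgroup G) : Prop where
  ne_bot : L ≠ ⊥
  ne_top : L ≠ ⊤
  inf_conj : ∀ g : G, g ∉ L → L ⊓ L.map (MulAut.conj g).toMonoidHom = ⊥
  mem_kernel : ∀ x : G, x ∈ K ↔ x = 1 ∨ ∀ g : G, x ∉ L.map (MulAut.conj g).toMonoidHom

/-- Elementary abelian `q`-groups. -/
def IsElementaryAbelian (q : ℕ) (K : Type*) [Group K] : Prop :=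
  (∀ x y : K, x * y = y * x) ∧ ∀ x : K, x ^ q = 1

/-- Suzuki `2`-groups: non-abelian `2`-groups with more than one involution that have a soluble
group of automorphisms transitive on the involutions. -/
structure IsSuzukiTwoGroup (K : Type*) [Group K] : Prop where
  isPGroup : IsPGroup 2 K
  nonabelian : ∃ x y : K, x * y ≠ y * x
  involutions : ∃ x y : K, orderOf x = 2 ∧ orderOf y = 2 ∧ x ≠ y
  transitive : ∃ A : Subgroup (MulAut K), Group.IsSolvable A ∧
    ∀ x y : K, orderOf x = 2 → orderOf y = 2 → ∃ a ∈ A, a x = y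

/-! The kernel `K` is studied through its characters. If an irreducible character of `K` restricts
to an `L`-invariant normal subgroup as a multiple of a nontrivial linear character, then it induces
irreducibly to `G = K ⋊ L`, because `L` acts freely on such linear characters. The `GC*` condition
therefore says that two such characters of `K` of equal degree differ by an element of `L` and a
power map `g ↦ g ^ t` (`isGaloisTransitive_of_isGCStar`). This property, `IsGaloisTransitive`, is
inherited by `L`-equivariant quotients of `K`.

Applied to linear characters, it makes `K / K'` of prime exponent `p`, and solvability together with
the fixed-point-free action then makes `K` a `p`-group. The main tool is
`mem_commutator_of_apply_ne_zero`. The orbit, under `L` and power maps, of a function unaffected by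
exponents `t ≡ 1` mod `p` has size dividing `|L| (p - 1)`, which is prime to `p`. If multiplication
by the `p`-group of linear characters preserves this orbit, it fixes some member, and that forces
the function to vanish off `K'`.

Suppose `P' ≤ Z(P)` and let `lam ≠ 1` be a linear character of `P'`. The tool shows that an `x` in
the radical of `lam ⁅x, y⁆` with `lam (x ^ p) = 1` lies in `P'`. So the radical has order `|P'|` or
`p |P'|`. Comparing with squares of degrees, all `lam ≠ 1` lie under characters of one degree and
are conjugate.

For `p` odd and `P' ≠ 1`, the map `x ↦ x ^ p` induces an isomorphism `P / P' ≅ P'`, through which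
the commutators `⁅x, ·⁆` become a linear family of endomorphisms of `P'` with one-dimensional
kernels. Chevalley–Warning, applied to a coefficient of the characteristic polynomial, finds `x`
with `x ^ p ∈ ⁅x, P⁆` (`exists_pairing_eq`). This contradicts `⁅x, P⁆ ⟨x ^ p⟩ = P'` and `⁅x, P⁆ ≠
P'`. Hence `K` is abelian for odd `p`.

For `p = 2` the orbit sizes give `|P : P'| = |P'| = |L| + 1`. What remains is to exclude class three
(`IsCentralExtensionOfClassTwo.false`). There the same Chevalley–Warning argument makes every `g`
conjugate to `g ^ 5`. Characters over a suitable linear character of a subgroup of index `2 * 4 ^ k`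
then have pairwise distinct degrees `2 ^ a` with `a ≤ k`, and the squares of these degrees cannot
add up to that index.

Finally `L` is nilpotent, of odd order when `K' ≠ 1`, and acts fixed-point-freely on the abelian
group `K'`, so it is cyclic. It permutes the involutions of `K`, which all lie in `K'`,
transitively. -/

namespace GaloisFrobenius

/-! ### Irreducible representations, eigenvalues, and Galois conjugacy as a power map -/

open Representation

/-- `χ` is the character of an irreducible representation on which the subgroup `M` acts by
scalars through the linear character `lam`. -/
def IrrOver {K : Type*} [Group K] (M : Subgroup K) (lam : M →* ℂˣ) (χ : K → ℂ) : Prop :=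
  ∃ (d : ℕ) (ρ : Representation ℂ K (Fin d → ℂ)), ρ.IsIrreducible ∧ ρ.character = χ ∧
    ∀ m : M, ρ m = (lam m : ℂ) • (1 : Module.End ℂ (Fin d → ℂ))

theorem isIrreducible_iff {G V : Type*} [Group G] [AddCommGroup V] [Module ℂ V]
    (ρ : Representation ℂ G V) :
    ρ.IsIrreducible ↔ Nontrivial V ∧ ∀ U : Submodule ℂ V,
      (∀ g, ∀ v ∈ U, ρ g v ∈ U) → U = ⊥ ∨ U = ⊤ := by
  constructor
  · intro h
    refine ⟨?_, fun U hU => ?_⟩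
    · by_contra hn
      rw [not_nontrivial_iff_subsingleton] at hn
      refine bot_ne_top (α := Subrepresentation ρ) ?_
      apply Subrepresentation.toSubmodule_injective
      exact Subsingleton.elim _ _
    · rcases h.eq_bot_or_eq_top ⟨U, hU⟩ with h | h
      · exact Or.inl (congrArg Subrepresentation.toSubmodule h)
      · exact Or.inr (congrArg Subrepresentation.toSubmodule h)
  · rintro ⟨h1, h2⟩
    refine { exists_pair_ne := ⟨⊥, ⊤, fun h => ?_⟩, eq_bot_or_eq_top := fun U => ?_ }
    · exact bot_ne_top (α := Submodule ℂ V) (congrArg Subrepresentation.toSubmodule h)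
    · rcases h2 U.toSubmodule (fun g v hv => U.apply_mem_toSubmodule g hv) with h | h
      · exact Or.inl (Subrepresentation.toSubmodule_injective h)
      · exact Or.inr (Subrepresentation.toSubmodule_injective h)

theorem isIrreducible_comp {G H V : Type*} [Group G] [Group H] [AddCommGroup V] [Module ℂ V]
    (ρ : Representation ℂ G V) (hρ : ρ.IsIrreducible) (f : H →* G)
    (hf : Function.Surjective f) : IsIrreducible (ρ.comp f : Representation ℂ H V) := by
  rw [isIrreducible_iff] at hρ ⊢
  refine ⟨hρ.1, fun U hU => hρ.2 U fun g v hv => ?_⟩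
  obtain ⟨h, rfl⟩ := hf g
  exact hU h v hv

/-- Every irreducible representation on a finite-dimensional space has an irreducible character
in coordinates. -/
theorem isIrreducibleCharacter_character {G V : Type*} [Group G] [AddCommGroup V] [Module ℂ V]
    [FiniteDimensional ℂ V] (ρ : Representation ℂ G V) (hρ : ρ.IsIrreducible) :
    IsIrreducibleCharacter ρ.character := by
  let e : V ≃ₗ[ℂ] (Fin (Module.finrank ℂ V) → ℂ) := (Module.finBasis ℂ V).equivFun
  let σ : Representation ℂ G (Fin (Module.finrank ℂ V) → ℂ) :=
    (e.conjAlgEquiv ℂ : Module.End ℂ V →* _).comp ρ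
  have hσ : ∀ g v, σ g (e v) = e (ρ g v) := fun g v => by simp [σ]
  refine ⟨_, σ, ?_, ?_⟩
  · rw [isIrreducible_iff] at hρ ⊢
    refine ⟨e.symm.toEquiv.nontrivial_congr.mpr hρ.1, fun U hU => ?_⟩
    rcases hρ.2 (U.comap e.toLinearMap) (fun g v hv => by
      have := hU g _ hv
      simpa [hσ] using this) with h | h
    · left
      rw [eq_bot_iff]
      intro x hx
      have : e.symm x ∈ U.comap e.toLinearMap := by simpa using hx
      rw [h, Submodule.mem_bot] at this
      simpa using this
    · right
      rw [eq_top_iff]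
      intro x _
      have : e.symm x ∈ U.comap e.toLinearMap := h ▸ Submodule.mem_top
      simpa using this
  · ext g
    exact LinearMap.trace_conj' (ρ g) e

section RootsOfUnity

variable {V : Type*} [AddCommGroup V] [Module ℂ V] [FiniteDimensional ℂ V]

theorem sum_pow_primitiveRoot {n : ℕ} {ζ : ℂ} (hζ : IsPrimitiveRoot ζ n) (hn : 0 < n) (t k : ℕ) :
    ∑ j ∈ Finset.range n, ζ ^ (j * t) * (ζ ^ (j * k))⁻¹ = if t ≡ k [MOD n] then (n : ℂ) else 0 := by
  have hζ0 : ζ ≠ 0 := hζ.ne_zero hn.ne'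
  have h1 : ∀ j, ζ ^ (j * t) * (ζ ^ (j * k))⁻¹ = (ζ ^ t * (ζ ^ k)⁻¹) ^ j := by
    intro j
    rw [mul_pow, inv_pow, ← pow_mul, ← pow_mul, mul_comm t, mul_comm k]
  simp_rw [h1]
  split_ifs with h
  · have : ζ ^ t * (ζ ^ k)⁻¹ = 1 := by
      rw [mul_inv_eq_one₀ (pow_ne_zero _ hζ0)]
      rw [pow_eq_pow_mod t hζ.pow_eq_one, pow_eq_pow_mod k hζ.pow_eq_one, h]
    simp [this]
  · have hne : ζ ^ t * (ζ ^ k)⁻¹ ≠ 1 := by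
      rw [Ne, mul_inv_eq_one₀ (pow_ne_zero _ hζ0)]
      intro h'
      apply h
      rw [pow_eq_pow_mod t hζ.pow_eq_one, pow_eq_pow_mod k hζ.pow_eq_one] at h'
      exact hζ.pow_inj (Nat.mod_lt _ hn) (Nat.mod_lt _ hn) h'
    have hp : (ζ ^ t * (ζ ^ k)⁻¹) ^ n = 1 := by
      rw [mul_pow, inv_pow, ← pow_mul, ← pow_mul, mul_comm t, mul_comm k, pow_mul, pow_mul,
        hζ.pow_eq_one]
      simp
    rw [geom_sum_eq hne, hp]
    simp

/-- The traces of the powers of an operator of finite order are given by the multiplicities of its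
eigenvalues. -/
theorem exists_trace_pow_eq {n : ℕ} {ζ : ℂ} (hζ : IsPrimitiveRoot ζ n) (hn : 0 < n)
    (A : Module.End ℂ V) (hA : A ^ n = 1) :
    ∃ r : ℕ → ℕ, ∀ t : ℕ, LinearMap.trace ℂ V (A ^ t) =
      ∑ j ∈ Finset.range n, (r j : ℂ) * ζ ^ (j * t) := by
  have hn0 : (n : ℂ) ≠ 0 := by exact_mod_cast hn.ne'
  have hζ0 : ζ ≠ 0 := hζ.ne_zero hn.ne'
  -- Discrete Fourier inversion: `P j` is the projection onto the `ζ ^ j`-eigenspace of `A`, and `r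
  -- j` will be its rank.
  let P : ℕ → Module.End ℂ V := fun j =>
    (n : ℂ)⁻¹ • ∑ k ∈ Finset.range n, (ζ ^ (j * k))⁻¹ • A ^ k
  have hAP : ∀ j, A * P j = ζ ^ j • P j := by
    intro j
    have h1 : ∀ k, A * ((ζ ^ (j * k))⁻¹ • A ^ k)
        = ζ ^ j • ((ζ ^ (j * (k + 1)))⁻¹ • A ^ (k + 1)) := by
      intro k
      rw [mul_smul_comm, ← pow_succ', smul_smul]
      congr 1
      rw [mul_add, mul_one, pow_add, mul_inv]
      field_simp
    simp only [P]
    rw [mul_smul_comm, Finset.mul_sum, Finset.sum_congr rfl fun k _ => h1 k, ← Finset.smul_sum,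
      smul_comm]
    congr 2
    have := Finset.sum_range_succ (fun k => (ζ ^ (j * k))⁻¹ • A ^ k) n
    rw [Finset.sum_range_succ'] at this
    have h2 : (ζ ^ (j * n))⁻¹ • A ^ n = (ζ ^ (j * 0))⁻¹ • A ^ 0 := by
      rw [mul_comm, pow_mul, hζ.pow_eq_one, hA]; simp
    rw [h2] at this
    exact add_right_cancel this
  have hAkP : ∀ j k, A ^ k * P j = ζ ^ (j * k) • P j := by
    intro j k
    induction k with
    | zero => simp
    | succ k ih =>
      rw [pow_succ, mul_assoc, hAP, mul_smul_comm, ih, smul_smul, mul_add, mul_one, pow_add,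
        mul_comm]
  have hPP : ∀ j, IsIdempotentElem (P j) := by
    intro j
    change P j * P j = P j
    conv_lhs => enter [1]; simp only [P]
    rw [smul_mul_assoc, Finset.sum_mul]
    have : ∀ k ∈ Finset.range n, ((ζ ^ (j * k))⁻¹ • A ^ k) * P j = P j := by
      intro k _
      rw [smul_mul_assoc, hAkP, smul_smul, inv_mul_cancel₀ (pow_ne_zero _ hζ0), one_smul]
    rw [Finset.sum_congr rfl this, Finset.sum_const, Finset.card_range, ← Nat.cast_smul_eq_nsmul ℂ,
      smul_smul, inv_mul_cancel₀ hn0, one_smul]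
  refine ⟨fun j => Module.finrank ℂ (LinearMap.range (P j)), fun t => ?_⟩
  have htr : ∀ j, LinearMap.trace ℂ V (P j) = (Module.finrank ℂ (LinearMap.range (P j)) : ℂ) :=
    fun j => (LinearMap.IsIdempotentElem.isProj_range _ (hPP j)).trace
  have hsum : ∑ j ∈ Finset.range n, ζ ^ (j * t) • P j = A ^ t := by
    simp only [P, Finset.smul_sum, smul_smul]
    rw [Finset.sum_comm]
    have : ∀ k ∈ Finset.range n, ∑ j ∈ Finset.range n, (ζ ^ (j * t) * ((n : ℂ)⁻¹ *
        (ζ ^ (j * k))⁻¹)) • A ^ k = if t % n = k then A ^ k else 0 := by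
      intro k hk
      rw [← Finset.sum_smul]
      have : ∑ j ∈ Finset.range n, (ζ ^ (j * t) * ((n : ℂ)⁻¹ * (ζ ^ (j * k))⁻¹)) =
          (n : ℂ)⁻¹ * (if t ≡ k [MOD n] then (n : ℂ) else 0) := by
        rw [← sum_pow_primitiveRoot hζ hn, Finset.mul_sum]
        exact Finset.sum_congr rfl fun j _ => by ring
      rw [this]
      have hiff : t ≡ k [MOD n] ↔ t % n = k := by
        rw [Nat.ModEq, Nat.mod_eq_of_lt (Finset.mem_range.mp hk)]
      simp only [hiff]
      split_ifs <;> simp [hn0]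
    rw [Finset.sum_congr rfl this, Finset.sum_ite_eq, if_pos (Finset.mem_range.mpr
      (Nat.mod_lt _ hn))]
    conv_rhs => rw [← Nat.mod_add_div t n, pow_add, pow_mul, hA, one_pow, mul_one]
  rw [← hsum, map_sum]
  refine Finset.sum_congr rfl fun j _ => ?_
  rw [map_smul, htr, smul_eq_mul, mul_comm]

end RootsOfUnity

theorem isIntegral_character {G V : Type*} [Group G] [Finite G] [AddCommGroup V] [Module ℂ V]
    [FiniteDimensional ℂ V] (ρ : Representation ℂ G V) (g : G) :
    IsIntegral ℤ (ρ.character g) := by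
  have hn : 0 < Nat.card G := Nat.card_pos
  have hζ := Complex.isPrimitiveRoot_exp (Nat.card G) hn.ne'
  obtain ⟨r, hr⟩ := exists_trace_pow_eq hζ hn (ρ g) (by rw [← map_pow, pow_card_eq_one', map_one])
  have := hr 1
  rw [pow_one] at this
  rw [Representation.character, this]
  refine IsIntegral.sum _ fun j _ => IsIntegral.mul ?_ ?_
  · exact isIntegral_algebraMap (R := ℤ) (x := (r j : ℤ)) |> fun h => by simpa using h
  · exact (hζ.isIntegral hn).pow _

/-- Galois conjugate characters differ by a power map. -/
theorem exists_coprime_of_galoisConjugate {G : Type*} [Group G] [Finite G] {χ ψ : G → ℂ}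
    (hχ : IsIrreducibleCharacter χ) (h : GaloisConjugate χ ψ) :
    ∃ t : ℕ, t.Coprime (Nat.card G) ∧ ∀ g, ψ g = χ (g ^ t) := by
  obtain ⟨n, hn, hdvd, α, hα⟩ := h
  obtain ⟨d, ρ, -, rfl⟩ := hχ
  have hζ := Complex.isPrimitiveRoot_exp n hn.ne'
  set ζ := Complex.exp (2 * Real.pi * Complex.I / n) with hζdef
  let z : cyclotomicSubfield n := ⟨ζ, IntermediateField.subset_adjoin _ _ hζ.pow_eq_one⟩
  have hz : IsPrimitiveRoot z n :=
    IsPrimitiveRoot.of_map_of_injective (f := (cyclotomicSubfield n).val) hζ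
      (cyclotomicSubfield n).val.injective
  have hαz : IsPrimitiveRoot ((α z : cyclotomicSubfield n) : ℂ) n :=
    (hz.map_of_injective (f := α) α.injective).map_of_injective
      (f := (cyclotomicSubfield n).val) (cyclotomicSubfield n).val.injective
  have : NeZero n := ⟨hn.ne'⟩
  -- `α` raises `ζ` to the power `t`, so it turns the eigenvalue sum for the trace of `ρ g` into the
  -- one for `ρ g ^ t`.
  obtain ⟨t, -, ht, hzt⟩ := hζ.isPrimitiveRoot_iff.mp hαz
  refine ⟨t, ht.coprime_dvd_right hdvd, fun g => ?_⟩
  have hg : (ρ g) ^ n = 1 := by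
    obtain ⟨m, rfl⟩ := hdvd
    rw [← map_pow, pow_mul, pow_card_eq_one', one_pow, map_one]
  obtain ⟨r, hr⟩ := exists_trace_pow_eq hζ hn (ρ g) hg
  obtain ⟨w, hw, hw'⟩ := hα g
  have hw2 : w = ∑ j ∈ Finset.range n, (r j : cyclotomicSubfield n) * z ^ j := by
    apply Subtype.ext
    have := hr 1
    rw [pow_one] at this
    rw [hw, Representation.character, this]
    push_cast
    simp [z]
  have h1 := hr t
  rw [← map_pow] at h1
  rw [Representation.character, h1, ← hw', hw2]
  simp only [map_sum, map_mul, map_natCast, map_pow]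
  push_cast
  refine Finset.sum_congr rfl fun j _ => ?_
  rw [← hzt, ← pow_mul, mul_comm t j]

end GaloisFrobenius

/-! ### Degrees, and characters over an invariant linear character -/

namespace GaloisFrobenius

open Representation

/-- The degree of an irreducible character divides the group order. -/
theorem IsIrreducible.finrank_dvd_card {G V : Type*} [Group G] [Finite G] [AddCommGroup V]
    [Module ℂ V] [FiniteDimensional ℂ V] (ρ : Representation ℂ G V) (hρ : ρ.IsIrreducible) :
    Module.finrank ℂ V ∣ Nat.card G := by
  classical
  have := Fintype.ofFinite G
  have hnt : Nontrivial V := ((isIrreducible_iff ρ).mp hρ).1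
  have hd : (Module.finrank ℂ V : ℂ) ≠ 0 := by
    exact_mod_cast Module.finrank_pos.ne'
  have hG : (Nat.card G : ℂ) ≠ 0 := by exact_mod_cast Nat.card_pos.ne'
  have : Invertible (Nat.card G : ℂ) := invertibleOfNonzero hG
  let A := integralClosure ℤ ℂ
  let c : G → A := fun g => ⟨ρ.character g⁻¹, isIntegral_character ρ g⁻¹⟩
  -- With coefficients in the ring `A` of algebraic integers, `z` is integral because the group ring
  -- is a finite `A`-module. By Schur's lemma and orthogonality `z` acts as the scalar `|G| / d`, a
  -- rational number which is thus an integer.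
  let z : MonoidAlgebra A G := ∑ g, MonoidAlgebra.single g (c g)
  let φ : MonoidAlgebra A G →ₐ[A] Module.End ℂ V := MonoidAlgebra.lift A (Module.End ℂ V) G ρ
  have hφz : φ z = ∑ g, ρ.character g⁻¹ • ρ g := by
    simp only [z, φ, map_sum, MonoidAlgebra.lift_single]
    rfl
  have hcomm : ∀ h, φ z * ρ h = ρ h * φ z := by
    intro h
    rw [hφz, Finset.sum_mul, Finset.mul_sum]
    refine Fintype.sum_equiv (MulAut.conj h⁻¹).toEquiv _ _ fun g => ?_
    simp only [MulEquiv.toEquiv_eq_coe, MulEquiv.coe_toEquiv, MulAut.conj_apply, inv_inv,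
      smul_mul_assoc, mul_smul_comm, ← map_mul]
    congr 1
    · rw [← ρ.char_conj g⁻¹ h⁻¹]
      congr 1
      group
    · congr 1
      group
  let f : IntertwiningMap ρ ρ := ⟨φ z, fun g => by
    ext v; exact LinearMap.congr_fun (hcomm g) v⟩
  obtain ⟨w, hw⟩ := (IsIrreducible.algebraMap_intertwiningMap_bijective_of_isAlgClosed (ρ := ρ)).2 f
  have hzw : φ z = w • (1 : Module.End ℂ V) := by
    have : (f : V →ₗ[ℂ] V) = φ z := rfl
    rw [← this, ← hw]
    ext v
    rfl
  have horth := char_orthonormal ρ ρ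
  rw [if_pos ⟨Representation.Equiv.refl ρ⟩, inv_mul_eq_one₀ hG] at horth
  have htr : w * Module.finrank ℂ V = Nat.card G := by
    have h1 : LinearMap.trace ℂ V (φ z) = w * Module.finrank ℂ V := by
      rw [hzw, map_smul, LinearMap.trace_one, smul_eq_mul]
    rw [← h1, hφz, map_sum, horth]
    refine Finset.sum_congr rfl fun g _ => ?_
    rw [map_smul, smul_eq_mul, mul_comm]
    rfl
  have hwint : IsIntegral ℤ w := by
    have h1 : IsIntegral A z := IsIntegral.of_finite A z
    have h2 : IsIntegral A (φ z) := h1.map φ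
    have h3 : φ z = (Algebra.ofId ℂ (Module.End ℂ V)).restrictScalars A w := by
      rw [hzw]; ext v; simp [Algebra.ofId_apply, Module.algebraMap_end_apply]
    rw [h3] at h2
    have h4 : IsIntegral A w := (isIntegral_algHom_iff _
      (fun a b hab => (algebraMap ℂ (Module.End ℂ V)).injective hab)).mp h2
    exact isIntegral_trans w h4
  have hrat : w = algebraMap ℚ ℂ ((Nat.card G : ℚ) / Module.finrank ℂ V) := by
    rw [map_div₀, map_natCast, map_natCast, eq_div_iff hd, htr]
  rw [hrat, isIntegral_algebraMap_iff (algebraMap ℚ ℂ).injective,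
    IsIntegrallyClosed.isIntegral_iff] at hwint
  obtain ⟨m, hm⟩ := hwint
  rw [← Int.natCast_dvd_natCast]
  refine ⟨m, ?_⟩
  have hdq : (Module.finrank ℂ V : ℚ) ≠ 0 := by exact_mod_cast Module.finrank_pos.ne'
  rw [eq_intCast, eq_div_iff hdq] at hm
  have : ((Nat.card G : ℤ) : ℚ) = ((Module.finrank ℂ V : ℤ) * m : ℤ) := by
    push_cast; rw [← hm]; ring
  exact_mod_cast this

section Wedderburn

variable {n : ℕ} (d : Fin n → ℕ)

/-- A block of size `d` is a sum of `d` copies of its column module. Together with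
`trace_mulLeft_single`, this decomposes the regular character along Wedderburn's isomorphism. -/
theorem trace_mulLeft_pi_matrix (x : Π i, Matrix (Fin (d i)) (Fin (d i)) ℂ) :
    LinearMap.trace ℂ _ (LinearMap.mulLeft ℂ x) = ∑ i, (d i : ℂ) * (x i).trace := by
  classical
  let b := Pi.basis (fun i => Matrix.stdBasis ℂ (Fin (d i)) (Fin (d i)))
  rw [LinearMap.trace_eq_matrix_trace ℂ b, Matrix.trace, Fintype.sum_sigma]
  refine Finset.sum_congr rfl fun i _ => ?_
  rw [Fintype.sum_prod_type, Matrix.trace, Finset.mul_sum]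
  refine Finset.sum_congr rfl fun j _ => ?_
  have : ∀ k, (LinearMap.toMatrix b b (LinearMap.mulLeft ℂ x)).diag ⟨i, j, k⟩ = x i j j := by
    intro k
    rw [Matrix.diag_apply, LinearMap.toMatrix_apply, LinearMap.mulLeft_apply]
    simp [b, Pi.basis_apply, Pi.basis_repr, Matrix.stdBasis_eq_single]
    rw [show (Matrix.stdBasis ℂ (Fin (d i)) (Fin (d i))).repr (x i * Matrix.single j k 1) (j, k) =
      (x i * Matrix.single j k 1 : Matrix (Fin (d i)) (Fin (d i)) ℂ) j k from rfl]
    simp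
  rw [Finset.sum_congr rfl fun k _ => this k]
  simp

theorem trace_mulLeft_single {G : Type*} [Group G] [Fintype G] [DecidableEq G] (g : G) :
    LinearMap.trace ℂ _ (LinearMap.mulLeft ℂ (MonoidAlgebra.single g (1 : ℂ))) =
      if g = 1 then (Nat.card G : ℂ) else 0 := by
  rw [LinearMap.trace_eq_matrix_trace ℂ (MonoidAlgebra.basis G ℂ), Matrix.trace]
  have : ∀ h, (LinearMap.toMatrix (MonoidAlgebra.basis G ℂ) (MonoidAlgebra.basis G ℂ)
      (LinearMap.mulLeft ℂ (MonoidAlgebra.single g (1 : ℂ)))).diag h = if g = 1 then 1 else 0 := by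
    intro h
    rw [Matrix.diag_apply, LinearMap.toMatrix_apply, LinearMap.mulLeft_apply,
      MonoidAlgebra.basis_apply, MonoidAlgebra.single_mul_single, mul_one,
      ← MonoidAlgebra.basis_apply, Module.Basis.repr_self, Finsupp.single_apply]
    simp
  rw [Finset.sum_congr rfl fun h _ => this h]
  split_ifs <;> simp

end Wedderburn

/-- Wedderburn writes the regular character as `∑ dᵢ χᵢ` with distinct irreducible `χᵢ`; this is
paired with `ν⁻¹` over `N`. Invariance of `ν` makes the averaging operator `E` commute with `G`, so
its range is zero or everything, and in the second case `N` acts through `ν`. Only those `χᵢ`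
contribute, each `|N| χᵢ(1) ^ 2`, to the total `|G|`. -/
theorem IrrOver.exists_finset_sum_sq {G : Type*} [Group G] [Finite G] (N : Subgroup G) [N.Normal]
    (ν : N →* ℂˣ) (hν : ∀ g n, ν (MulAut.conjNormal g n) = ν n) :
    ∃ S : Finset (G → ℂ), (∀ χ ∈ S, IrrOver N ν χ) ∧ ∑ χ ∈ S, χ 1 ^ 2 = (N.index : ℂ) := by
  classical
  have := Fintype.ofFinite G
  have hG : (Nat.card G : ℂ) ≠ 0 := by exact_mod_cast Nat.card_pos.ne'
  have hN : (Nat.card N : ℂ) ≠ 0 := by exact_mod_cast Nat.card_pos.ne'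
  have : NeZero (Nat.card G : ℂ) := ⟨hG⟩
  obtain ⟨n, d, hd, ⟨e⟩⟩ :=
    IsSemisimpleRing.exists_algEquiv_pi_matrix_of_isAlgClosed ℂ (MonoidAlgebra ℂ G)
  let ρ : ∀ i, Representation ℂ G (Fin (d i) → ℂ) := fun i =>
    ((Matrix.toLinAlgEquiv' : Matrix (Fin (d i)) (Fin (d i)) ℂ ≃ₐ[ℂ] _).toMonoidHom.comp
      ((Pi.evalMonoidHom (fun i => Matrix (Fin (d i)) (Fin (d i)) ℂ) i).comp
        ((e : MonoidAlgebra ℂ G →* _).comp (MonoidAlgebra.of ℂ G))))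
  have hρ : ∀ i g v, ρ i g v = (e (MonoidAlgebra.single g 1) i).mulVec v := fun i g v => by
    simp [ρ]
  have hchar : ∀ i g, (ρ i).character g = (e (MonoidAlgebra.single g 1) i).trace := by
    intro i g
    have : ρ i g = Matrix.toLin' (e (MonoidAlgebra.single g 1) i) := by
      refine LinearMap.ext fun v => ?_
      rw [hρ, Matrix.toLin'_apply]
    rw [Representation.character, this, Matrix.trace_toLin'_eq]
  have hirr : ∀ i, (ρ i).IsIrreducible := by
    intro i
    have := hd i
    rw [isIrreducible_iff]
    refine ⟨inferInstance, fun U hU => ?_⟩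
    by_cases hbot : U = ⊥
    · exact Or.inl hbot
    right
    have hall : ∀ a : MonoidAlgebra ℂ G, ∀ v ∈ U, (e a i).mulVec v ∈ U := by
      intro a
      induction a using MonoidAlgebra.induction_linear with
      | zero => intro v _; simp
      | add x y hx hy =>
        intro v hv
        rw [map_add, Pi.add_apply, Matrix.add_mulVec]
        exact U.add_mem (hx v hv) (hy v hv)
      | single g c =>
        intro v hv
        have h1 : MonoidAlgebra.single g c = c • MonoidAlgebra.single g (1 : ℂ) := by simp
        rw [h1, map_smul, Pi.smul_apply, Matrix.smul_mulVec, ← hρ]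
        exact U.smul_mem _ (hU g v hv)
    obtain ⟨v, hv, hv0⟩ := U.ne_bot_iff.mp hbot
    obtain ⟨j, hj⟩ := Function.ne_iff.mp hv0
    rw [eq_top_iff]
    intro w _
    -- A rank-one matrix taking `v` to `w`.
    let B : Matrix (Fin (d i)) (Fin (d i)) ℂ := Matrix.vecMulVec w (Pi.single j (v j)⁻¹)
    have hB := hall (e.symm (Pi.single i B)) v hv
    rw [e.apply_symm_apply, Pi.single_eq_same, Matrix.vecMulVec_mulVec] at hB
    simpa [hj, inv_mul_cancel₀ (show v j ≠ 0 from hj)] using hB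
  have hinj : Function.Injective fun i => (ρ i).character := by
    intro i j hij
    by_contra hne
    have hall : ∀ a : MonoidAlgebra ℂ G, (e a i).trace = (e a j).trace := by
      intro a
      induction a using MonoidAlgebra.induction_linear with
      | zero => simp
      | add x y hx hy => simp [Matrix.trace_add, hx, hy]
      | single g c =>
        have h1 : MonoidAlgebra.single g c = c • MonoidAlgebra.single g (1 : ℂ) := by simp
        rw [h1, map_smul, Pi.smul_apply, Pi.smul_apply, Matrix.trace_smul, Matrix.trace_smul,
          ← hchar, ← hchar]
        exact congrArg (c • ·) (congrFun hij g)
    have h2 := hall (e.symm (Pi.single i 1))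
    rw [e.apply_symm_apply, Pi.single_eq_same, Pi.single_eq_of_ne (Ne.symm hne)] at h2
    have := (hd i).out
    simp [this] at h2
  have hreg : ∀ g, ∑ i, (d i : ℂ) * (ρ i).character g = if g = 1 then (Nat.card G : ℂ) else 0 := by
    intro g
    rw [← trace_mulLeft_single, ← LinearMap.trace_conj' _ e.toLinearEquiv]
    have : e.toLinearEquiv.conj (LinearMap.mulLeft ℂ (MonoidAlgebra.single g (1 : ℂ))) =
        LinearMap.mulLeft ℂ (e (MonoidAlgebra.single g 1)) := by
      refine LinearMap.ext fun v => ?_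
      simp [LinearEquiv.conj_apply]
    rw [this, trace_mulLeft_pi_matrix]
    simp [hchar]
  let isOver : Fin n → Prop := fun i => ∀ m : N, ρ i m = (ν m : ℂ) • (1 : Module.End ℂ _)
  have hT : ∀ i, ∑ m : N, ((ν m)⁻¹ : ℂˣ) * (ρ i).character m =
      if isOver i then (Nat.card N : ℂ) * d i else 0 := by
    intro i
    let E : Module.End ℂ (Fin (d i) → ℂ) := ∑ m : N, (((ν m)⁻¹ : ℂˣ) : ℂ) • ρ i m
    have hE : LinearMap.trace ℂ _ E = ∑ m : N, ((ν m)⁻¹ : ℂˣ) * (ρ i).character m := by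
      simp [E, Representation.character]
    rw [← hE]
    have hmE : ∀ m : N, ρ i m * E = (ν m : ℂ) • E := by
      intro m
      simp only [E]
      rw [Finset.mul_sum, Finset.smul_sum]
      refine Fintype.sum_equiv (Equiv.mulLeft m) _ _ fun k => ?_
      rw [mul_smul_comm, ← map_mul, smul_smul]
      have hk : (ν m : ℂ) * (((ν (Equiv.mulLeft m k))⁻¹ : ℂˣ) : ℂ) = (((ν k)⁻¹ : ℂˣ) : ℂ) := by
        rw [← Units.val_mul, Equiv.coe_mulLeft, map_mul, mul_inv, mul_inv_cancel_left]
      rw [hk]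
      rfl
    have hgE : ∀ g, ρ i g * E = E * ρ i g := by
      intro g
      simp only [E]
      rw [Finset.mul_sum, Finset.sum_mul]
      refine Fintype.sum_equiv (MulAut.conjNormal g).toEquiv _ _ fun k => ?_
      rw [mul_smul_comm, smul_mul_assoc, ← map_mul, ← map_mul]
      simp [hν]
    split_ifs with h
    · have h1 : E = (Nat.card N : ℂ) • 1 := by
        simp only [E]
        have : ∀ m : N, (((ν m)⁻¹ : ℂˣ) : ℂ) • ρ i m = 1 := by
          intro m
          rw [h m, smul_smul]
          simp
        rw [Finset.sum_congr rfl fun m _ => this m, Finset.sum_const, Finset.card_univ,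
          ← Nat.card_eq_fintype_card, Nat.cast_smul_eq_nsmul]
      rw [h1]
      simp
    · rcases ((isIrreducible_iff _).mp (hirr i)).2 (LinearMap.range E) (by
        rintro g _ ⟨v, rfl⟩
        exact ⟨ρ i g v, (LinearMap.congr_fun (hgE g) v).symm⟩) with h1 | h1
      · rw [LinearMap.range_eq_bot.mp h1, map_zero]
      · exfalso
        apply h
        intro m
        refine LinearMap.ext fun v => ?_
        obtain ⟨w, rfl⟩ := LinearMap.range_eq_top.mp h1 v
        exact LinearMap.congr_fun (hmE m) w
  refine ⟨(Finset.univ.filter isOver).image fun i => (ρ i).character, ?_, ?_⟩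
  · intro χ hχ
    obtain ⟨i, hi, rfl⟩ := Finset.mem_image.mp hχ
    exact ⟨d i, ρ i, hirr i, rfl, (Finset.mem_filter.mp hi).2⟩
  · rw [Finset.sum_image fun i _ j _ h => hinj h, Finset.sum_filter]
    have h1 : ∑ m : N, (((ν m)⁻¹ : ℂˣ) : ℂ) * ∑ i, (d i : ℂ) * (ρ i).character m =
        (Nat.card N : ℂ) * ∑ i, if isOver i then (ρ i).character 1 ^ 2 else 0 := by
      simp_rw [Finset.mul_sum]
      rw [Finset.sum_comm]
      refine Finset.sum_congr rfl fun i _ => ?_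
      have : ∀ m : N, (((ν m)⁻¹ : ℂˣ) : ℂ) * ((d i : ℂ) * (ρ i).character m) =
          d i * ((((ν m)⁻¹ : ℂˣ) : ℂ) * (ρ i).character m) := fun m => by ring
      simp_rw [this]
      rw [← Finset.mul_sum, hT]
      split_ifs
      · rw [char_one, Module.finrank_fin_fun]; ring
      · simp
    have h2 : ∑ m : N, (((ν m)⁻¹ : ℂˣ) : ℂ) * ∑ i, (d i : ℂ) * (ρ i).character m =
        Nat.card G := by
      simp_rw [hreg]
      rw [Finset.sum_eq_single 1]
      · simp
      · intro m _ hm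
        simp [hm]
      · simp
    rw [h2, ← N.card_mul_index, Nat.cast_mul] at h1
    exact (mul_left_cancel₀ hN h1).symm

end GaloisFrobenius

/-! ### Linear characters under a fixed-point-free action -/

namespace GaloisFrobenius

open Representation

namespace IrrOver

variable {K : Type*} [Group K] {M : Subgroup K} {lam : M →* ℂˣ} {χ : K → ℂ}

theorem mono {N : Subgroup K} (hN : N ≤ M) (h : IrrOver M lam χ) :
    IrrOver N (lam.comp (Subgroup.inclusion hN)) χ := by
  obtain ⟨d, ρ, h1, h2, h3⟩ := h
  exact ⟨d, ρ, h1, h2, fun m => h3 (Subgroup.inclusion hN m)⟩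

theorem apply_mul (h : IrrOver M lam χ) (g : K) (m : M) : χ (g * m) = lam m * χ g := by
  obtain ⟨d, ρ, -, rfl, h3⟩ := h
  rw [Representation.character, Representation.character, map_mul, h3, mul_smul_comm, mul_one,
    map_smul, smul_eq_mul]

theorem apply_conj (h : IrrOver M lam χ) (g k : K) : χ (k * g * k⁻¹) = χ g := by
  obtain ⟨d, ρ, -, rfl, -⟩ := h
  exact ρ.char_conj g k

theorem exists_degree [Finite K] (h : IrrOver M lam χ) :
    ∃ d : ℕ, 0 < d ∧ χ 1 = d ∧ d ∣ Nat.card K := by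
  obtain ⟨d, ρ, h1, rfl, -⟩ := h
  have hnt := ((isIrreducible_iff ρ).mp h1).1
  refine ⟨Module.finrank ℂ (Fin d → ℂ), Module.finrank_pos, ρ.char_one,
    IsIrreducible.finrank_dvd_card ρ h1⟩

theorem apply_one_ne_zero [Finite K] (h : IrrOver M lam χ) : χ 1 ≠ 0 := by
  obtain ⟨d, hd, h1, -⟩ := h.exists_degree
  rw [h1]
  exact_mod_cast hd.ne'

theorem apply_coe (h : IrrOver M lam χ) (m : M) : χ m = lam m * χ 1 := by
  simpa using h.apply_mul 1 m

theorem sum_mul_inv [Fintype K] (h : IrrOver M lam χ) : ∑ g, χ g * χ g⁻¹ = Nat.card K := by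
  obtain ⟨d, ρ, h1, rfl, -⟩ := h
  have hG : (Nat.card K : ℂ) ≠ 0 := by exact_mod_cast Nat.card_pos.ne'
  have : Invertible (Nat.card K : ℂ) := invertibleOfNonzero hG
  have horth := char_orthonormal ρ ρ
  rw [if_pos ⟨Representation.Equiv.refl ρ⟩, inv_mul_eq_one₀ hG] at horth
  exact horth.symm

end IrrOver

section Action

variable (L K : Type*) [Group L] [Group K] [MulDistribMulAction L K]

/-- Only the identity of `K` is fixed by a nontrivial element of `L`. -/
def IsFixedPointFree : Prop := ∀ l : L, l ≠ 1 → ∀ k : K, l • k = k → k = 1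

/-- Irreducible characters of `K` of the same degree, lying over nontrivial linear characters of
an `L`-invariant normal subgroup, are conjugate under `L` and power maps. -/
def IsGaloisTransitive : Prop :=
  ∀ M : Subgroup K, M.Normal → (∀ l : L, ∀ m ∈ M, l • m ∈ M) →
    ∀ lam₁ lam₂ : M →* ℂˣ, lam₁ ≠ 1 → lam₂ ≠ 1 → ∀ χ₁ χ₂ : K → ℂ,
      IrrOver M lam₁ χ₁ → IrrOver M lam₂ χ₂ → χ₁ 1 = χ₂ 1 →
        ∃ (l : L) (t : ℕ), t.Coprime (Nat.card K) ∧ ∀ g, χ₂ g = χ₁ (l • g ^ t)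

variable {L K}

/-- The map `k ↦ k / l • k` is injective when `l` fixes only the identity, hence onto the finite
group `M`. -/
theorem IsFixedPointFree.exists_div_smul_eq [Finite K] (h : IsFixedPointFree L K) {l : L}
    (hl : l ≠ 1) (M : Subgroup K) (hM : ∀ l : L, ∀ m ∈ M, l • m ∈ M) {m : K} (hm : m ∈ M) :
    ∃ k ∈ M, k / (l • k) = m := by
  let φ : M →* M := ((MulDistribMulAction.toMonoidHom K l).comp M.subtype).codRestrict M
    fun m => hM l m m.2
  have hφ : MonoidHom.FixedPointFree φ := fun k hk => by
    have := h l hl k (congrArg Subtype.val hk)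
    exact Subtype.ext this
  obtain ⟨k, hk⟩ := hφ.commutatorMap_surjective ⟨m, hm⟩
  exact ⟨k, k.2, congrArg Subtype.val hk⟩

/-- Every element of `M` has the form `k / l • k`, which an `l`-invariant linear character kills. -/
theorem IsFixedPointFree.eq_one_of_forall_smul [Finite K] (h : IsFixedPointFree L K)
    (M : Subgroup K) (hM : ∀ l : L, ∀ m ∈ M, l • m ∈ M) {lam : M →* ℂˣ} (hlam : lam ≠ 1) {l : L}
    (hl : ∀ m : M, lam ⟨l • m, hM l m m.2⟩ = lam m) : l = 1 := by
  by_contra hne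
  apply hlam
  ext1 ⟨m, hm⟩
  obtain ⟨k, hk, rfl⟩ := h.exists_div_smul_eq hne M hM hm
  have : (⟨k / l • k, hm⟩ : M) = ⟨k, hk⟩ / ⟨l • k, hM l k hk⟩ := rfl
  rw [this, map_div, hl ⟨k, hk⟩]
  simp

/-- The conjugate by `x : L` of a linear character of an `L`-invariant subgroup. -/
def twist {M : Subgroup K} (hM : ∀ l : L, ∀ m ∈ M, l • m ∈ M) (lam : M →* ℂˣ) (x : L) : M →* ℂˣ :=
  lam.comp
    (((MulDistribMulAction.toMonoidHom K x).comp M.subtype).codRestrict M fun m => hM x m m.2)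

theorem twist_apply {M : Subgroup K} (hM : ∀ l : L, ∀ m ∈ M, l • m ∈ M) (lam : M →* ℂˣ) (x : L)
    (m : M) : twist hM lam x m = lam ⟨x • (m : K), hM x m m.2⟩ := rfl

theorem IsFixedPointFree.twist_injective [Finite K] (h : IsFixedPointFree L K) {M : Subgroup K}
    (hM : ∀ l : L, ∀ m ∈ M, l • m ∈ M) {lam : M →* ℂˣ} (hlam : lam ≠ 1) :
    Function.Injective (twist hM lam) := by
  intro x y hxy
  have : x * y⁻¹ = 1 := by
    refine h.eq_one_of_forall_smul M hM hlam fun m => ?_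
    have := DFunLike.congr_fun hxy ⟨y⁻¹ • m, hM _ _ m.2⟩
    simpa [twist_apply, smul_smul] using this
  exact mul_inv_eq_one.mp this

open scoped Classical in
theorem sum_mul_inv_eq_ite {M : Type*} [Group M] [Fintype M] (α β : M →* ℂˣ) :
    ∑ m : M, (α m : ℂ) * (((β m)⁻¹ : ℂˣ) : ℂ) = if α = β then (Nat.card M : ℂ) else 0 := by
  have h5 := sum_hom_units ((Units.coeHom ℂ).comp (α * β⁻¹))
  have h6 : ((Units.coeHom ℂ).comp (α * β⁻¹) = 1) ↔ α = β := by
    constructor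
    · intro h
      rw [← mul_inv_eq_one]
      ext1 m
      exact Units.ext (DFunLike.congr_fun h m)
    · rintro rfl
      ext m
      simp
  simpa [h6] using h5

/-- If `l` fixes the image of `k`, then `k / l • k` lies in the kernel and equals `n / l • n` with
`n` in the kernel. So `n⁻¹ * k` is fixed by `l`, and `k = n`. -/
theorem IsFixedPointFree.of_surjective [Finite K] {K' : Type*} [Group K'] [MulDistribMulAction L K']
    (h : IsFixedPointFree L K) (f : K →* K') (hf : Function.Surjective f)
    (hfl : ∀ (l : L) k, f (l • k) = l • f k) : IsFixedPointFree L K' := by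
  intro l hl k' hk'
  obtain ⟨k, rfl⟩ := hf k'
  have hk : k / l • k ∈ f.ker := by
    rw [MonoidHom.mem_ker, map_div, hfl, hk', div_self']
  obtain ⟨n, hn, hnk⟩ := h.exists_div_smul_eq hl f.ker (fun l m hm => by
    rw [MonoidHom.mem_ker] at hm ⊢
    rw [hfl, hm, smul_one]) hk
  have : n⁻¹ * k = 1 := by
    apply h l hl
    rw [smul_mul', smul_inv', inv_mul_eq_iff_eq_mul]
    have h1 : l • k = l • n * n⁻¹ * k := by
      rw [div_eq_mul_inv, div_eq_mul_inv] at hnk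
      have h2 := congrArg (·⁻¹) hnk
      simp only [mul_inv_rev, inv_inv] at h2
      rw [h2, inv_mul_cancel_right]
    rw [h1, mul_assoc]
  rw [inv_mul_eq_one] at this
  rw [← this]
  exact hn

theorem IsGaloisTransitive.of_surjective {K' : Type*} [Group K'] [Finite K]
    [MulDistribMulAction L K']
    (h : IsGaloisTransitive L K) (f : K →* K') (hf : Function.Surjective f)
    (hfl : ∀ (l : L) k, f (l • k) = l • f k) : IsGaloisTransitive L K' := by
  intro M hM hML lam₁ lam₂ h₁ h₂ χ₁ χ₂ hχ₁ hχ₂ hdeg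
  let f' : M.comap f →* M := f.subgroupComap M
  have hf' : Function.Surjective f' := f.subgroupComap_surjective_of_surjective M hf
  have hne : ∀ lam : M →* ℂˣ, lam ≠ 1 → lam.comp f' ≠ 1 := by
    intro lam hlam h
    apply hlam
    ext1 m
    obtain ⟨x, rfl⟩ := hf' m
    exact DFunLike.congr_fun h x
  have hover : ∀ (lam : M →* ℂˣ) χ, IrrOver M lam χ → IrrOver (M.comap f) (lam.comp f') (χ ∘ f) := by
    rintro lam χ ⟨d, ρ, h1, rfl, h3⟩
    exact ⟨d, ρ.comp f, isIrreducible_comp ρ h1 f hf, rfl, fun m => h3 (f' m)⟩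
  obtain ⟨l, t, ht, hg⟩ := h (M.comap f) (hM.comap f)
    (fun l m hm => by rw [Subgroup.mem_comap] at hm ⊢; rw [hfl]; exact hML l _ hm)
    _ _ (hne _ h₁) (hne _ h₂) _ _ (hover _ _ hχ₁) (hover _ _ hχ₂) (by simpa using hdeg)
  refine ⟨l, t, ht.coprime_dvd_right (Subgroup.card_dvd_of_surjective f hf), fun g => ?_⟩
  obtain ⟨k, rfl⟩ := hf g
  have := hg k
  simpa [hfl] using this

end Action

/-! ### Induction to `K ⋊ L` and the meaning of `GC*` on the kernel -/

section Induction

variable {L K : Type*} [Group L] [Group K] [MulDistribMulAction L K]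

/-- The representation of `K ⋊ L` induced from a representation of `K`, realised on the functions
on `L`. -/
def indRep {V : Type*} [AddCommGroup V] [Module ℂ V] (ρ : Representation ℂ K V) :
    Representation ℂ (K ⋊[MulDistribMulAction.toMulAut L K] L) (L → V) where
  toFun g :=
    { toFun := fun f x => ρ (x • g.left) (f (x * g.right))
      map_add' := fun f f' => by ext x; simp
      map_smul' := fun c f => by ext x; simp }
  map_one' := by ext f x; simp
  map_mul' g h := by
    refine LinearMap.ext fun f => funext fun x => ?_
    simp [mul_smul, mul_assoc]

theorem indRep_apply {V : Type*} [AddCommGroup V] [Module ℂ V] (ρ : Representation ℂ K V)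
    (g : K ⋊[MulDistribMulAction.toMulAut L K] L) (f : L → V) (x : L) :
    indRep ρ g f x = ρ (x • g.left) (f (x * g.right)) := rfl

theorem character_indRep_inl [Fintype L] {d : ℕ} (ρ : Representation ℂ K (Fin d → ℂ)) (k : K) :
    (indRep (L := L) ρ).character (SemidirectProduct.inl k) = ∑ x : L, ρ.character (x • k) := by
  classical
  let b : Module.Basis (Fin d) ℂ (Fin d → ℂ) := Pi.basisFun ℂ (Fin d)
  rw [Representation.character, LinearMap.trace_eq_matrix_trace ℂ (Pi.basis fun _ : L => b),
    Matrix.trace, Fintype.sum_sigma]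
  refine Finset.sum_congr rfl fun x _ => ?_
  rw [Representation.character, LinearMap.trace_eq_matrix_trace ℂ b, Matrix.trace]
  refine Finset.sum_congr rfl fun i _ => ?_
  rw [Matrix.diag_apply, Matrix.diag_apply, LinearMap.toMatrix_apply, LinearMap.toMatrix_apply,
    Pi.basis_repr, indRep_apply]
  simp [Pi.basis_apply]

/-- `M` acts on the summand at `x` through the twist of `lam` by `x`, and these twists are distinct.
So an invariant subspace contains the components of its vectors; irreducibility of `ρ` fills one
summand and `L` carries it to the others. -/
theorem isIrreducible_indRep [Finite L] [Finite K] (hfpf : IsFixedPointFree L K) (M : Subgroup K)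
    (hML : ∀ l : L, ∀ m ∈ M, l • m ∈ M) (lam : M →* ℂˣ) (hlam : lam ≠ 1) {d : ℕ}
    (ρ : Representation ℂ K (Fin d → ℂ)) (hρ : ρ.IsIrreducible)
    (hρM : ∀ m : M, ρ m = (lam m : ℂ) • (1 : Module.End ℂ (Fin d → ℂ))) :
    (indRep (L := L) ρ).IsIrreducible := by
  classical
  have := Fintype.ofFinite L
  have := Fintype.ofFinite K
  have hM0 : (Nat.card M : ℂ) ≠ 0 := by exact_mod_cast Nat.card_pos.ne'
  have hirr := (isIrreducible_iff ρ).mp hρ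
  have := hirr.1
  rw [isIrreducible_iff]
  refine ⟨inferInstance, fun U hU => ?_⟩
  let tw := twist hML lam
  have htw : ∀ x y, tw x = tw y → x = y := hfpf.twist_injective hML hlam
  have hproj : ∀ f ∈ U, ∀ x, Pi.single x (f x) ∈ U := by
    intro f hf x
    have h1 : ∑ m : M, (((tw x m)⁻¹ : ℂˣ) : ℂ) • indRep ρ (SemidirectProduct.inl (m : K)) f ∈ U :=
      U.sum_mem fun m _ => U.smul_mem _ (hU _ _ hf)
    have h2 : ∑ m : M, (((tw x m)⁻¹ : ℂˣ) : ℂ) • indRep ρ (SemidirectProduct.inl (m : K)) f =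
        (Nat.card M : ℂ) • Pi.single x (f x) := by
      ext1 y
      rw [Finset.sum_apply]
      have h3 : ∀ m : M, ((((tw x m)⁻¹ : ℂˣ) : ℂ) •
          indRep ρ (SemidirectProduct.inl (m : K)) f) y =
          ((tw y m : ℂ) * (((tw x m)⁻¹ : ℂˣ) : ℂ)) • f y := by
        intro m
        have h4 : ρ (y • (m : K)) = (tw y m : ℂ) • 1 := hρM ⟨y • (m : K), hML y m m.2⟩
        rw [Pi.smul_apply, indRep_apply]
        simp only [SemidirectProduct.left_inl, SemidirectProduct.right_inl, mul_one, h4]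
        rw [LinearMap.smul_apply, smul_smul, mul_comm]
        rfl
      rw [Finset.sum_congr rfl fun m _ => h3 m, ← Finset.sum_smul]
      rw [sum_mul_inv_eq_ite, Pi.smul_apply]
      by_cases hxy : y = x
      · subst hxy
        simp
      · rw [if_neg fun h => hxy (htw _ _ h)]
        simp [hxy]
    rw [h2] at h1
    exact (U.smul_mem_iff hM0).mp h1
  by_cases hbot : U = ⊥
  · exact Or.inl hbot
  right
  obtain ⟨f, hf, hf0⟩ := U.ne_bot_iff.mp hbot
  obtain ⟨x, hx⟩ := Function.ne_iff.mp hf0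
  have hfull : ∀ v, Pi.single x v ∈ U := by
    rcases hirr.2 (U.comap (LinearMap.single ℂ (fun _ : L => Fin d → ℂ) x)) (by
      intro k v hv
      have := hU (SemidirectProduct.inl (x⁻¹ • k)) _ hv
      have h7 : indRep ρ (SemidirectProduct.inl (x⁻¹ • k)) (Pi.single x v) =
          Pi.single x (ρ k v) := by
        ext1 y
        rw [indRep_apply]
        by_cases hxy : y = x
        · subst hxy
          simp
        · simp [hxy]
      simpa [h7] using this) with h | h
    · exfalso
      apply hx
      have : f x ∈ U.comap (LinearMap.single ℂ (fun _ : L => Fin d → ℂ) x) := hproj f hf x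
      rw [h] at this
      simpa using this
    · intro v
      have : v ∈ U.comap (LinearMap.single ℂ (fun _ : L => Fin d → ℂ) x) := h ▸ Submodule.mem_top
      exact this
  have hall : ∀ y v, Pi.single y v ∈ U := by
    intro y v
    have := hU (SemidirectProduct.inr (y⁻¹ * x)) _ (hfull v)
    have h7 : indRep ρ (SemidirectProduct.inr (y⁻¹ * x)) (Pi.single x v) =
        Pi.single y v := by
      ext1 z
      rw [indRep_apply]
      by_cases hxy : z = y
      · subst hxy
        simp
      · have h8 : z * (y⁻¹ * x) ≠ x := fun h => hxy (by
          rw [← mul_assoc, mul_eq_right, mul_inv_eq_one] at h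
          exact h)
        simp [Pi.single_eq_of_ne hxy, Pi.single_eq_of_ne h8]
    rwa [h7] at this
  rw [eq_top_iff]
  intro w _
  rw [← Finset.univ_sum_single w]
  exact U.sum_mem fun y _ => hall y _

/-- The induced characters are irreducible and nonlinear, of equal degree, so one is the other
composed with a power map. On `K` this equates two sums of `L`-conjugates. In the `lam₂`-part under
`M` at most one term survives on each side, since the twists of `lam₁` remain distinct after raising
to a power `t` prime to `|K|`. -/
theorem isGaloisTransitive_of_isGCStar [Finite L] [Finite K] [Nontrivial L]
    (hfpf : IsFixedPointFree L K) (hGC : IsGCStar (K ⋊[MulDistribMulAction.toMulAut L K] L)) :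
    IsGaloisTransitive L K := by
  classical
  have := Fintype.ofFinite L
  have := Fintype.ofFinite K
  rintro M hM hML lam₁ lam₂ h₁ h₂ χ₁ χ₂ hχ₁ hχ₂ hdeg
  have hχ₁' := hχ₁
  have hχ₂' := hχ₂
  obtain ⟨d₁, ρ₁, hi₁, rfl, hs₁⟩ := hχ₁
  obtain ⟨d₂, ρ₂, hi₂, rfl, hs₂⟩ := hχ₂
  have hM0 : (Nat.card M : ℂ) ≠ 0 := by exact_mod_cast Nat.card_pos.ne'
  have hfin : Finite (K ⋊[MulDistribMulAction.toMulAut L K] L) :=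
    Finite.of_equiv _ SemidirectProduct.equivProd.symm
  have hI₁ := isIrreducible_indRep hfpf M hML lam₁ h₁ ρ₁ hi₁ hs₁
  have hI₂ := isIrreducible_indRep hfpf M hML lam₂ h₂ ρ₂ hi₂ hs₂
  have hone : ∀ {d : ℕ} (ρ : Representation ℂ K (Fin d → ℂ)),
      (indRep (L := L) ρ).character 1 = Nat.card L * ρ.character 1 := by
    intro d ρ
    have := character_indRep_inl (L := L) ρ 1
    rw [map_one] at this
    rw [this]
    simp
  have hnl : ∀ {d : ℕ} (ρ : Representation ℂ K (Fin d → ℂ)),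
      (indRep (L := L) ρ).character 1 ≠ 1 := by
    intro d ρ h
    rw [hone, char_one, ← Nat.cast_mul, Nat.cast_eq_one, mul_eq_one] at h
    exact Finite.one_lt_card.ne' h.1
  obtain ⟨t, ht, hconj⟩ := exists_coprime_of_galoisConjugate
    (isIrreducibleCharacter_character _ hI₁)
    (hGC _ _ (isIrreducibleCharacter_character _ hI₁) (isIrreducibleCharacter_character _ hI₂)
      (hnl ρ₁) (hnl ρ₂) (by rw [hone, hone, hdeg]))
  have htK : t.Coprime (Nat.card K) := ht.coprime_dvd_right
    (Subgroup.card_dvd_of_injective (SemidirectProduct.inl (φ := MulDistribMulAction.toMulAut L K))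
      SemidirectProduct.inl_injective)
  have hsum : ∀ k : K, ∑ x : L, ρ₂.character (x • k) = ∑ x : L, ρ₁.character (x • k ^ t) := by
    intro k
    have := hconj (SemidirectProduct.inl k)
    rwa [← map_pow, character_indRep_inl, character_indRep_inl] at this
  let tw := fun lam : M →* ℂˣ => twist hML lam
  have htw : ∀ lam : M →* ℂˣ, lam ≠ 1 → ∀ x y, tw lam x = tw lam y → x = y :=
    fun lam hlam => hfpf.twist_injective hML hlam
  have hpowinj : ∀ α β : M →* ℂˣ, α ^ t = β ^ t → α = β := by
    intro α β hαβ
    ext1 m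
    have h1 : (α m * (β m)⁻¹) ^ t = 1 := by
      rw [mul_pow, inv_pow, mul_inv_eq_one]
      exact DFunLike.congr_fun hαβ m
    have h2 : (α m * (β m)⁻¹) ^ Nat.card M = 1 := by
      rw [mul_pow, inv_pow, ← map_pow, ← map_pow, pow_card_eq_one', map_one, map_one]
      simp
    have h3 := Nat.dvd_gcd (orderOf_dvd_of_pow_eq_one h1) (orderOf_dvd_of_pow_eq_one h2)
    rw [(htK.coprime_dvd_right M.card_subgroup_dvd_card).gcd_eq_one, Nat.dvd_one,
      orderOf_eq_one_iff, mul_inv_eq_one] at h3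
    exact h3
  have hmul : ∀ (m : M) (k : K), ∑ x : L, (tw lam₂ x m : ℂ) * ρ₂.character (x • k) =
      ∑ x : L, (((tw lam₁ x) ^ t) m : ℂˣ) * ρ₁.character (x • k ^ t) := by
    intro m k
    have h1 : ∀ x : L, (tw lam₂ x m : ℂ) * ρ₂.character (x • k) =
        ρ₂.character (x • (k * m)) := by
      intro x
      rw [smul_mul']
      exact (hχ₂'.apply_mul (x • k) ⟨x • (m : K), hML x m m.2⟩).symm
    have h2 : ∀ x : L, ((((tw lam₁ x) ^ t) m : ℂˣ) : ℂ) * ρ₁.character (x • k ^ t) =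
        ρ₁.character (x • (k * m) ^ t) := by
      intro x
      have h3 : ρ₁ (x • (m : K)) = (tw lam₁ x m : ℂ) • 1 := hs₁ ⟨x • (m : K), hML x m m.2⟩
      rw [Representation.character, Representation.character, smul_pow', smul_pow',
        map_pow ρ₁, map_pow ρ₁, smul_mul', map_mul ρ₁, h3, mul_smul_comm, mul_one, smul_pow,
        LinearMap.map_smul, smul_eq_mul, MonoidHom.pow_apply, Units.val_pow_eq_pow_val]
    rw [Finset.sum_congr rfl fun x _ => h1 x, Finset.sum_congr rfl fun x _ => h2 x, hsum]
  -- Multiply `hmul` by `lam₂⁻¹` and sum over `M`: on the left only `x = 1` contributes.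
  have hproj : ∀ k : K, ρ₂.character k =
      ∑ x : L, if (tw lam₁ x) ^ t = lam₂ then ρ₁.character (x • k ^ t) else 0 := by
    intro k
    have h1 : ∑ m : M, (∑ x : L, (tw lam₂ x m : ℂ) * ρ₂.character (x • k)) *
        (((lam₂ m)⁻¹ : ℂˣ) : ℂ) = Nat.card M * ρ₂.character k := by
      simp_rw [Finset.sum_mul]
      rw [Finset.sum_comm, Finset.sum_eq_single 1]
      · have : tw lam₂ 1 = lam₂ := by
          ext1 m
          simp [tw, twist_apply]
        simp_rw [this, one_smul, mul_right_comm _ (ρ₂.character k)]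
        rw [← Finset.sum_mul, sum_mul_inv_eq_ite, if_pos rfl]
      · intro x _ hx
        simp_rw [mul_right_comm _ (ρ₂.character (x • k))]
        rw [← Finset.sum_mul, sum_mul_inv_eq_ite, if_neg, zero_mul]
        intro h
        apply hx
        apply htw lam₂ h₂
        rw [h]
        ext1 m
        simp [tw, twist_apply]
      · simp
    have h2 : ∑ m : M, (∑ x : L, ((((tw lam₁ x) ^ t) m : ℂˣ) : ℂ) * ρ₁.character (x • k ^ t)) *
        (((lam₂ m)⁻¹ : ℂˣ) : ℂ) = Nat.card M *
        ∑ x : L, if (tw lam₁ x) ^ t = lam₂ then ρ₁.character (x • k ^ t) else 0 := by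
      simp_rw [Finset.sum_mul]
      rw [Finset.sum_comm, Finset.mul_sum]
      refine Finset.sum_congr rfl fun x _ => ?_
      simp_rw [mul_right_comm _ (ρ₁.character (x • k ^ t))]
      rw [← Finset.sum_mul, sum_mul_inv_eq_ite]
      split_ifs <;> simp
    simp_rw [hmul] at h1
    rw [h2] at h1
    exact (mul_left_cancel₀ hM0 h1).symm
  obtain ⟨x, hx⟩ : ∃ x, (tw lam₁ x) ^ t = lam₂ := by
    by_contra! h
    apply hχ₂'.apply_one_ne_zero
    rw [hproj]
    simp [h]
  refine ⟨x, t, htK, fun k => ?_⟩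
  rw [hproj, Finset.sum_eq_single x, if_pos hx]
  · intro y _ hy
    rw [if_neg]
    intro h
    exact hy (htw lam₁ h₁ _ _ (hpowinj _ _ (h.trans hx.symm)))
  · simp

end Induction

end GaloisFrobenius

/-! ### Class-two power formula, extension of linear characters, Chevalley–Warning -/

namespace GaloisFrobenius

open scoped commutatorElement

theorem mul_pow_of_commutatorElement_central {G : Type*} [Group G] (x y : G)
    (h : ∀ z, Commute ⁅y, x⁆ z) (n : ℕ) :
    (x * y) ^ n = x ^ n * y ^ n * ⁅y, x⁆ ^ (n.choose 2) := by
  set c := ⁅y, x⁆ with hc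
  have hyx : y * x = c * (x * y) := by rw [hc, commutatorElement_def]; group
  have hyn : ∀ n : ℕ, y ^ n * x = c ^ n * (x * y ^ n) := by
    intro n
    induction n with
    | zero => simp
    | succ n ih =>
      rw [pow_succ', mul_assoc, ih, ← mul_assoc, ← ((h y).pow_left n).eq, mul_assoc (c ^ n),
        ← mul_assoc y, hyx, pow_succ c]
      simp only [mul_assoc]
  induction n with
  | zero => simp
  | succ n ih =>
    have e1 := ((h (x * y)).pow_left (n.choose 2)).eq
    have e2 := ((h (x ^ n)).pow_left n).eq
    have e3 : c ^ (n.choose 2) * (y ^ n * y) = y ^ n * y * c ^ (n.choose 2) :=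
      ((h (y ^ n * y)).pow_left (n.choose 2)).eq
    have e4 := ((h (x ^ n * x * (y ^ n * y))).pow_left n).eq
    calc (x * y) ^ (n + 1) = x ^ n * y ^ n * (c ^ n.choose 2 * (x * y)) := by
          rw [pow_succ, ih, mul_assoc]
      _ = x ^ n * (y ^ n * x) * y * c ^ n.choose 2 := by rw [e1]; simp only [mul_assoc]
      _ = x ^ n * c ^ n * (x * y ^ n) * y * c ^ n.choose 2 := by
          rw [hyn]; simp only [mul_assoc]
      _ = c ^ n * (x ^ n * x * (y ^ n * y)) * c ^ n.choose 2 := by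
          rw [← e2]; simp only [mul_assoc]
      _ = x ^ (n + 1) * y ^ (n + 1) * c ^ ((n + 1).choose 2) := by
          rw [e4, Nat.choose_succ_succ' n 1, Nat.choose_one_right, pow_add c, pow_succ x n, pow_succ y n]
          simp only [mul_assoc]

section Extension

/-- A linear character of a subgroup extends as soon as it is trivial on the commutators. -/
theorem exists_extension {H : Type*} [Group H] [Finite H] (D : Subgroup H) (lam : D →* ℂˣ)
    (h : ∀ d : D, (d : H) ∈ commutator H → lam d = 1) :
    ∃ μ : H →* ℂˣ, ∀ d : D, μ d = lam d := by
  let j : D →* Abelianization H := Abelianization.of.comp D.subtype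
  have hker : j.ker ≤ lam.ker := by
    intro d hd
    rw [MonoidHom.mem_ker] at hd ⊢
    apply h
    rw [← Abelianization.ker_of]
    exact hd
  let lam' : j.range →* ℂˣ :=
    j.rangeRestrict.liftOfSurjective j.rangeRestrict_surjective
      ⟨lam, by rw [MonoidHom.ker_rangeRestrict]; exact hker⟩
  have : Finite (Abelianization H) := Quotient.finite _
  have : NeZero ((Monoid.exponent (Abelianization H) : ℕ) : ℂ) :=
    ⟨by exact_mod_cast Monoid.exponent_ne_zero_of_finite⟩
  obtain ⟨ψ, hψ⟩ := MonoidHom.domRestrict_surjective (M := ℂ) j.range lam'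
  refine ⟨ψ.comp Abelianization.of, fun d => ?_⟩
  have h1 := DFunLike.congr_fun hψ (j.rangeRestrict d)
  have h2 : lam' (j.rangeRestrict d) = lam d :=
    MonoidHom.liftOfRightInverse_comp_apply _ _ _ _ _
  rw [h2] at h1
  exact h1

theorem exists_apply_ne_one {H : Type*} [Group H] [Finite H] (D : Subgroup H) [D.Normal]
    (hD : commutator H ≤ D) {x : H} (hx : x ∉ D) :
    ∃ μ : H →* ℂˣ, (∀ d ∈ D, μ d = 1) ∧ μ x ≠ 1 := by
  have hcomm : ∀ a b : H ⧸ D, a * b = b * a := by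
    intro a b
    obtain ⟨a, rfl⟩ := QuotientGroup.mk_surjective a
    obtain ⟨b, rfl⟩ := QuotientGroup.mk_surjective b
    rw [← QuotientGroup.mk_mul, ← QuotientGroup.mk_mul, QuotientGroup.eq]
    apply hD
    have : (a * b)⁻¹ * (b * a) = ⁅b⁻¹, a⁻¹⁆ := by rw [commutatorElement_def]; group
    rw [this]
    exact Subgroup.commutator_mem_commutator (Subgroup.mem_top _) (Subgroup.mem_top _)
  let _ : CommGroup (H ⧸ D) := { (inferInstance : Group (H ⧸ D)) with mul_comm := hcomm }
  have : NeZero ((Monoid.exponent (H ⧸ D) : ℕ) : ℂ) :=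
    ⟨by exact_mod_cast Monoid.exponent_ne_zero_of_finite⟩
  obtain ⟨φ, hφ⟩ := CommGroup.exists_apply_ne_one_of_hasEnoughRootsOfUnity (H ⧸ D) ℂ
    (a := (x : H ⧸ D)) (by rwa [Ne, QuotientGroup.eq_one_iff])
  refine ⟨φ.comp (QuotientGroup.mk' D), fun d hd => ?_, hφ⟩
  rw [MonoidHom.comp_apply, QuotientGroup.mk'_apply, (QuotientGroup.eq_one_iff d).mpr hd, map_one]

end Extension

/-- In a linear family of endomorphisms over a prime field that has at least as many parameters as
the dimension and all of whose nonzero members have one-dimensional kernels, some member has a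
nonzero element of its kernel in its range. -/
theorem exists_apply_apply_eq_zero {p : ℕ} [hp : Fact p.Prime] {V U : Type*} [AddCommGroup V]
    [AddCommGroup U] [Module (ZMod p) V] [Module (ZMod p) U] [Module.Finite (ZMod p) V]
    [Module.Finite (ZMod p) U] [Nontrivial U] (φ : V →ₗ[ZMod p] Module.End (ZMod p) U)
    (hVU : Module.finrank (ZMod p) U ≤ Module.finrank (ZMod p) V)
    (hker : ∀ v, v ≠ 0 → φ v ≠ 0 ∧ Module.finrank (ZMod p) (LinearMap.ker (φ v)) = 1) :
    ∃ v, v ≠ 0 ∧ ∃ u, φ v u ≠ 0 ∧ φ v (φ v u) = 0 := by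
  classical
  set m := Module.finrank (ZMod p) U with hm
  set n := Module.finrank (ZMod p) V with hn
  have hm0 : 0 < m := Module.finrank_pos
  -- Needed so that the form of degree `m - 1` below is not constant and vanishes at the origin.
  have hm1 : m ≠ 1 := by
    intro h
    have : Nontrivial V := Module.nontrivial_of_finrank_pos (R := ZMod p) (by omega)
    obtain ⟨v, hv⟩ := exists_ne (0 : V)
    obtain ⟨h1, h2⟩ := hker v hv
    exact h1 (LinearMap.ker_eq_top.mp (Submodule.eq_top_of_finrank_eq (h2.trans h.symm)))
  let b : Module.Basis (Fin n) (ZMod p) V := Module.finBasis (ZMod p) V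
  -- In the coordinates of `v`, the coefficient of `X` in the characteristic polynomial is a form of
  -- degree `m - 1 < n`. By Chevalley–Warning it has a nontrivial zero.
  let f := (φ.polyCharpoly b).coeff 1
  have hhom : f.IsHomogeneous (m - 1) := φ.polyCharpoly_coeff_isHomogeneous b 1 (m - 1) (by omega)
  have hdeg : f.totalDegree < Fintype.card (Fin n) := by
    rw [Fintype.card_fin]
    exact lt_of_le_of_lt hhom.totalDegree_le (by omega)
  have hdvd := char_dvd_card_solutions p hdeg
  have h0 : MvPolynomial.eval (0 : Fin n → ZMod p) f = 0 := by
    rw [MvPolynomial.eval_zero, MvPolynomial.constantCoeff_eq]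
    exact hhom.coeff_eq_zero (by rw [map_zero]; omega)
  obtain ⟨x, hx0, hx⟩ : ∃ x : Fin n → ZMod p, x ≠ 0 ∧ MvPolynomial.eval x f = 0 := by
    by_contra! hcon
    have : Fintype.card {x : Fin n → ZMod p // MvPolynomial.eval x f = 0} = 1 := by
      rw [Fintype.card_eq_one_iff]
      refine ⟨⟨0, h0⟩, fun y => Subtype.ext ?_⟩
      by_contra hy
      exact hcon y.1 hy y.2
    rw [this] at hdvd
    exact hp.out.one_lt.ne' (Nat.dvd_one.mp hdvd)
  set v : V := b.equivFun.symm x with hv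
  have hv0 : v ≠ 0 := fun h => hx0 (by rwa [hv, LinearEquiv.map_eq_zero_iff] at h)
  have hcoeff : (φ v).charpoly.coeff 1 = 0 := by
    rw [← φ.polyCharpoly_coeff_eval b, ← hx]
    congr 2
    ext i
    have := congrFun (b.equivFun.apply_symm_apply x) i
    rwa [Module.Basis.equivFun_apply] at this
  refine ⟨v, hv0, ?_⟩
  by_contra! hcon
  -- Under `hcon` the generalized eigenspace at `0` is the one-dimensional kernel. Then `X` divides
  -- the characteristic polynomial exactly once, contrary to `hcoeff`.
  have hk : ∀ k : ℕ, ∀ w, ((φ v) ^ k) w = 0 → w ∈ LinearMap.ker (φ v) := by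
    intro k
    induction k with
    | zero => intro w hw; rw [pow_zero] at hw; rw [show w = 0 from hw]; exact zero_mem _
    | succ k ih =>
      intro w hw
      rw [pow_succ] at hw
      have h1 := ih (φ v w) hw
      by_contra h2
      exact hcon w (fun h => h2 h) h1
  have hgen : (φ v).maxGenEigenspace 0 = LinearMap.ker (φ v) := by
    ext w
    rw [Module.End.mem_maxGenEigenspace]
    constructor
    · rintro ⟨k, hk'⟩
      rw [zero_smul, sub_zero] at hk'
      exact hk k w hk'
    · intro hw
      exact ⟨1, by rw [zero_smul, sub_zero, pow_one]; exact hw⟩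
  have htr := (φ v).finrank_maxGenEigenspace_zero_eq
  rw [hgen, (hker v hv0).2] at htr
  have hne := Polynomial.coeff_natTrailingDegree_ne_zero.mpr (φ v).charpoly_monic.ne_zero
  rw [← htr] at hne
  exact hne hcoeff

theorem exists_apply_apply_eq_one {p : ℕ} [hp : Fact p.Prime] {A M : Type*} [CommGroup M]
    [Finite M] [Nontrivial M] [CommGroup A] [Finite A] (hM : ∀ m : M, m ^ p = 1)
    (hA : ∀ a : A, a ^ p = 1) (act : A →* (M →* M)) (hMA : Nat.card M ≤ Nat.card A)
    (hker : ∀ a, a ≠ 1 → act a ≠ 1 ∧ Nat.card (act a).ker = p) :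
    ∃ a, a ≠ 1 ∧ ∃ u, act a u ≠ 1 ∧ act a (act a u) = 1 := by
  let _ : Module (ZMod p) (Additive M) := AddCommGroup.zmodModule (n := p) fun x => hM x.toMul
  let _ : Module (ZMod p) (Additive A) := AddCommGroup.zmodModule (n := p) fun x => hA x.toMul
  let φ₀ : Additive A →+ Module.End (ZMod p) (Additive M) :=
    { toFun := fun a => AddMonoidHom.toZModLinearMap p (MonoidHom.toAdditive (act a.toMul))
      map_zero' := by
        rw [toMul_zero, map_one]
        rfl
      map_add' := fun a b => by
        rw [toMul_add, map_mul]
        rfl }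
  let φ : Additive A →ₗ[ZMod p] Module.End (ZMod p) (Additive M) :=
    AddMonoidHom.toZModLinearMap p φ₀
  have hcardM : Nat.card M = p ^ Module.finrank (ZMod p) (Additive M) := by
    have := Module.natCard_eq_pow_finrank (K := ZMod p) (V := Additive M)
    rwa [Nat.card_zmod] at this
  have hcardA : Nat.card A = p ^ Module.finrank (ZMod p) (Additive A) := by
    have := Module.natCard_eq_pow_finrank (K := ZMod p) (V := Additive A)
    rwa [Nat.card_zmod] at this
  obtain ⟨v, hv, u, h1, h2⟩ := exists_apply_apply_eq_zero φ
    (by rw [hcardM, hcardA] at hMA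
        exact (Nat.pow_le_pow_iff_right hp.out.one_lt).mp hMA)
    (fun v hv => by
      obtain ⟨h1, h2⟩ := hker v.toMul hv
      refine ⟨fun h => h1 ?_, ?_⟩
      · ext m
        exact LinearMap.congr_fun h (Additive.ofMul m)
      · have h3 := Module.natCard_eq_pow_finrank (K := ZMod p) (V := LinearMap.ker (φ v))
        have h4 : Nat.card (LinearMap.ker (φ v)) = p := h2
        rw [h4, Nat.card_zmod] at h3
        exact (Nat.pow_right_injective hp.out.two_le (h3.symm.trans (pow_one p).symm)))
  exact ⟨v.toMul, hv, u.toMul, h1, h2⟩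

end GaloisFrobenius

/-! ### A solvable group with a fixed-point-free action and `K / K'` of `p`-power exponent is a
`p`-group -/

namespace GaloisFrobenius

open scoped commutatorElement

section

variable {L K : Type*} [Group L] [Group K] [MulDistribMulAction L K]

/-- The action on the quotient by an invariant normal subgroup. -/
abbrev quotientAction (N : Subgroup K) [N.Normal] (hN : ∀ l : L, ∀ n ∈ N, l • n ∈ N) :
    MulDistribMulAction L (K ⧸ N) where
  smul l := QuotientGroup.map N N (MulDistribMulAction.toMonoidHom K l) fun n hn => hN l n hn
  one_smul x := by
    obtain ⟨x, rfl⟩ := QuotientGroup.mk_surjective x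
    exact congrArg _ (one_smul L x)
  mul_smul a b x := by
    obtain ⟨x, rfl⟩ := QuotientGroup.mk_surjective x
    exact congrArg _ (mul_smul a b x)
  smul_one a := map_one (QuotientGroup.map N N (MulDistribMulAction.toMonoidHom K a) _)
  smul_mul a x y := map_mul (QuotientGroup.map N N (MulDistribMulAction.toMonoidHom K a) _) x y

/-- The action on an invariant subgroup. -/
abbrev restrictAction (N : Subgroup K) (hN : ∀ l : L, ∀ n ∈ N, l • n ∈ N) :
    MulDistribMulAction L N where
  smul l n := ⟨l • (n : K), hN l n n.2⟩
  one_smul x := Subtype.ext (one_smul L (x : K))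
  mul_smul a b x := Subtype.ext (mul_smul a b (x : K))
  smul_one a := Subtype.ext (smul_one a)
  smul_mul a x y := Subtype.ext (smul_mul' a (x : K) y)

theorem smul_mem_of_characteristic (N : Subgroup K) [hN : N.Characteristic] (l : L) {n : K}
    (hn : n ∈ N) : l • n ∈ N := by
  have := Subgroup.characteristic_iff_map_le.mp hN (MulDistribMulAction.toMulAut L K l)
  exact this ⟨n, hn, rfl⟩

end

theorem map_commutator_of_surjective {G H : Type*} [Group G] [Group H] (f : G →* H)
    (hf : Function.Surjective f) : (commutator G).map f = commutator H := by
  rw [commutator_def, commutator_def, Subgroup.map_commutator, Subgroup.map_top_of_surjective f hf]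

/-- The norm of any element over `L` is fixed by `L`, hence trivial. So the product over all
conjugates `h L h⁻¹` and the product over all cosets `H l` are both `1`. For `l ≠ 1` the elements `h
l h⁻¹` run through `H l`, so these factors agree, and comparing the factors at `l = 1` leaves the
claim. -/
theorem prod_apply_eq_pow_card {H L A : Type*} [Group H] [Group L] [CommGroup A] [Fintype H]
    [Fintype L] [Nontrivial L] (α : H →* MulAut A) (β : L →* MulAut A) (γ : L →* MulAut H)
    (hcompat : ∀ l h a, β l (α h a) = α (γ l h) (β l a))
    (hβ : ∀ l, l ≠ 1 → ∀ a, β l a = a → a = 1) (hγ : ∀ l, l ≠ 1 → ∀ h, γ l h = h → h = 1) (a : A) :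
    ∏ h, α h a = a ^ Fintype.card H := by
  classical
  have hnorm : ∀ c, ∏ l, β l c = 1 := by
    intro c
    obtain ⟨x, hx⟩ := exists_ne (1 : L)
    apply hβ x hx
    rw [map_prod]
    refine Fintype.prod_equiv (Equiv.mulLeft x) _ _ fun l => ?_
    rw [Equiv.coe_mulLeft, map_mul, MulAut.mul_apply]
  have h1 : ∏ l, ∏ h, α h (β l (α h⁻¹ a)) = 1 := by
    rw [Finset.prod_comm]
    refine Finset.prod_eq_one fun h _ => ?_
    rw [← map_prod, hnorm, map_one]
  have h2 : ∏ l, ∏ h, α h (β l a) = 1 := by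
    rw [Finset.prod_comm]
    refine Finset.prod_eq_one fun h _ => ?_
    rw [← map_prod, hnorm, map_one]
  have h3 : ∀ l, l ≠ 1 → ∏ h, α h (β l (α h⁻¹ a)) = ∏ h, α h (β l a) := by
    intro l hl
    have hfpf : MonoidHom.FixedPointFree (γ l) := hγ l hl
    refine Fintype.prod_equiv (Equiv.ofBijective _
      (Finite.injective_iff_bijective.mp hfpf.commutatorMap_injective)) _ _ fun h => ?_
    rw [hcompat, Equiv.ofBijective_apply, MonoidHom.commutatorMap_apply, div_eq_mul_inv,
      ← map_inv, map_mul, MulAut.mul_apply]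
  rw [← Finset.mul_prod_erase _ _ (Finset.mem_univ (1 : L)),
    Finset.prod_congr rfl fun l hl => h3 l (Finset.ne_of_mem_erase hl)] at h1
  rw [← Finset.mul_prod_erase _ _ (Finset.mem_univ (1 : L))] at h2
  have h4 := mul_right_cancel (h2.trans h1.symm)
  have h5 : ∀ h : H, α h (β 1 a) = α h a := fun h => by rw [map_one, MulAut.one_apply]
  have h6 : ∀ h : H, α h (β 1 (α h⁻¹ a)) = a := fun h => by
    rw [map_one, MulAut.one_apply, ← MulAut.mul_apply, ← map_mul, mul_inv_cancel, map_one,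
      MulAut.one_apply]
  rw [Finset.prod_congr rfl fun h _ => h5 h, Finset.prod_congr rfl fun h _ => h6 h,
    Finset.prod_const, Finset.card_univ] at h4
  exact h4

/-- A proper Sylow subgroup would lie in a maximal subgroup. By nilpotency this is normal and
contains `K'`, so its index is a power of `p` that is also prime to `p`. -/
theorem isPGroup_of_isNilpotent {p : ℕ} [hp : Fact p.Prime] {K : Type*} [Group K] [Finite K]
    [Group.IsNilpotent K] (h : ∀ x : K, ∃ k, x ^ p ^ k ∈ commutator K) : IsPGroup p K := by
  obtain ⟨P⟩ : Nonempty (Sylow p K) := inferInstance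
  by_cases hP : (P : Subgroup K) = ⊤
  · exact IsPGroup.of_equiv (hP ▸ P.isPGroup') Subgroup.topEquiv
  exfalso
  obtain ⟨M, hM, hPM⟩ := (eq_top_or_exists_le_coatom (P : Subgroup K)).resolve_left hP
  have hMn : M.Normal := Subgroup.NormalizerCondition.normal_of_coatom M Group.normalizerCondition_of_isNilpotent hM
  have hlt : commutator K ≤ M := by
    by_contra hcon
    have hsup : commutator K ⊔ M = ⊤ := hM.2 _ (by
      rw [sup_comm]
      exact lt_of_le_of_ne le_sup_left fun h => hcon (h ▸ le_sup_right))
    have hnt : Nontrivial (K ⧸ M) := by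
      rw [QuotientGroup.nontrivial_iff]
      exact hM.1
    have h1 : commutator (K ⧸ M) < ⊤ := Group.IsSolvable.commutator_lt_top_of_nontrivial _
    apply h1.ne
    rw [← map_commutator_of_surjective _ (QuotientGroup.mk'_surjective M), ← Subgroup.map_top_of_surjective _ (QuotientGroup.mk'_surjective M), ← hsup,
      Subgroup.map_sup, QuotientGroup.map_mk'_self, sup_bot_eq]
  have hpM : IsPGroup p (K ⧸ M) := by
    intro x
    obtain ⟨x, rfl⟩ := QuotientGroup.mk_surjective x
    obtain ⟨k, hk⟩ := h x
    exact ⟨k, by rw [← QuotientGroup.mk_pow, QuotientGroup.eq_one_iff]; exact hlt hk⟩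
  obtain ⟨n, hn⟩ := IsPGroup.iff_card.mp hpM
  have hidx : M.index ∣ (P : Subgroup K).index := Subgroup.index_dvd_of_le hPM
  have hnd := P.not_dvd_index
  rcases n with _ | n
  · rw [pow_zero] at hn
    exact hM.1 (Subgroup.index_eq_one.mp hn)
  · apply hnd
    refine dvd_trans ?_ hidx
    change p ∣ Nat.card (K ⧸ M)
    rw [hn]
    exact dvd_pow_self p n.succ_ne_zero

/-- The product of the conjugates of `a` over `K / A` is central, and by `prod_apply_eq_pow_card` it
is `a ^ |K / A|`. As `|K / A|` is prime to the order of `a`, this power generates `⟨a⟩`. -/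
theorem mem_center_of_coprime {p : ℕ} {L K : Type*} [Group L] [Group K] [Finite L] [Nontrivial L]
    [Finite K] [MulDistribMulAction L K] (hfpf : IsFixedPointFree L K) (A : Subgroup K)
    [A.Characteristic] (hA : ∀ a ∈ A, ∀ b ∈ A, a * b = b * a) (hKA : IsPGroup p (K ⧸ A))
    [hp : Fact p.Prime] {a : K} (ha : a ∈ A) (hap : (orderOf a).Coprime p) :
    a ∈ Subgroup.center K := by
  have := Fintype.ofFinite L
  have := Fintype.ofFinite (K ⧸ A)
  have hAL : ∀ l : L, ∀ n ∈ A, l • n ∈ A := fun l n hn => smul_mem_of_characteristic A l hn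
  let _ : CommGroup A := { (inferInstance : Group A) with
    mul_comm := fun x y => Subtype.ext (hA x x.2 y y.2) }
  let _ := quotientAction A hAL
  let _ := restrictAction A hAL
  let α : K ⧸ A →* MulAut A := QuotientGroup.lift A MulAut.conjNormal (by
    intro x hx
    ext y
    rw [MulAut.conjNormal_apply, MulAut.one_apply, hA x hx y y.2, mul_inv_cancel_right])
  have hα : ∀ (k : K) (b : A), ((α (k : K ⧸ A) b : A) : K) = k * b * k⁻¹ := fun k b => rfl
  have hprod := prod_apply_eq_pow_card α (MulDistribMulAction.toMulAut L A)
    (MulDistribMulAction.toMulAut L (K ⧸ A))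
    (by
      intro l h b
      obtain ⟨k, rfl⟩ := QuotientGroup.mk_surjective h
      apply Subtype.ext
      change l • (k * b * k⁻¹) = (l • k) * (l • (b : K)) * (l • k)⁻¹
      rw [smul_mul', smul_mul', smul_inv'])
    (fun l hl b hb => Subtype.ext (hfpf l hl b (congrArg Subtype.val hb)))
    (hfpf.of_surjective (QuotientGroup.mk' A) (QuotientGroup.mk'_surjective A) fun l k => rfl)
    ⟨a, ha⟩
  obtain ⟨n, hn⟩ := IsPGroup.iff_card.mp hKA
  have hcen : ∀ k : K, k * a ^ p ^ n * k⁻¹ = a ^ p ^ n := by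
    intro k
    have h1 : α (k : K ⧸ A) (∏ h, α h ⟨a, ha⟩) = ∏ h, α h ⟨a, ha⟩ := by
      rw [map_prod]
      refine Fintype.prod_equiv (Equiv.mulLeft (k : K ⧸ A)) _ _ fun h => ?_
      rw [Equiv.coe_mulLeft, map_mul, MulAut.mul_apply]
    rw [hprod, ← Nat.card_eq_fintype_card, hn] at h1
    exact congrArg Subtype.val h1
  obtain ⟨m, hm⟩ := exists_pow_eq_self_of_coprime (x := a) (n := p ^ n)
    (Nat.Coprime.pow_left n hap.symm)
  rw [← hm]
  apply Subgroup.pow_mem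
  rw [Subgroup.mem_center_iff]
  intro k
  exact mul_inv_eq_iff_eq_mul.mp (hcen k)

/-- Solvability lets an elementary argument replace Thompson's theorem. Let `A` be the last
nontrivial derived subgroup. By induction `K / A` is a `p`-group, so the elements of `A` of order
prime to `p` are central. Then `K / Z(K)` is a `p`-group and `K` is nilpotent. -/
theorem isPGroup_of_isFixedPointFree {p : ℕ} [hp : Fact p.Prime] {L : Type*} [Group L] [Finite L]
    [Nontrivial L] : ∀ (n : ℕ) {K : Type*} [Group K] [Finite K] [MulDistribMulAction L K],
    Nat.card K = n → Group.IsSolvable K → IsFixedPointFree L K →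
    (∀ x : K, ∃ k, x ^ p ^ k ∈ commutator K) → IsPGroup p K := by
  intro n
  induction n using Nat.strong_induction_on with
  | _ n ih =>
  intro K _ _ _ hcard hsol hfpf h
  rcases subsingleton_or_nontrivial K with hK | hK
  · intro x
    exact ⟨0, Subsingleton.elim _ _⟩
  obtain ⟨m, hm0, hm1⟩ : ∃ m, derivedSeries K m ≠ ⊥ ∧ derivedSeries K (m + 1) = ⊥ := by
    classical
    have hex := hsol.solvable
    have h0 : Nat.find hex ≠ 0 := by
      intro h0
      have := Nat.find_spec hex
      rw [h0, derivedSeries_zero] at this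
      exact top_ne_bot this
    obtain ⟨m, hm⟩ := Nat.exists_eq_succ_of_ne_zero h0
    refine ⟨m, Nat.find_min hex (by omega), ?_⟩
    have := Nat.find_spec hex
    rwa [hm] at this
  set A := derivedSeries K m with hAdef
  have hchar : A.Characteristic := derivedSeries_characteristic K m
  have hA : ∀ a ∈ A, ∀ b ∈ A, a * b = b * a := by
    intro a ha b hb
    have : ⁅a, b⁆ ∈ derivedSeries K (m + 1) := by
      rw [derivedSeries_succ]
      exact Subgroup.commutator_mem_commutator ha hb
    rw [hm1, Subgroup.mem_bot, commutatorElement_eq_one_iff_mul_comm] at this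
    exact this
  have hAL : ∀ l : L, ∀ n ∈ A, l • n ∈ A := fun l n hn => smul_mem_of_characteristic A l hn
  have hKA : IsPGroup p (K ⧸ A) := by
    let _ := quotientAction A hAL
    refine ih (Nat.card (K ⧸ A)) ?_ rfl inferInstance
      (hfpf.of_surjective (QuotientGroup.mk' A) (QuotientGroup.mk'_surjective A) fun l k => rfl) ?_
    · rw [← hcard, A.card_eq_card_quotient_mul_card_subgroup]
      have : 1 < Nat.card A := by
        rw [Finite.one_lt_card_iff_nontrivial, Subgroup.nontrivial_iff_ne_bot]
        exact hm0
      exact lt_mul_of_one_lt_right Nat.card_pos this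
    · intro x
      obtain ⟨x, rfl⟩ := QuotientGroup.mk_surjective x
      obtain ⟨k, hk⟩ := h x
      refine ⟨k, ?_⟩
      rw [← QuotientGroup.mk_pow]
      rw [← map_commutator_of_surjective _ (QuotientGroup.mk'_surjective A)]
      exact ⟨_, hk, rfl⟩
  have hZ : IsPGroup p (K ⧸ Subgroup.center K) := by
    intro x
    obtain ⟨x, rfl⟩ := QuotientGroup.mk_surjective x
    obtain ⟨k, hk⟩ := hKA (x : K ⧸ A)
    rw [← QuotientGroup.mk_pow, QuotientGroup.eq_one_iff] at hk
    set a := x ^ p ^ k with ha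
    obtain ⟨j, r, hr, hjr⟩ := Nat.exists_eq_pow_mul_and_not_dvd (orderOf_pos a).ne' p
      hp.out.ne_one
    refine ⟨k + j, ?_⟩
    rw [← QuotientGroup.mk_pow, QuotientGroup.eq_one_iff, pow_add, pow_mul, ← ha]
    refine mem_center_of_coprime hfpf A hA hKA (A.pow_mem hk _) ?_
    rw [orderOf_pow_of_dvd (pow_ne_zero _ hp.out.ne_zero) (hjr ▸ dvd_mul_right _ _), hjr,
      Nat.mul_div_cancel_left _ (pow_pos hp.out.pos _)]
    exact ((Nat.Prime.coprime_iff_not_dvd hp.out).mpr hr).symm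
  have : Group.IsNilpotent K := by
    have := hZ.isNilpotent
    exact Group.of_quotient_center_nilpotent this
  exact isPGroup_of_isNilpotent h

end GaloisFrobenius

/-! ### Orbits of linear characters -/

namespace GaloisFrobenius

open Representation
open scoped commutatorElement

theorem irrOver_top {K : Type*} [Group K] (μ : K →* ℂˣ) :
    IrrOver ⊤ (μ.comp (Subgroup.subtype ⊤)) fun g => (μ g : ℂ) := by
  let ρ : Representation ℂ K (Fin 1 → ℂ) :=
    { toFun := fun g => (μ g : ℂ) • 1
      map_one' := by simp
      map_mul' := fun a b => by simp [smul_smul, mul_comm] }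
  have hρ : ∀ g, ρ g = (μ g : ℂ) • 1 := fun g => rfl
  refine ⟨1, ρ, ?_, ?_, fun m => rfl⟩
  · rw [isIrreducible_iff]
    refine ⟨inferInstance, fun W _ => ?_⟩
    have := Module.finrank_fin_fun ℂ (n := 1)
    have h : IsSimpleModule ℂ (Fin 1 → ℂ) := isSimpleModule_iff_finrank_eq_one.mpr this
    exact eq_bot_or_eq_top W
  · ext g
    simp [Representation.character, hρ]

theorem card_dvd_card_of_free {L β : Type*} [Group L] [Finite L] [MulAction L β] [Finite β]
    (h : ∀ (l : L) (b : β), l • b = b → l = 1) : Nat.card L ∣ Nat.card β := by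
  have : ∀ b : β, MulAction.stabilizer L b = ⊥ := fun b =>
    (Subgroup.eq_bot_iff_forall _).mpr fun l hl => h l b hl
  rw [Nat.card_congr (MulAction.selfEquivOrbitsQuotientProd this), Nat.card_prod]
  exact dvd_mul_left _ _

section

variable {L K : Type*} [Group L] [Group K] [MulDistribMulAction L K]

theorem IsFixedPointFree.card_dvd [Finite L] [Finite K] (h : IsFixedPointFree L K) :
    Nat.card L ∣ Nat.card K - 1 := by
  let _ : MulAction L {k : K // k ≠ 1} :=
    { smul := fun l k => ⟨l • (k : K), fun hk => k.2 (smul_left_cancel l (hk.trans (smul_one l).symm))⟩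
      one_smul := fun k => Subtype.ext (one_smul L (k : K))
      mul_smul := fun a b k => Subtype.ext (mul_smul a b (k : K)) }
  have h1 : Nat.card {k : K // k ≠ 1} = Nat.card K - 1 := by
    classical
    have := Fintype.ofFinite K
    rw [Nat.card_eq_fintype_card, Nat.card_eq_fintype_card, Fintype.card_subtype_compl,
      Fintype.card_subtype_eq]
  rw [← h1]
  refine card_dvd_card_of_free fun l k hk => ?_
  by_contra hl
  exact k.2 (h l hl k (congrArg Subtype.val hk))

theorem IsFixedPointFree.exists_smul_eq [Finite L] [Finite K] (h : IsFixedPointFree L K)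
    (hcard : Nat.card K = Nat.card L + 1) {x y : K} (hx : x ≠ 1) (hy : y ≠ 1) :
    ∃ l : L, l • x = y := by
  have hinj : Function.Injective fun l : L => l • x := by
    intro a b hab
    by_contra hne
    refine hx (h (b⁻¹ * a) ?_ x ?_)
    · rwa [Ne, inv_mul_eq_one, eq_comm]
    · rw [mul_smul, inv_smul_eq_iff]
      exact hab
  by_contra hcon
  push Not at hcon
  have h1 : Set.range (fun l : L => l • x) ⊆ {1, y}ᶜ := by
    rintro _ ⟨l, rfl⟩ h2
    rcases h2 with h2 | h2
    · exact hx (smul_left_cancel l (h2.trans (smul_one l).symm))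
    · exact hcon l h2
  have h2 := Set.ncard_le_ncard h1
  have h3 : (Set.range fun l : L => l • x).ncard = Nat.card L := by
    rw [← Set.image_univ, Set.ncard_image_of_injective _ hinj, Set.ncard_univ]
  have h4 := Set.ncard_add_ncard_compl ({1, y} : Set K)
  rw [Set.ncard_pair (Ne.symm hy)] at h4
  omega

theorem IsGaloisTransitive.exists_of_monoidHom (h : IsGaloisTransitive L K) {μ₁ μ₂ : K →* ℂˣ}
    (h₁ : μ₁ ≠ 1) (h₂ : μ₂ ≠ 1) :
    ∃ (l : L) (t : ℕ), t.Coprime (Nat.card K) ∧ ∀ g, μ₂ g = μ₁ (l • g ^ t) := by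
  have hne : ∀ μ : K →* ℂˣ, μ ≠ 1 → μ.comp (Subgroup.subtype ⊤) ≠ 1 := by
    intro μ hμ h
    exact hμ (MonoidHom.ext fun g => DFunLike.congr_fun h (⟨g, trivial⟩ : (⊤ : Subgroup K)))
  obtain ⟨l, t, ht, hg⟩ := h ⊤ inferInstance (fun _ _ _ => trivial) _ _ (hne _ h₁) (hne _ h₂) _ _
    (irrOver_top μ₁) (irrOver_top μ₂) (by simp)
  exact ⟨l, t, ht, fun g => Units.ext (hg g)⟩

/-- A power of a nontrivial linear character has prime order `p`. Every other nontrivial one is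
conjugate to it, so has exponent `p` too, and linear characters separate the points of `K / K'`. -/
theorem IsGaloisTransitive.exists_prime_pow_mem [Finite K] (h : IsGaloisTransitive L K)
    (hK : commutator K ≠ ⊤) : ∃ p, p.Prime ∧ ∀ x : K, x ^ p ∈ commutator K := by
  obtain ⟨x, hx⟩ : ∃ x, x ∉ commutator K := by
    by_contra! hcon
    exact hK (eq_top_iff.mpr fun x _ => hcon x)
  obtain ⟨μ, -, hμx⟩ := exists_apply_ne_one (commutator K) le_rfl hx
  have hμ : μ ≠ 1 := fun hμ => hμx (by rw [hμ, MonoidHom.one_apply])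
  have hex : ∃ n, 0 < n ∧ ∀ g, μ g ^ n = 1 := ⟨Nat.card K, Nat.card_pos, fun g => by
    rw [← map_pow, pow_card_eq_one', map_one]⟩
  classical
  set n := Nat.find hex with hn
  obtain ⟨hn0, hn1⟩ := Nat.find_spec hex
  rw [← hn] at hn0 hn1
  have h1 : n ≠ 1 := fun h1 => hμ (MonoidHom.ext fun g => by simpa [h1] using hn1 g)
  set p := n.minFac
  have hpp : p.Prime := Nat.minFac_prime h1
  have hdvd : p ∣ n := Nat.minFac_dvd _
  set μ₁ := (powMonoidHom (n / p)).comp μ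
  have hpow : ∀ g, μ₁ g ^ p = 1 := fun g => by
    rw [MonoidHom.comp_apply, powMonoidHom_apply, ← pow_mul, Nat.div_mul_cancel hdvd, hn1]
  have hne : μ₁ ≠ 1 := fun h2 => Nat.find_min hex (Nat.div_lt_self hn0 hpp.one_lt)
    ⟨Nat.div_pos (Nat.le_of_dvd hn0 hdvd) hpp.pos, fun g => DFunLike.congr_fun h2 g⟩
  refine ⟨p, hpp, fun y => ?_⟩
  by_contra hy
  obtain ⟨μ₂, -, h2⟩ := exists_apply_ne_one (commutator K) le_rfl hy
  obtain ⟨l, t, -, hg⟩ := h.exists_of_monoidHom (μ₂ := μ₂) hne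
    (fun h => h2 (by rw [h, MonoidHom.one_apply]))
  apply h2
  rw [map_pow, hg, hpow]

/-- Triviality on `U` is preserved by `L` and by powers, so a nontrivial linear character killing
`U` cannot be conjugate to one that does not. -/
theorem IsGaloisTransitive.eq_commutator_of_ne_top [Finite K] (h : IsGaloisTransitive L K)
    (U : Subgroup K) (hU : commutator K ≤ U) (hUL : ∀ l : L, ∀ u ∈ U, l • u ∈ U) (hne : U ≠ ⊤) :
    U = commutator K := by
  have hUn : U.Normal := Subgroup.Normal.of_commutator_le K hU
  refine le_antisymm (fun x hx => ?_) hU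
  by_contra hxK
  obtain ⟨y, hy⟩ : ∃ y, y ∉ U := by
    by_contra! hcon
    exact hne (eq_top_iff.mpr fun x _ => hcon x)
  obtain ⟨μ₁, hμ₁, h1⟩ := exists_apply_ne_one U hU hy
  obtain ⟨μ₂, -, h2⟩ := exists_apply_ne_one (commutator K) le_rfl hxK
  obtain ⟨l, t, -, hg⟩ := h.exists_of_monoidHom (μ₁ := μ₁) (μ₂ := μ₂)
    (fun h => h1 (by rw [h, MonoidHom.one_apply])) (fun h => h2 (by rw [h, MonoidHom.one_apply]))
  exact h2 (by rw [hg]; exact hμ₁ _ (hUL l _ (U.pow_mem hx t)))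

variable (L) in
/-- The functions obtained from `f` by composing with elements of `L` and power maps. -/
def galoisOrbit {α : Type*} (f : K → α) : Set (K → α) :=
  {f' | ∃ (l : L) (t : ℕ), t.Coprime (Nat.card K) ∧ ∀ g, f' g = f (l • g ^ t)}

variable (L K) in
/-- The combined action of `L` and power maps. -/
noncomputable abbrev powerAction [Finite K] : MulAction (L × (ZMod (Nat.card K))ˣ) K where
  smul γ g := γ.1 • g ^ (γ.2 : ZMod (Nat.card K)).val
  one_smul g := by
    change (1 : L) • g ^ ((1 : (ZMod (Nat.card K))ˣ) : ZMod (Nat.card K)).val = g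
    rw [one_smul, Units.val_one]
    conv_rhs => rw [← pow_one g]
    rw [pow_eq_pow_iff_modEq]
    refine Nat.ModEq.of_dvd (orderOf_dvd_natCard g) ?_
    rw [← ZMod.natCast_eq_natCast_iff, ZMod.natCast_val, ZMod.cast_id', id, Nat.cast_one]
  mul_smul a b g := by
    change (a.1 * b.1) • g ^ ((a.2 * b.2 : (ZMod (Nat.card K))ˣ) : ZMod (Nat.card K)).val =
      a.1 • (b.1 • g ^ (b.2 : ZMod (Nat.card K)).val) ^ (a.2 : ZMod (Nat.card K)).val
    rw [mul_smul, ← smul_pow', ← pow_mul]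
    congr 2
    rw [pow_eq_pow_iff_modEq]
    refine Nat.ModEq.of_dvd (orderOf_dvd_natCard g) ?_
    rw [← ZMod.natCast_eq_natCast_iff]
    simp [mul_comm]

/-- This is an orbit of `L × (ZMod |K|)ˣ` whose stabilizer contains all units congruent to `1` mod
`p`. -/
theorem card_galoisOrbit_dvd [Finite K] {p : ℕ} [hp : Fact p.Prime] (hpK : p ∣ Nat.card K)
    {α : Type*} (f : K → α) (hf : ∀ g t, t ≡ 1 [MOD p] → f (g ^ t) = f g) :
    Nat.card (galoisOrbit L f) ∣ Nat.card L * (p - 1) := by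
  let _ := powerAction L K
  have hdef : ∀ (γ : L × (ZMod (Nat.card K))ˣ) (g : K),
    γ • g = γ.1 • g ^ (γ.2 : ZMod (Nat.card K)).val := fun _ _ => rfl
  let _ : MulAction (L × (ZMod (Nat.card K))ˣ) (K → α) := arrowAction
  have horb : galoisOrbit L f = MulAction.orbit (L × (ZMod (Nat.card K))ˣ) f := by
    ext f'
    constructor
    · rintro ⟨l, t, ht, hg⟩
      refine ⟨((l, ZMod.unitOfCoprime t ht) : L × (ZMod (Nat.card K))ˣ)⁻¹, ?_⟩
      ext g
      change f ((((l, ZMod.unitOfCoprime t ht) : L × (ZMod (Nat.card K))ˣ)⁻¹)⁻¹ • g) = f' g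
      rw [hg, inv_inv, hdef]
      congr 2
      rw [pow_eq_pow_iff_modEq]
      refine Nat.ModEq.of_dvd (orderOf_dvd_natCard g) ?_
      rw [← ZMod.natCast_eq_natCast_iff]
      simp
    · rintro ⟨γ, rfl⟩
      exact ⟨γ⁻¹.1, (γ⁻¹.2 : ZMod (Nat.card K)).val, ZMod.val_coe_unit_coprime _, fun g => rfl⟩
  rw [horb, Nat.card_coe_set_eq, ← MulAction.index_stabilizer]
  set N : Subgroup (L × (ZMod (Nat.card K))ˣ) := (⊥ : Subgroup L).prod (ZMod.unitsMap hpK).ker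
  have hN : N ≤ MulAction.stabilizer _ f := by
    have hfix : ∀ γ ∈ N, ∀ g, f (γ • g) = f g := by
      rintro ⟨l, u⟩ ⟨hl, hu⟩ g
      obtain rfl : l = 1 := hl
      rw [hdef, one_smul]
      apply hf
      rw [← ZMod.natCast_eq_natCast_iff, Nat.cast_one]
      have := congrArg Units.val (MonoidHom.mem_ker.mp hu)
      rw [ZMod.unitsMap_val, Units.val_one] at this
      rw [ZMod.natCast_val]
      exact this
    intro γ hγ
    rw [MulAction.mem_stabilizer_iff]
    ext g
    exact hfix γ⁻¹ (N.inv_mem hγ) g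
  refine (Subgroup.index_dvd_of_le hN).trans ?_
  rw [Subgroup.index_prod, Subgroup.index_bot, Subgroup.index_ker]
  refine Nat.mul_dvd_mul_left _ ?_
  rw [← Nat.totient_prime hp.out, ← ZMod.card_units_eq_totient, ← Nat.card_eq_fintype_card]
  exact Subgroup.card_subgroup_dvd_card _

end

theorem card_monoidHom_eq_index {K : Type*} [Group K] [Finite K] :
    Nat.card (K →* ℂˣ) = (commutator K).index := by
  have h : (commutator K).index = Nat.card (Abelianization K) := rfl
  rw [h, ← CommGroup.card_monoidHom_of_hasEnoughRootsOfUnity (Abelianization K) ℂ]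
  exact Nat.card_congr Abelianization.lift
  
theorem card_monoidHom_sub_one_dvd {L K : Type*} [Group L] [Group K] [MulDistribMulAction L K]
    [Finite K] {p : ℕ} [hp : Fact p.Prime] (hpK : p ∣ Nat.card K)
    (hpow : ∀ x : K, x ^ p ∈ commutator K) (hne : commutator K ≠ ⊤)
    (htrans : ∀ μ₁ μ₂ : K →* ℂˣ, μ₁ ≠ 1 → μ₂ ≠ 1 →
      ∃ (l : L) (t : ℕ), t.Coprime (Nat.card K) ∧ ∀ g, μ₂ g = μ₁ (l • g ^ t)) :
    (commutator K).index - 1 ∣ Nat.card L * (p - 1) := by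
  obtain ⟨x, hx⟩ : ∃ x, x ∉ commutator K := by
    by_contra! hcon
    exact hne (eq_top_iff.mpr fun x _ => hcon x)
  obtain ⟨μ, -, hμx⟩ := exists_apply_ne_one (commutator K) le_rfl hx
  have hμ : μ ≠ 1 := fun hμ => hμx (by rw [hμ, MonoidHom.one_apply])
  have h1 := card_galoisOrbit_dvd (L := L) hpK μ (by
    intro g t ht
    have h1 : μ g ^ p = 1 := by
      rw [← map_pow]
      exact MonoidHom.mem_ker.mp (Abelianization.commutator_subset_ker μ (hpow g))
    rw [map_pow]
    conv_rhs => rw [← pow_one (μ g)]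
    rw [pow_eq_pow_iff_modEq]
    exact ht.of_dvd (orderOf_dvd_of_pow_eq_one h1))
  have h2 : galoisOrbit L (μ : K → ℂˣ) = (fun μ : K →* ℂˣ => (μ : K → ℂˣ)) '' {1}ᶜ := by
    ext f
    constructor
    · rintro ⟨l, t, ht, hf⟩
      refine ⟨(powMonoidHom t).comp (μ.comp (MulDistribMulAction.toMonoidHom K l)), ?_, ?_⟩
      · intro hone
        obtain ⟨m, hm⟩ := exists_pow_eq_self_of_coprime (x := l⁻¹ • x) (n := t)
          (ht.coprime_dvd_right (orderOf_dvd_natCard _))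
        have h3 : μ (l • (l⁻¹ • x) ^ m) ^ t = 1 := DFunLike.congr_fun hone ((l⁻¹ • x) ^ m)
        rw [← map_pow, ← smul_pow', ← pow_mul, mul_comm, pow_mul, hm, smul_inv_smul] at h3
        exact hμx h3
      · ext1 g
        rw [hf, smul_pow', map_pow]
        rfl
    · rintro ⟨μ₂, h2, rfl⟩
      exact htrans μ μ₂ hμ h2
  have : Finite (K →* ℂˣ) := by
    apply Nat.finite_of_card_ne_zero
    rw [card_monoidHom_eq_index]
    exact Subgroup.index_ne_zero_of_finite
  rwa [h2, Nat.card_image_of_injective DFunLike.coe_injective, Nat.card_coe_set_eq,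
    Set.ncard_compl, Set.ncard_singleton, card_monoidHom_eq_index] at h1

end GaloisFrobenius

/-! ### Supports of characters, and the radical in class two -/

namespace GaloisFrobenius

open Representation
open scoped commutatorElement

section

variable {L K : Type*} [Group L] [Group K] [MulDistribMulAction L K]

/-- To multiply `F (l • g ^ t)` by `ε g`, first multiply `F` by the linear character `(ε ∘ l⁻¹) ^
s`, where `s t ≡ 1` mod `|K|`. -/
theorem mul_mem_galoisOrbit [Finite K] [Nontrivial K] {F : K → ℂ}
    (hF : ∀ ε : K →* ℂˣ, (fun g => (ε g : ℂ) * F g) ∈ galoisOrbit L F) (ε : K →* ℂˣ) {f : K → ℂ}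
    (hf : f ∈ galoisOrbit L F) : (fun g => (ε g : ℂ) * f g) ∈ galoisOrbit L F := by
  obtain ⟨l, t, ht, hg⟩ := hf
  obtain ⟨s, -, hs⟩ := Nat.exists_mul_mod_eq_one_of_coprime ht Finite.one_lt_card
  obtain ⟨l', t', ht', hg'⟩ := hF
    ((powMonoidHom s).comp (ε.comp (MulDistribMulAction.toMonoidHom K l⁻¹)))
  refine ⟨l' * l, t * t', ht.mul_left ht', fun g => ?_⟩
  have h1 := hg' (l • g ^ t)
  beta_reduce at h1
  have h2 : ((powMonoidHom s).comp (ε.comp (MulDistribMulAction.toMonoidHom K l⁻¹))) (l • g ^ t)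
      = ε g := by
    change ε (l⁻¹ • l • g ^ t) ^ s = ε g
    rw [inv_smul_smul, ← map_pow, ← pow_mul]
    conv_rhs => rw [← pow_one g]
    congr 1
    rw [pow_eq_pow_iff_modEq]
    refine Nat.ModEq.of_dvd (orderOf_dvd_natCard g) ?_
    rw [Nat.ModEq, hs, Nat.mod_eq_of_lt Finite.one_lt_card]
  rw [h2] at h1
  simp only [hg, h1]
  rw [mul_smul, pow_mul, smul_pow' l (g ^ t) t']

/-- The orbit of `F` has size prime to `p`, while the linear characters form a `p`-group acting on
it by multiplication. So some member is fixed, hence zero wherever a linear character is not `1`,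
that is, off `K'`. The same then holds for `F`. -/
theorem mem_commutator_of_apply_ne_zero [Finite L] [Finite K] {p : ℕ} [hp : Fact p.Prime]
    (hK : IsPGroup p K) (hL : ¬ p ∣ Nat.card L) {F : K → ℂ}
    (hF : ∀ ε : K →* ℂˣ, (fun g => (ε g : ℂ) * F g) ∈ galoisOrbit L F)
    (hper : ∀ g t, t ≡ 1 [MOD p] → F (g ^ t) = F g) {x : K} (hx : F x ≠ 0) : x ∈ commutator K := by
  by_contra hxK
  have : Nontrivial K := ⟨x, 1, fun h => hxK (h ▸ (commutator K).one_mem)⟩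
  obtain ⟨n, hn0, hn⟩ := hK.nontrivial_iff_card.mp this
  have hdvd := card_galoisOrbit_dvd (L := L) (p := p) (by rw [hn]; exact dvd_pow_self p hn0.ne') F
    hper
  have hndvd : ¬ p ∣ Nat.card L * (p - 1) := by
    rw [hp.out.dvd_mul]
    rintro (h | h)
    · exact hL h
    · have := Nat.le_of_dvd (Nat.sub_pos_of_lt hp.out.one_lt) h
      have := hp.out.pos
      omega
  have hfin : Finite (galoisOrbit L F) := by
    apply Nat.finite_of_card_ne_zero
    intro h0
    rw [h0, zero_dvd_iff] at hdvd
    exact hndvd (hdvd ▸ dvd_zero p)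
  let _ : MulAction (K →* ℂˣ) (galoisOrbit L F) :=
    { smul := fun ε f => ⟨fun g => (ε g : ℂ) * f.1 g, mul_mem_galoisOrbit hF ε f.2⟩
      one_smul := fun f => Subtype.ext (funext fun g => one_mul (f.1 g))
      mul_smul := fun a b f => Subtype.ext (funext fun g => mul_assoc (a g : ℂ) (b g) (f.1 g)) }
  have hdual : IsPGroup p (K →* ℂˣ) := by
    obtain ⟨m, hm⟩ := (hK.to_quotient (commutator K)).exists_card_eq
    apply IsPGroup.of_card (n := m)
    rw [card_monoidHom_eq_index, ← hm]
    rfl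
  have hmod := hdual.card_modEq_card_fixedPoints (galoisOrbit L F)
  have hempty : IsEmpty (MulAction.fixedPoints (K →* ℂˣ) (galoisOrbit L F)) := by
    refine ⟨?_⟩
    rintro ⟨⟨f, hfo⟩, hf⟩
    obtain ⟨l, t, ht, hg⟩ := hfo
    obtain ⟨m, hm⟩ := exists_pow_eq_self_of_coprime (x := l⁻¹ • x) (n := t)
      (ht.coprime_dvd_right (orderOf_dvd_natCard _))
    set y := (l⁻¹ • x) ^ m with hy
    have hyx : l • y ^ t = x := by
      rw [hy, ← pow_mul, mul_comm, pow_mul, hm, smul_inv_smul]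
    have hyK : y ∉ commutator K := fun h => hxK (by
      rw [← hyx]
      exact smul_mem_of_characteristic _ l (pow_mem h t))
    obtain ⟨ε, -, hε⟩ := exists_apply_ne_one (commutator K) le_rfl hyK
    have h1 : (ε y : ℂ) * f y = f y := congrFun (congrArg Subtype.val (hf ε)) y
    have h2 : f y ≠ 0 := by rwa [hg, hyx]
    exact hε (Units.ext (mul_right_cancel₀ h2 (h1.trans (one_mul _).symm)))
  rw [Nat.card_of_isEmpty (α := MulAction.fixedPoints (K →* ℂˣ) (galoisOrbit L F))] at hmod
  exact hndvd ((Nat.modEq_zero_iff_dvd.mp hmod).trans hdvd)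

theorem IsFixedPointFree.not_dvd_card [Finite L] [Finite K] [Nontrivial K] {p : ℕ}
    [hp : Fact p.Prime] (hK : IsPGroup p K) (h : IsFixedPointFree L K) : ¬ p ∣ Nat.card L := by
  intro hpL
  obtain ⟨n, hn0, hn⟩ := hK.nontrivial_iff_card.mp ‹_›
  have h1 : p ∣ Nat.card K := by rw [hn]; exact dvd_pow_self p hn0.ne'
  have h2 := hpL.trans h.card_dvd
  have h3 := (Nat.dvd_sub_iff_right Nat.card_pos h1).mp h2
  exact hp.out.one_lt.ne' (Nat.dvd_one.mp h3)

end

section ClassTwo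

variable {P : Type*} [Group P]

theorem commutatorElement_mul_left_of_le_center (hc : commutator P ≤ Subgroup.center P)
    (x x' y : P) : ⁅x * x', y⁆ = ⁅x, y⁆ * ⁅x', y⁆ := by
  have h := Subgroup.mem_center_iff.mp (hc (Subgroup.commutator_mem_commutator
    (Subgroup.mem_top x') (Subgroup.mem_top y)))
  have h1 : ⁅x * x', y⁆ = x * ⁅x', y⁆ * x⁻¹ * ⁅x, y⁆ := by simp only [commutatorElement_def]; group
  rw [h1, h x, mul_inv_cancel_right, h]

theorem commutatorElement_mul_right_of_le_center (hc : commutator P ≤ Subgroup.center P)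
    (x y y' : P) :
    ⁅x, y * y'⁆ = ⁅x, y⁆ * ⁅x, y'⁆ := by
  have h := Subgroup.mem_center_iff.mp (hc (Subgroup.commutator_mem_commutator
    (Subgroup.mem_top x) (Subgroup.mem_top y')))
  have h1 : ⁅x, y * y'⁆ = ⁅x, y⁆ * (y * ⁅x, y'⁆ * y⁻¹) := by
    simp only [commutatorElement_def]; group
  rw [h1, h y, mul_inv_cancel_right]

variable (hc : commutator P ≤ Subgroup.center P)

/-- The homomorphism `y ↦ ⁅x, y⁆` of a group of class two. -/
def commutatorHom (x : P) : P →* commutator P where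
  toFun y := ⟨⁅x, y⁆, Subgroup.commutator_mem_commutator (Subgroup.mem_top x) (Subgroup.mem_top y)⟩
  map_one' := Subtype.ext (commutatorElement_one_right x)
  map_mul' y y' := Subtype.ext (commutatorElement_mul_right_of_le_center hc x y y')

theorem coe_commutatorHom (x y : P) : (commutatorHom hc x y : P) = ⁅x, y⁆ := rfl

theorem commutatorHom_mul (x x' y : P) :
    commutatorHom hc (x * x') y = commutatorHom hc x y * commutatorHom hc x' y :=
  Subtype.ext (commutatorElement_mul_left_of_le_center hc x x' y)

theorem commutatorHom_one (y : P) : commutatorHom hc 1 y = 1 :=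
  Subtype.ext (commutatorElement_one_left y)

theorem commutatorHom_of_mem {x : P} (hx : x ∈ Subgroup.center P) (y : P) :
    commutatorHom hc x y = 1 :=
  Subtype.ext (commutatorElement_eq_one_iff_mul_comm.mpr (Subgroup.mem_center_iff.mp hx y).symm)

/-- The radical of the form `(x, y) ↦ lam ⁅x, y⁆`. -/
def radical (lam : commutator P →* ℂˣ) : Subgroup P where
  carrier := {x | ∀ y, lam (commutatorHom hc x y) = 1}
  one_mem' y := by rw [commutatorHom_one, map_one]
  mul_mem' hx hx' y := by rw [commutatorHom_mul, map_mul, hx, hx', one_mul]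
  inv_mem' {x} hx y := by
    have := commutatorHom_mul hc x⁻¹ x y
    rw [inv_mul_cancel, commutatorHom_one] at this
    have h2 := congrArg lam this
    rwa [map_one, map_mul, hx, mul_one, eq_comm] at h2

variable (lam : commutator P →* ℂˣ)

theorem commutator_le_radical : commutator P ≤ radical hc lam := fun x hx y => by
  rw [commutatorHom_of_mem hc (hc hx), map_one]

instance : (radical hc lam).Normal :=
  Subgroup.Normal.of_commutator_le P (commutator_le_radical hc lam)

theorem conj_eq_mul_commutatorHom (g x : P) : g * x * g⁻¹ = x * commutatorHom hc g x := by
  have h := Subgroup.mem_center_iff.mp (hc (commutatorHom hc g x).2) x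
  rw [h, coe_commutatorHom, commutatorElement_def, inv_mul_cancel_right]

theorem lam_commutatorHom_of_mem_radical {lam} {x : P} (hx : x ∈ radical hc lam) (y : P) :
    lam (commutatorHom hc y x) = 1 := by
  have h1 : commutatorHom hc y x = (commutatorHom hc x y)⁻¹ :=
    Subtype.ext (commutatorElement_inv x y).symm
  rw [h1, map_inv, hx y, inv_one]

/-- Conjugating `g` by `y` multiplies `χ g` by `lam ⁅y, g⁆` without changing it. -/
theorem IrrOver.eq_zero_of_notMem_radical {lam} {χ : P → ℂ} (hχ : IrrOver (commutator P) lam χ)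
    {g : P} (hg : g ∉ radical hc lam) : χ g = 0 := by
  by_contra hne
  apply hg
  intro y
  have h1 : ∀ y, lam (commutatorHom hc y g) = 1 := by
    intro y
    have h2 := hχ.apply_conj g y
    rw [conj_eq_mul_commutatorHom hc, hχ.apply_mul] at h2
    exact Units.ext (mul_right_cancel₀ hne (h2.trans (one_mul _).symm))
  have h3 : commutatorHom hc g y = (commutatorHom hc y g)⁻¹ :=
    Subtype.ext (commutatorElement_inv y g).symm
  rw [h3, map_inv, h1, inv_one]

/-- On the radical `lam` kills all commutators with `P`. This both allows the extension to `μ` and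
makes `μ` invariant under `P`. -/
theorem exists_irrOver_radical [Finite P] : ∃ (μ : radical hc lam →* ℂˣ) (χ : P → ℂ),
    (∀ z : commutator P, μ (Subgroup.inclusion (commutator_le_radical hc lam) z) = lam z) ∧
      IrrOver (radical hc lam) μ χ := by
  set Z := radical hc lam
  obtain ⟨μ, hμ⟩ := exists_extension ((commutator P).subgroupOf Z)
    (lam.comp (Subgroup.subgroupOfEquivOfLe (commutator_le_radical hc lam)).toMonoidHom) (by
      intro d hd
      have key : commutator Z ≤ (lam.ker.map (commutator P).subtype).subgroupOf Z := by
        rw [commutator_def, Subgroup.commutator_le]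
        intro a _ b _
        rw [Subgroup.mem_subgroupOf]
        exact ⟨commutatorHom hc a b, a.2 b, rfl⟩
      obtain ⟨z, hz, hzd⟩ := key hd
      have : Subgroup.subgroupOfEquivOfLe (commutator_le_radical hc lam) d = z :=
        Subtype.ext hzd.symm
      change lam (Subgroup.subgroupOfEquivOfLe (commutator_le_radical hc lam) d) = 1
      rw [this]
      exact hz)
  have hμ' : ∀ z : commutator P, μ (Subgroup.inclusion (commutator_le_radical hc lam) z) = lam z := by
    intro z
    exact hμ ⟨Subgroup.inclusion (commutator_le_radical hc lam) z, z.2⟩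
  obtain ⟨S, hS, hsum⟩ := IrrOver.exists_finset_sum_sq Z μ (by
    intro g n
    have : MulAut.conjNormal g n =
        n * Subgroup.inclusion (commutator_le_radical hc lam) (commutatorHom hc g n) :=
      Subtype.ext (conj_eq_mul_commutatorHom hc g n)
    rw [this, map_mul, hμ', lam_commutatorHom_of_mem_radical hc n.2, mul_one])
  have hne : S.Nonempty := by
    rw [Finset.nonempty_iff_ne_empty]
    rintro rfl
    rw [Finset.sum_empty] at hsum
    exact Subgroup.index_ne_zero_of_finite (H := Z) (by exact_mod_cast hsum.symm)
  obtain ⟨χ, hχ⟩ := hne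
  exact ⟨μ, χ, hμ', hS χ hχ⟩

theorem IrrOver.of_extension {lam} {Z : Subgroup P} (hZ : commutator P ≤ Z) {μ : Z →* ℂˣ}
    {χ : P → ℂ} (hμ : ∀ z : commutator P, μ (Subgroup.inclusion hZ z) = lam z)
    (h : IrrOver Z μ χ) : IrrOver (commutator P) lam χ := by
  have := h.mono hZ
  rwa [show μ.comp (Subgroup.inclusion hZ) = lam from MonoidHom.ext hμ] at this

/-- Orthonormality: `χ g * χ g⁻¹` is `χ 1 ^ 2` on the radical and `0` off it. -/
theorem IrrOver.sq_mul_card_radical [Finite P] {lam} {μ : radical hc lam →* ℂˣ} {χ : P → ℂ}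
    (hμ : ∀ z : commutator P, μ (Subgroup.inclusion (commutator_le_radical hc lam) z) = lam z)
    (h : IrrOver (radical hc lam) μ χ) : χ 1 ^ 2 * Nat.card (radical hc lam) = Nat.card P := by
  classical
  have := Fintype.ofFinite P
  have h' := h.of_extension (commutator_le_radical hc lam) hμ
  rw [← h.sum_mul_inv]
  have h1 : ∀ g, χ g * χ g⁻¹ = if g ∈ radical hc lam then χ 1 ^ 2 else 0 := by
    intro g
    split_ifs with hg
    · have h2 := h.apply_coe ⟨g, hg⟩
      have h3 := h.apply_coe ⟨g, hg⟩⁻¹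
      rw [map_inv, Units.val_inv_eq_inv_val] at h3
      change χ g = _ at h2
      change χ g⁻¹ = _ at h3
      rw [h2, h3]
      field_simp
    · rw [h'.eq_zero_of_notMem_radical hc hg, zero_mul]
  rw [Finset.sum_congr rfl fun g _ => h1 g, ← Finset.sum_filter, Finset.sum_const, nsmul_eq_mul,
    mul_comm, Nat.card_eq_fintype_card, Fintype.card_subtype]

end ClassTwo

end GaloisFrobenius

/-! ### Class two: order of the radical and conjugacy of the characters of `P'` -/

namespace GaloisFrobenius

open Representation
open scoped commutatorElement

theorem IrrOver.mul_monoidHom {K : Type*} [Group K] {M : Subgroup K} {lam : M →* ℂˣ} {χ : K → ℂ}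
    (h : IrrOver M lam χ) (ε : K →* ℂˣ) (hε : ∀ m ∈ M, ε m = 1) :
    IrrOver M lam fun g => (ε g : ℂ) * χ g := by
  obtain ⟨d, ρ, hirr, rfl, hM⟩ := h
  let ρ' : Representation ℂ K (Fin d → ℂ) :=
    { toFun := fun g => (ε g : ℂ) • ρ g
      map_one' := by simp
      map_mul' := fun a b => by
        rw [map_mul, map_mul, Units.val_mul, smul_mul_smul_comm] }
  have hρ' : ∀ g, ρ' g = (ε g : ℂ) • ρ g := fun g => rfl
  refine ⟨d, ρ', ?_, ?_, fun m => ?_⟩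
  · rw [isIrreducible_iff] at hirr ⊢
    refine ⟨hirr.1, fun W hW => hirr.2 W fun g w hw => ?_⟩
    have := W.smul_mem (ε g : ℂ)⁻¹ (hW g w hw)
    rwa [hρ', LinearMap.smul_apply, inv_smul_smul₀ (ε g).ne_zero] at this
  · ext g
    simp [Representation.character, hρ']
  · rw [hρ', hε m m.2, Units.val_one, one_smul, hM]

theorem sq_eq_mul_sq_absurd {p a b : ℕ} (hp : p.Prime) (hb : b ≠ 0) (h : a ^ 2 = p * b ^ 2) :
    False := by
  have := Fact.mk hp
  have ha : a ≠ 0 := by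
    rintro rfl
    rw [zero_pow two_ne_zero, eq_comm, mul_eq_zero] at h
    exact h.elim hp.ne_zero (pow_ne_zero 2 hb)
  have h1 := congrArg (padicValNat p) h
  rw [padicValNat.pow a 2, padicValNat.mul hp.ne_zero (pow_ne_zero 2 hb), padicValNat.pow b 2,
    padicValNat_self] at h1
  omega

theorem pow_eq_one_of_mem_commutator {P : Type*} [Group P] (hc : commutator P ≤ Subgroup.center P)
    {p : ℕ} (hpow : ∀ x : P, x ^ p ∈ commutator P) {z : P} (hz : z ∈ commutator P) : z ^ p = 1 := by
  let U : Subgroup P :=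
    { carrier := {z | z ∈ Subgroup.center P ∧ z ^ p = 1}
      one_mem' := ⟨one_mem _, one_pow p⟩
      mul_mem' := fun {a b} ha hb => ⟨mul_mem ha.1 hb.1, by
        have h : Commute a b := (Subgroup.mem_center_iff.mp hb.1 a)
        rw [h.mul_pow, ha.2, hb.2, one_mul]⟩
      inv_mem' := fun {a} ha => ⟨inv_mem ha.1, by rw [inv_pow, ha.2, inv_one]⟩ }
  have key : commutator P ≤ U := by
    rw [commutator_def, Subgroup.commutator_le]
    intro x _ y _
    refine ⟨hc (commutatorHom hc x y).2, ?_⟩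
    have h1 := congrArg Subtype.val (map_pow (commutatorHom hc x) y p)
    rw [Subgroup.coe_pow, coe_commutatorHom, coe_commutatorHom] at h1
    rw [← h1, commutatorElement_eq_one_iff_mul_comm]
    exact Subgroup.mem_center_iff.mp (hc (hpow y)) x
  exact (key hz).2

section

variable {L P : Type*} [Group L] [Group P] [MulDistribMulAction L P] [Finite P]
  {p : ℕ} [hp : Fact p.Prime]

/-- `mem_commutator_of_apply_ne_zero` is applied to `χ` cut off to the set where `lam (g ^ p) = 1`.
The cut-off makes the function insensitive to exponents `t ≡ 1` mod `p`, and it is compatible with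
twisting because `ε (g ^ p) = 1`. On the radical `χ` does not vanish. -/
theorem IsGaloisTransitive.mem_commutator_of_mem_radical [Finite L] [Nontrivial P]
    (hc : commutator P ≤ Subgroup.center P) (hGT : IsGaloisTransitive L P) (hfpf : IsFixedPointFree L P) (hP : IsPGroup p P)
    (hpow : ∀ x : P, x ^ p ∈ commutator P) {lam : commutator P →* ℂˣ} (hlam : lam ≠ 1)
    {x : P} (hx : x ∈ radical hc lam) (hxp : lam ⟨x ^ p, hpow x⟩ = 1) : x ∈ commutator P := by
  classical
  obtain ⟨μ, χ, hμ, hχ⟩ := exists_irrOver_radical hc lam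
  have hχ' := hχ.of_extension (commutator_le_radical hc lam) hμ
  have h1 := hχ.apply_one_ne_zero
  set F : P → ℂ := fun g => if χ (g ^ p) = χ 1 then χ g else 0 with hFdef
  have hcond : ∀ g, χ (g ^ p) = lam ⟨g ^ p, hpow g⟩ * χ 1 := fun g => hχ'.apply_coe ⟨g ^ p, hpow g⟩
  refine mem_commutator_of_apply_ne_zero (L := L) (F := F) hP (hfpf.not_dvd_card hP) ?_ ?_ ?_
  · intro ε
    have hε : ∀ m ∈ commutator P, ε m = 1 := fun m hm =>
      MonoidHom.mem_ker.mp (Abelianization.commutator_subset_ker ε hm)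
    obtain ⟨l, t, ht, hg⟩ := hGT (commutator P) inferInstance
      (fun l m hm => smul_mem_of_characteristic _ l hm) lam lam hlam hlam χ _ hχ'
      (hχ'.mul_monoidHom ε hε) (by simp)
    refine ⟨l, t, ht, fun g => ?_⟩
    have h2 : χ ((l • g ^ t) ^ p) = χ (g ^ p) := by
      have := hg (g ^ p)
      rw [hε _ (hpow g), Units.val_one, one_mul, ← pow_mul, mul_comm, pow_mul, smul_pow' l (g ^ t)]
        at this
      exact this.symm
    simp only [hFdef, h2]
    split_ifs
    · exact hg g
    · exact mul_zero _
  · intro g t ht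
    have ht1 : 1 ≤ t := by
      by_contra h0
      obtain rfl : t = 0 := by omega
      have := (Nat.modEq_zero_iff_dvd.mp ht.symm)
      exact hp.out.one_lt.ne' (Nat.dvd_one.mp this)
    obtain ⟨k, hk⟩ := (Nat.modEq_iff_dvd' ht1).mp ht.symm
    have hgt : g ^ t = g * (g ^ p) ^ k := by
      rw [← pow_mul, ← hk, ← pow_succ']
      congr 1
      omega
    have hcen : Commute g ((g ^ p) ^ k) := ((Commute.refl g).pow_right p).pow_right k
    have hgtp : (g ^ t) ^ p = g ^ p := by
      rw [hgt, hcen.mul_pow, pow_eq_one_of_mem_commutator hc hpow (pow_mem (hpow g) k), mul_one]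
    simp only [hFdef, hgtp]
    split_ifs with h2
    · have h3 : lam ⟨g ^ p, hpow g⟩ = 1 := by
        rw [hcond] at h2
        exact Units.ext (mul_right_cancel₀ h1 (h2.trans (one_mul _).symm))
      have h4 := hχ'.apply_mul g (⟨g ^ p, hpow g⟩ ^ k)
      rw [map_pow, h3, one_pow, Units.val_one, one_mul] at h4
      rw [hgt]
      exact h4
    · rfl
  · have h2 : χ (x ^ p) = χ 1 := by rw [hcond, hxp, Units.val_one, one_mul]
    simp only [hFdef, h2, if_true]
    have h3 := hχ.apply_coe ⟨x, hx⟩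
    change χ x = _ at h3
    rw [h3]
    exact mul_ne_zero (Units.ne_zero _) h1

/-- On the radical `x ↦ lam (x ^ p)` is a homomorphism, as `lam` kills the commutator error term.
Its values are `p`-th roots of unity, and its kernel is `P'` by the previous lemma. -/
theorem IsGaloisTransitive.card_radical [Finite L] [Nontrivial P]
    (hc : commutator P ≤ Subgroup.center P) (hGT : IsGaloisTransitive L P) (hfpf : IsFixedPointFree L P) (hP : IsPGroup p P)
    (hpow : ∀ x : P, x ^ p ∈ commutator P) {lam : commutator P →* ℂˣ} (hlam : lam ≠ 1) :
    Nat.card (radical hc lam) = Nat.card (commutator P) ∨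
      Nat.card (radical hc lam) = p * Nat.card (commutator P) := by
  let θ : radical hc lam →* ℂˣ :=
    { toFun := fun x => lam ⟨(x : P) ^ p, hpow x⟩
      map_one' := by
        rw [← map_one lam]
        congr 1
        exact Subtype.ext (one_pow p)
      map_mul' := fun x y => by
        rw [← map_mul]
        have h1 : (⟨((x * y : radical hc lam) : P) ^ p, hpow _⟩ : commutator P) =
            ⟨(x : P) ^ p, hpow x⟩ * ⟨(y : P) ^ p, hpow y⟩ * commutatorHom hc y x ^ p.choose 2 := by
          apply Subtype.ext
          exact mul_pow_of_commutatorElement_central (x : P) y (fun z =>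
            (Subgroup.mem_center_iff.mp (hc (commutatorHom hc y x).2) z).symm) p
        rw [h1, map_mul, map_pow, y.2, one_pow, mul_one] }
  have hker : θ.ker = (commutator P).subgroupOf (radical hc lam) := by
    ext x
    rw [MonoidHom.mem_ker, Subgroup.mem_subgroupOf]
    refine ⟨fun h => hGT.mem_commutator_of_mem_radical hc hfpf hP hpow hlam x.2 h, fun h => ?_⟩
    change lam _ = 1
    rw [← map_one lam]
    congr 1
    exact Subtype.ext (pow_eq_one_of_mem_commutator hc hpow h)
  have hrange : θ.range ≤ rootsOfUnity p ℂ := by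
    rintro _ ⟨x, rfl⟩
    rw [mem_rootsOfUnity]
    change lam _ ^ p = 1
    rw [← map_pow, ← map_one lam]
    congr 1
    exact Subtype.ext (pow_eq_one_of_mem_commutator hc hpow (hpow x))
  have hdvd := Subgroup.card_dvd_of_le hrange
  have : NeZero p := ⟨hp.out.ne_zero⟩
  rw [← Subgroup.index_ker, hker, Complex.card_rootsOfUnity] at hdvd
  have h2 := Subgroup.card_mul_index ((commutator P).subgroupOf (radical hc lam))
  rw [Nat.card_congr (Subgroup.subgroupOfEquivOfLe (commutator_le_radical hc lam)).toEquiv] at h2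
  rcases (Nat.dvd_prime hp.out).mp hdvd with h | h <;> rw [h] at h2
  · left; rw [← h2, mul_one]
  · right; rw [← h2, mul_comm]

/-- Degrees satisfy `χ 1 ^ 2 * |radical| = |P|`. The two possible radical orders differ by the
nonsquare factor `p`, so only one occurs and the degrees over `lam₁` and `lam₂` agree. -/
theorem IsGaloisTransitive.exists_of_commutator_le_center [Finite L] [Nontrivial P]
    (hc : commutator P ≤ Subgroup.center P) (hGT : IsGaloisTransitive L P) (hfpf : IsFixedPointFree L P) (hP : IsPGroup p P)
    (hpow : ∀ x : P, x ^ p ∈ commutator P) {lam₁ lam₂ : commutator P →* ℂˣ} (h₁ : lam₁ ≠ 1)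
    (h₂ : lam₂ ≠ 1) : ∃ (l : L) (t : ℕ), t.Coprime (Nat.card P) ∧ ∀ z : commutator P,
      lam₂ z = lam₁ ⟨l • (z : P) ^ t, smul_mem_of_characteristic _ l (pow_mem z.2 t)⟩ := by
  obtain ⟨μ₁, χ₁, hμ₁, hχ₁⟩ := exists_irrOver_radical hc lam₁
  obtain ⟨μ₂, χ₂, hμ₂, hχ₂⟩ := exists_irrOver_radical hc lam₂
  have hχ₁' := hχ₁.of_extension (commutator_le_radical hc lam₁) hμ₁
  have hχ₂' := hχ₂.of_extension (commutator_le_radical hc lam₂) hμ₂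
  have hd : χ₁ 1 = χ₂ 1 := by
    have e₁ := hχ₁.sq_mul_card_radical hc hμ₁
    have e₂ := hχ₂.sq_mul_card_radical hc hμ₂
    obtain ⟨d₁, h10, h1, -⟩ := hχ₁.exists_degree
    obtain ⟨d₂, h20, h2, -⟩ := hχ₂.exists_degree
    rw [h1] at e₁ ⊢
    rw [h2] at e₂ ⊢
    norm_cast at e₁ e₂ ⊢
    have hpos : 0 < Nat.card (commutator P) := Nat.card_pos
    rcases hGT.card_radical hc hfpf hP hpow h₁ with c₁ | c₁ <;>
      rcases hGT.card_radical hc hfpf hP hpow h₂ with c₂ | c₂ <;>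
      rw [c₁] at e₁ <;> rw [c₂] at e₂ <;> have e := e₁.trans e₂.symm
    · exact Nat.pow_left_injective two_ne_zero (Nat.eq_of_mul_eq_mul_right hpos e)
    · rw [← mul_assoc] at e
      exact (sq_eq_mul_sq_absurd hp.out h20.ne'
        ((Nat.eq_of_mul_eq_mul_right hpos e).trans (mul_comm _ _))).elim
    · rw [← mul_assoc] at e
      exact (sq_eq_mul_sq_absurd hp.out h10.ne'
        ((Nat.eq_of_mul_eq_mul_right hpos e).symm.trans (mul_comm _ _))).elim
    · exact Nat.pow_left_injective two_ne_zero
        (Nat.eq_of_mul_eq_mul_right (Nat.mul_pos hp.out.pos hpos) e)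
  obtain ⟨l, t, ht, hg⟩ := hGT (commutator P) inferInstance
    (fun l m hm => smul_mem_of_characteristic _ l hm) lam₁ lam₂ h₁ h₂ χ₁ χ₂ hχ₁' hχ₂' hd
  refine ⟨l, t, ht, fun z => ?_⟩
  have h1 := hg z
  rw [hχ₂'.apply_coe] at h1
  have h2 := hχ₁'.apply_coe
    ⟨l • (z : P) ^ t, smul_mem_of_characteristic _ l (pow_mem z.2 t)⟩
  rw [h2, ← hd] at h1
  exact Units.ext (mul_right_cancel₀ hχ₁.apply_one_ne_zero h1)

end

end GaloisFrobenius

/-! ### Applying Chevalley–Warning to commutators; orders of `P'` and `P / P'` -/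

namespace GaloisFrobenius

open scoped commutatorElement

/-- Through `s` the pairing becomes a linear family of endomorphisms of `M`, with kernels of order
`p`. Some nontrivial value `b x y` lies in the kernel at `x`, and so does `s (f x)`; as the kernel
has prime order, `s (f x)` is a power of `b x y`. Here `s` will be the `p`-th power map onto `P'`,
and for class three the squaring map from `Q'` onto `M`. -/
theorem exists_pairing_eq {p : ℕ} [hp : Fact p.Prime] {G S M : Type*} [Group G] [Finite G]
    [Group S] [CommGroup M] [Finite M] [Nontrivial M] (hM : ∀ m : M, m ^ p = 1)
    (hG : ∀ x : G, x ^ p ∈ commutator G) (s : S →* M) (hs : Function.Surjective s)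
    (b : G →* (S →* M)) (hb : ∀ x, s.ker ≤ (b x).ker)
    (hcard : Nat.card M ≤ (commutator G).index)
    (hrange : ∀ x, x ∉ commutator G → b x ≠ 1 ∧ (b x).range.index = p) (f : G → S)
    (hf : ∀ x, x ∉ commutator G → b x (f x) = 1 ∧ s (f x) ≠ 1) :
    ∃ x, x ∉ commutator G ∧ ∃ y, b x y = s (f x) := by
  let A₀ : G → (M →* M) := fun x => s.liftOfSurjective hs ⟨b x, hb x⟩
  have hA₀ : ∀ x y, A₀ x (s y) = b x y := fun x y =>
    MonoidHom.liftOfRightInverse_comp_apply s _ _ ⟨b x, hb x⟩ y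
  let A₁ : G →* (M →* M) :=
    { toFun := A₀
      map_one' := MonoidHom.ext fun m => by
        obtain ⟨y, rfl⟩ := hs m
        rw [hA₀, map_one, MonoidHom.one_apply, MonoidHom.one_apply]
      map_mul' := fun a a' => MonoidHom.ext fun m => by
        obtain ⟨y, rfl⟩ := hs m
        rw [hA₀, map_mul, MonoidHom.mul_apply, MonoidHom.mul_apply, hA₀, hA₀] }
  have hA : ∀ x y, Abelianization.lift A₁ (Abelianization.of x) (s y) = b x y := fun x y => by
    rw [Abelianization.lift_apply_of]
    exact hA₀ x y
  have hof : ∀ x : G, Abelianization.of x ≠ 1 → x ∉ commutator G := fun x hx hxG =>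
    hx ((QuotientGroup.eq_one_iff x).mpr hxG)
  have hrg : ∀ x : G, (Abelianization.lift A₁ (Abelianization.of x)).range = (b x).range := by
    intro x
    ext m
    constructor
    · rintro ⟨u, rfl⟩
      obtain ⟨y, rfl⟩ := hs u
      exact ⟨y, (hA x y).symm⟩
    · rintro ⟨y, rfl⟩
      exact ⟨s y, hA x y⟩
  have hker : ∀ x : G, x ∉ commutator G →
      Nat.card (Abelianization.lift A₁ (Abelianization.of x)).ker = p := by
    intro x hx
    rw [← Subgroup.index_range, hrg, (hrange x hx).2]
  obtain ⟨a, ha, u, hu1, hu2⟩ := exists_apply_apply_eq_one (p := p) (A := Abelianization G) hM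
    (fun a => by
      obtain ⟨x, rfl⟩ := QuotientGroup.mk_surjective a
      exact (QuotientGroup.eq_one_iff _).mpr (hG x))
    (Abelianization.lift A₁) hcard
    (fun a ha => by
      obtain ⟨x, rfl⟩ := QuotientGroup.mk_surjective a
      have hx := hof x ha
      refine ⟨fun h => (hrange x hx).1 (MonoidHom.ext fun y => ?_), hker x hx⟩
      rw [← hA x y]
      exact DFunLike.congr_fun h (s y))
  obtain ⟨x, rfl⟩ : ∃ x, Abelianization.of x = a := QuotientGroup.mk_surjective a
  have hx := hof x ha
  refine ⟨x, hx, ?_⟩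
  obtain ⟨y, rfl⟩ := hs u
  rw [hA] at hu1 hu2
  have h1 : Abelianization.lift A₁ (Abelianization.of x) (s (f x)) = 1 := by
    rw [hA, (hf x hx).1]
  have h2 := mem_zpowers_of_prime_card (hker x hx) (g := ⟨b x y, hu2⟩) (g' := ⟨s (f x), h1⟩)
    (fun h => hu1 (congrArg Subtype.val h))
  obtain ⟨k, hk⟩ := h2
  refine ⟨y ^ k, ?_⟩
  rw [map_zpow]
  exact congrArg Subtype.val hk

section

variable {L P : Type*} [Group L] [Group P] [MulDistribMulAction L P] [Finite P]
  {p : ℕ} [hp : Fact p.Prime]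

theorem IsGaloisTransitive.index_sub_one_dvd [Nontrivial P] (hGT : IsGaloisTransitive L P)
    (hP : IsPGroup p P) (hpow : ∀ x : P, x ^ p ∈ commutator P) :
    (commutator P).index - 1 ∣ Nat.card L * (p - 1) := by
  have := hP.isNilpotent
  obtain ⟨n, hn0, hn⟩ := hP.nontrivial_iff_card.mp ‹_›
  exact card_monoidHom_sub_one_dvd (by rw [hn]; exact dvd_pow_self p hn0.ne') hpow
    (Group.IsSolvable.commutator_lt_top_of_nontrivial P).ne
    fun μ₁ μ₂ h₁ h₂ => hGT.exists_of_monoidHom h₁ h₂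

theorem IsFixedPointFree.card_dvd_index_sub_one [Finite L] (h : IsFixedPointFree L P) :
    Nat.card L ∣ (commutator P).index - 1 := by
  let _ := quotientAction (L := L) (commutator P) fun l n hn => smul_mem_of_characteristic _ l hn
  exact (h.of_surjective (QuotientGroup.mk' (commutator P)) (QuotientGroup.mk'_surjective _)
    fun l k => rfl).card_dvd

theorem IsFixedPointFree.card_dvd_card_commutator_sub_one [Finite L] (h : IsFixedPointFree L P) :
    Nat.card L ∣ Nat.card (commutator P) - 1 := by
  let _ := restrictAction (L := L) (commutator P) fun l n hn => smul_mem_of_characteristic _ l hn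
  have : IsFixedPointFree L (commutator P) := fun l hl k hk =>
    Subtype.ext (h l hl k (congrArg Subtype.val hk))
  exact this.card_dvd

/-- For `p = 2` the factor `p - 1` disappears, so transitivity and freeness give opposite
divisibilities. -/
theorem IsGaloisTransitive.index_eq [Finite L] [Nontrivial P] (hGT : IsGaloisTransitive L P)
    (hfpf : IsFixedPointFree L P) (hP : IsPGroup 2 P) (hpow : ∀ x : P, x ^ 2 ∈ commutator P) :
    (commutator P).index = Nat.card L + 1 := by
  have h1 := hGT.index_sub_one_dvd hP hpow
  have h2 := hfpf.card_dvd_index_sub_one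
  rw [show 2 - 1 = 1 from rfl, mul_one] at h1
  have h3 := Nat.dvd_antisymm h1 h2
  have : (commutator P).index ≠ 0 := Subgroup.index_ne_zero_of_finite
  omega

theorem commutator_commutator_eq_bot {P : Type*} [Group P] (hc : commutator P ≤ Subgroup.center P) :
    commutator (commutator P) = ⊥ := by
  rw [commutator_eq_bot_iff_center_eq_top, eq_top_iff]
  intro x _
  rw [Subgroup.mem_center_iff]
  exact fun y => Subtype.ext (Subgroup.mem_center_iff.mp (hc x.2) y)

theorem IsGaloisTransitive.card_commutator_sub_one_dvd [Finite L] [Nontrivial P]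
    (hc : commutator P ≤ Subgroup.center P) (hne : commutator P ≠ ⊥)
    (hGT : IsGaloisTransitive L P) (hfpf : IsFixedPointFree L P) (hP : IsPGroup p P)
    (hpow : ∀ x : P, x ^ p ∈ commutator P) :
    Nat.card (commutator P) - 1 ∣ Nat.card L * (p - 1) := by
  let _ := restrictAction (L := L) (commutator P) fun l n hn => smul_mem_of_characteristic _ l hn
  have hbot := commutator_commutator_eq_bot hc
  have : Nontrivial (commutator P) := (Subgroup.nontrivial_iff_ne_bot _).mpr hne
  obtain ⟨n, hn0, hn⟩ := (hP.to_subgroup (commutator P)).nontrivial_iff_card.mp this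
  have h := card_monoidHom_sub_one_dvd (L := L) (K := commutator P) (p := p)
    (by rw [hn]; exact dvd_pow_self p hn0.ne')
    (fun x => by
      rw [hbot, Subgroup.mem_bot]
      exact Subtype.ext (pow_eq_one_of_mem_commutator hc hpow x.2))
    (by rw [hbot]; exact bot_ne_top)
    (fun lam₁ lam₂ h₁ h₂ => by
      obtain ⟨l, t, ht, hz⟩ := hGT.exists_of_commutator_le_center hc hfpf hP hpow h₁ h₂
      exact ⟨l, t, ht.coprime_dvd_right (Subgroup.card_subgroup_dvd_card _), hz⟩)
  rwa [hbot, Subgroup.index_bot] at h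

theorem IsGaloisTransitive.card_commutator_eq [Finite L] [Nontrivial P]
    (hc : commutator P ≤ Subgroup.center P) (hne : commutator P ≠ ⊥)
    (hGT : IsGaloisTransitive L P) (hfpf : IsFixedPointFree L P) (hP : IsPGroup 2 P)
    (hpow : ∀ x : P, x ^ 2 ∈ commutator P) : Nat.card (commutator P) = Nat.card L + 1 := by
  have h1 := hGT.card_commutator_sub_one_dvd hc hne hfpf hP hpow
  have h2 := hfpf.card_dvd_card_commutator_sub_one
  rw [show 2 - 1 = 1 from rfl, mul_one] at h1
  have h3 := Nat.dvd_antisymm h1 h2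
  have : 0 < Nat.card (commutator P) := Nat.card_pos
  omega

/-- A fixed-point-free involutive automorphism forces the group to be abelian. -/
theorem IsFixedPointFree.odd_card [Finite L] (hne : commutator P ≠ ⊥) (hfpf : IsFixedPointFree L P) :
    ¬ 2 ∣ Nat.card L := by
  intro h2
  obtain ⟨l, hl⟩ := exists_prime_orderOf_dvd_card' 2 h2
  have hl1 : l ≠ 1 := fun h => by rw [h, orderOf_one] at hl; omega
  have h3 : MonoidHom.FixedPointFree (MulDistribMulAction.toMonoidHom P l) := hfpf l hl1
  have h4 : Function.Involutive (MulDistribMulAction.toMonoidHom P l) := fun x => by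
    change l • l • x = x
    rw [← mul_smul, ← sq, ← hl, pow_orderOf_eq_one, one_smul]
  apply hne
  rw [commutator_eq_bot_iff_center_eq_top, eq_top_iff]
  exact fun x _ => Subgroup.mem_center_iff.mpr fun y => h3.commute_all_of_involutive h4 y x

/-- For even `n` the factor `p ^ 2 - 1` would divide, so the even number `p + 1` would divide `k`.
-/
theorem odd_of_pow_sub_one_dvd {p n k : ℕ} (hp : p.Prime) (hp2 : p ≠ 2) (hk : ¬ 2 ∣ k)
    (h : p ^ n - 1 ∣ k * (p - 1)) : Odd n := by
  rw [← Nat.not_even_iff_odd]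
  intro hn
  have h1 : p ^ 2 - 1 ∣ k * (p - 1) := (Nat.pow_sub_one_dvd_pow_sub_one p hn.two_dvd).trans h
  have h2 : p ^ 2 - 1 = (p + 1) * (p - 1) := by
    have := Nat.sq_sub_sq p 1
    rwa [one_pow] at this
  rw [h2] at h1
  have h3 := Nat.dvd_of_mul_dvd_mul_right (Nat.sub_pos_of_lt hp.one_lt) h1
  apply hk
  refine dvd_trans ?_ h3
  have := hp.eq_two_or_odd'.resolve_left hp2
  exact this.add_one.two_dvd

end

end GaloisFrobenius

/-! ### Class two is impossible for odd `p` -/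

namespace GaloisFrobenius

open scoped commutatorElement IsMulCommutative

section

variable {L P : Type*} [Group L] [Group P] [MulDistribMulAction L P] [Finite P]
  {p : ℕ} [hp : Fact p.Prime]

theorem IsGaloisTransitive.center_eq_commutator (hGT : IsGaloisTransitive L P)
    (hc : commutator P ≤ Subgroup.center P) (hne : commutator P ≠ ⊥) :
    Subgroup.center P = commutator P :=
  hGT.eq_commutator_of_ne_top _ hc (fun l _ hu => smul_mem_of_characteristic _ l hu)
    fun h => hne ((commutator_eq_bot_iff_center_eq_top P).mpr h)

/-- The `p`-th power homomorphism of a group of class two, `p` odd. -/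
def powHom (hc : commutator P ≤ Subgroup.center P) (hp2 : p ≠ 2)
    (hpow : ∀ x : P, x ^ p ∈ commutator P) : P →* commutator P where
  toFun x := ⟨x ^ p, hpow x⟩
  map_one' := Subtype.ext (one_pow p)
  map_mul' x y := by
    apply Subtype.ext
    change (x * y) ^ p = x ^ p * y ^ p
    have h1 := mul_pow_of_commutatorElement_central x y (fun z =>
      (Subgroup.mem_center_iff.mp (hc (commutatorHom hc y x).2) z).symm) p
    obtain ⟨k, hk⟩ : p ∣ p.choose 2 := hp.out.dvd_choose_self two_ne_zero
      (lt_of_le_of_ne hp.out.two_le (Ne.symm hp2))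
    rw [h1, hk, pow_mul]
    have h2 := pow_eq_one_of_mem_commutator hc hpow (commutatorHom hc y x).2
    rw [coe_commutatorHom] at h2
    rw [h2, one_pow, mul_one]

/-- Otherwise `|P : P'|` is the square of a degree, whereas it is an odd power of `p` by
`odd_of_pow_sub_one_dvd`. -/
theorem IsGaloisTransitive.card_radical_of_odd [Finite L] [Nontrivial P]
    (hc : commutator P ≤ Subgroup.center P) (hne : commutator P ≠ ⊥)
    (hGT : IsGaloisTransitive L P) (hfpf : IsFixedPointFree L P) (hP : IsPGroup p P) (hp2 : p ≠ 2)
    (hpow : ∀ x : P, x ^ p ∈ commutator P) {lam : commutator P →* ℂˣ} (hlam : lam ≠ 1) :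
    Nat.card (radical hc lam) = p * Nat.card (commutator P) := by
  refine (hGT.card_radical hc hfpf hP hpow hlam).resolve_left fun h => ?_
  obtain ⟨n, hn⟩ := (hP.to_quotient (commutator P)).exists_card_eq
  have h1 := hGT.index_sub_one_dvd hP hpow
  rw [Subgroup.index_eq_card, hn] at h1
  obtain ⟨k, rfl⟩ := odd_of_pow_sub_one_dvd hp.out hp2 (hfpf.odd_card hne) h1
  obtain ⟨μ, χ, hμ, hχ⟩ := exists_irrOver_radical hc lam
  obtain ⟨d, -, hd, -⟩ := hχ.exists_degree
  have e := hχ.sq_mul_card_radical hc hμ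
  rw [hd, h] at e
  norm_cast at e
  rw [Subgroup.card_eq_card_quotient_mul_card_subgroup (commutator P), hn] at e
  have e' := Nat.eq_of_mul_eq_mul_right Nat.card_pos e
  refine sq_eq_mul_sq_absurd (a := d) (b := p ^ k) hp.out (pow_ne_zero _ hp.out.ne_zero) ?_
  rw [e']
  ring

/-- The kernel is `L`-invariant and contains `P'`, so it is `P'` or `P`. If all `p`-th powers were
trivial, each radical would reduce to `P'`, contrary to its order. -/
theorem IsGaloisTransitive.ker_powHom [Finite L] [Nontrivial P]
    (hc : commutator P ≤ Subgroup.center P) (hne : commutator P ≠ ⊥)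
    (hGT : IsGaloisTransitive L P) (hfpf : IsFixedPointFree L P) (hP : IsPGroup p P) (hp2 : p ≠ 2)
    (hpow : ∀ x : P, x ^ p ∈ commutator P) : (powHom hc hp2 hpow).ker = commutator P := by
  apply hGT.eq_commutator_of_ne_top
  · exact fun x hx => Subtype.ext (pow_eq_one_of_mem_commutator hc hpow hx)
  · intro l u hu
    apply Subtype.ext
    change (l • u) ^ p = 1
    rw [← smul_pow', show u ^ p = 1 from congrArg Subtype.val hu, smul_one]
  · intro htop
    have : Nontrivial (commutator P) := (Subgroup.nontrivial_iff_ne_bot _).mpr hne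
    obtain ⟨z, hz⟩ := exists_ne (1 : commutator P)
    have hbot := commutator_commutator_eq_bot hc
    obtain ⟨lam, -, hlamz⟩ := exists_apply_ne_one (commutator (commutator P)) le_rfl (x := z)
      (by rw [hbot, Subgroup.mem_bot]; exact hz)
    have hlam : lam ≠ 1 := fun h => hlamz (by rw [h, MonoidHom.one_apply])
    have h1 := hGT.card_radical_of_odd hc hne hfpf hP hp2 hpow hlam
    have h2 : radical hc lam ≤ commutator P := fun x hx =>
      hGT.mem_commutator_of_mem_radical hc hfpf hP hpow hlam hx (by
        have : powHom hc hp2 hpow x = 1 := by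
          rw [← MonoidHom.mem_ker, htop]
          trivial
        change lam (powHom hc hp2 hpow x) = 1
        rw [this, map_one])
    rw [le_antisymm h2 (commutator_le_radical hc lam)] at h1
    have h3 : 0 < Nat.card (commutator P) := Nat.card_pos
    have := hp.out.one_lt
    nlinarith

/-- The range is `L`-invariant and nontrivial. A nontrivial character of `P'` killing it could not
be conjugate to one that is nontrivial on some `x ^ p`. -/
theorem IsGaloisTransitive.powHom_surjective [Finite L] [Nontrivial P]
    (hc : commutator P ≤ Subgroup.center P) (hne : commutator P ≠ ⊥)
    (hGT : IsGaloisTransitive L P) (hfpf : IsFixedPointFree L P) (hP : IsPGroup p P) (hp2 : p ≠ 2)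
    (hpow : ∀ x : P, x ^ p ∈ commutator P) : Function.Surjective (powHom hc hp2 hpow) := by
  have hker := hGT.ker_powHom hc hne hfpf hP hp2 hpow
  set s := powHom hc hp2 hpow with hs
  have hbot := commutator_commutator_eq_bot hc
  rw [← MonoidHom.range_eq_top]
  by_contra hR
  obtain ⟨z, hz⟩ : ∃ z, z ∉ s.range := by
    by_contra! hcon
    exact hR (eq_top_iff.mpr fun x _ => hcon x)
  have hn : s.range.Normal := Subgroup.Normal.of_commutator_le _ (by rw [hbot]; exact bot_le)
  obtain ⟨lam₁, hlam₁, h1⟩ := exists_apply_ne_one s.range (by rw [hbot]; exact bot_le) hz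
  have := hP.isNilpotent
  obtain ⟨x, hx⟩ : ∃ x, x ∉ commutator P := by
    by_contra! hcon
    exact (Group.IsSolvable.commutator_lt_top_of_nontrivial P).ne (eq_top_iff.mpr fun x _ => hcon x)
  obtain ⟨lam₂, -, h2⟩ := exists_apply_ne_one (commutator (commutator P)) le_rfl (x := s x)
    (by rw [hbot, Subgroup.mem_bot, ← MonoidHom.mem_ker, hker]; exact hx)
  obtain ⟨l, t, -, hlt⟩ := hGT.exists_of_commutator_le_center hc hfpf hP hpow
    (lam₁ := lam₁) (lam₂ := lam₂) (fun h => h1 (by rw [h, MonoidHom.one_apply]))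
    (fun h => h2 (by rw [h, MonoidHom.one_apply]))
  apply h2
  rw [hlt]
  apply hlam₁
  refine ⟨l • x ^ t, Subtype.ext ?_⟩
  change (l • x ^ t) ^ p = l • (x ^ p) ^ t
  rw [← smul_pow', ← pow_mul, ← pow_mul, mul_comm]

/-- A nontrivial `lam` killing both subgroups would have `x` in its radical and `lam (x ^ p) = 1`,
forcing `x ∈ P'`. -/
theorem IsGaloisTransitive.index_range_commutatorHom [Finite L] [Nontrivial P]
    (hc : commutator P ≤ Subgroup.center P)
    (hGT : IsGaloisTransitive L P) (hfpf : IsFixedPointFree L P) (hP : IsPGroup p P)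
    (hpow : ∀ x : P, x ^ p ∈ commutator P) {x : P} (hx : x ∉ commutator P) :
    (commutatorHom hc x).range ⊔ Subgroup.zpowers ⟨x ^ p, hpow x⟩ = ⊤ := by
  have hbot := commutator_commutator_eq_bot hc
  by_contra hR
  set R := (commutatorHom hc x).range ⊔ Subgroup.zpowers (⟨x ^ p, hpow x⟩ : commutator P) with hRdef
  obtain ⟨z, hz⟩ : ∃ z, z ∉ R := by
    by_contra! hcon
    exact hR (eq_top_iff.mpr fun x _ => hcon x)
  have hn : R.Normal := Subgroup.Normal.of_commutator_le _ (by rw [hbot]; exact bot_le)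
  obtain ⟨lam, hlam, h1⟩ := exists_apply_ne_one R (by rw [hbot]; exact bot_le) hz
  apply hx
  refine hGT.mem_commutator_of_mem_radical hc hfpf hP hpow (lam := lam)
    (fun h => h1 (by rw [h, MonoidHom.one_apply])) (fun y => ?_) ?_
  · exact hlam _ (Subgroup.mem_sup_left ⟨y, rfl⟩)
  · exact hlam _ (Subgroup.mem_sup_right (Subgroup.mem_zpowers _))

theorem index_dvd_of_sup_zpowers_eq_top {M : Type*} [Group M] (R : Subgroup M) [R.Normal] (m : M)
    (h : R ⊔ Subgroup.zpowers m = ⊤) {p : ℕ} (hm : m ^ p = 1) : R.index ∣ p := by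
  have h1 : Subgroup.zpowers (QuotientGroup.mk' R m) = ⊤ := by
    rw [← Subgroup.map_top_of_surjective _ (QuotientGroup.mk'_surjective R), ← h, Subgroup.map_sup,
      QuotientGroup.map_mk'_self, bot_sup_eq, MonoidHom.map_zpowers]
  rw [Subgroup.index_eq_card, ← Subgroup.card_top, ← h1, Nat.card_zpowers]
  apply orderOf_dvd_of_pow_eq_one
  rw [← map_pow, hm, map_one]

/-- `exists_pairing_eq` yields `x ∉ P'` with `x ^ p` in the range of `⁅x, ·⁆`. Since that range and
`x ^ p` generate `P'`, the range is all of `P'`, which `hne1` excludes. -/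
theorem IsGaloisTransitive.commutator_eq_bot_of_odd [Finite L] [Nontrivial P]
    (hc : commutator P ≤ Subgroup.center P)
    (hGT : IsGaloisTransitive L P) (hfpf : IsFixedPointFree L P) (hP : IsPGroup p P) (hp2 : p ≠ 2)
    (hpow : ∀ x : P, x ^ p ∈ commutator P) : commutator P = ⊥ := by
  by_contra hne
  have hker := hGT.ker_powHom hc hne hfpf hP hp2 hpow
  have hsurj := hGT.powHom_surjective hc hne hfpf hP hp2 hpow
  have : Nontrivial (commutator P) := (Subgroup.nontrivial_iff_ne_bot _).mpr hne
  have : IsMulCommutative (commutator P) := by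
    rw [← commutator_eq_bot_iff]
    exact commutator_commutator_eq_bot hc
  let b : P →* (P →* commutator P) :=
    { toFun := commutatorHom hc
      map_one' := MonoidHom.ext (commutatorHom_one hc)
      map_mul' := fun x y => MonoidHom.ext (commutatorHom_mul hc x y) }
  have hb : ∀ x, (powHom hc hp2 hpow).ker ≤ (b x).ker := by
    intro x y hy
    rw [hker] at hy
    exact Subtype.ext (commutatorElement_eq_one_iff_mul_comm.mpr
      (Subgroup.mem_center_iff.mp (hc hy) x))
  have hself : ∀ x, x ∉ commutator P → b x x = 1 ∧ powHom hc hp2 hpow x ≠ 1 := fun x hx =>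
    ⟨Subtype.ext (commutatorElement_self x), by rwa [Ne, ← MonoidHom.mem_ker, hker]⟩
  have hcard : Nat.card (commutator P) = (commutator P).index := by
    rw [← hker, Subgroup.index_ker, MonoidHom.range_eq_top.mpr hsurj, Subgroup.card_top, hker]
  have hdvd : ∀ x, x ∉ commutator P → (b x).range.index ∣ p := fun x hx =>
    index_dvd_of_sup_zpowers_eq_top _ _
      (hGT.index_range_commutatorHom hc hfpf hP hpow hx)
      (Subtype.ext (pow_eq_one_of_mem_commutator hc hpow (hpow x)))
  -- If `⁅x, ·⁆` were onto, its kernel would have index `|P'| = |P : P'|` and so be `P'`; but it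
  -- contains `x`.
  have hne1 : ∀ x, x ∉ commutator P → (b x).range.index ≠ 1 := by
    intro x hx h1
    have hle : commutator P ≤ (b x).ker := hker.symm.le.trans (hb x)
    have h2 : (b x).ker.index = (commutator P).index := by
      rw [Subgroup.index_ker, Subgroup.index_eq_one.mp h1, Subgroup.card_top, hcard]
    have h3 := Subgroup.relIndex_mul_index hle
    rw [h2] at h3
    have h4 := Nat.eq_of_mul_eq_mul_right
      (Nat.pos_of_ne_zero Subgroup.index_ne_zero_of_finite) (h3.trans (one_mul _).symm)
    exact hx (Subgroup.relIndex_eq_one.mp h4 (hself x hx).1)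
  have hidx := fun x hx => ((Nat.dvd_prime hp.out).mp (hdvd x hx)).resolve_left (hne1 x hx)
  obtain ⟨x, hx, y, hy⟩ := exists_pairing_eq (p := p) (G := P) (S := P) (M := commutator P)
    (fun m => Subtype.ext (pow_eq_one_of_mem_commutator hc hpow m.2)) hpow
    (powHom hc hp2 hpow) hsurj b hb hcard.le
    (fun x hx => ⟨fun h => hx (by
      rw [← hGT.center_eq_commutator hc hne, Subgroup.mem_center_iff]
      intro y
      have h1 := congrArg Subtype.val (DFunLike.congr_fun h y)
      exact (commutatorElement_eq_one_iff_mul_comm.mp h1).symm), hidx x hx⟩) id hself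
  apply hne1 x hx
  rw [Subgroup.index_eq_one, eq_top_iff, ← hGT.index_range_commutatorHom hc hfpf hP hpow hx,
    sup_le_iff, Subgroup.zpowers_le]
  exact ⟨le_rfl, y, hy⟩

end

end GaloisFrobenius

/-! ### Two-groups: class two, and the set-up for class three -/

namespace GaloisFrobenius

open scoped commutatorElement

theorem three_mul_sum_four_pow_le {ι : Type*} (S : Finset ι) (a : ι → ℕ) (c m : ℕ)
    (hfib : ∀ j, (S.filter fun i => a i = j).card ≤ c) (hlt : ∀ i ∈ S, a i < m) :
    3 * ∑ i ∈ S, 4 ^ a i + c ≤ c * 4 ^ m := by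
  have h1 : ∑ i ∈ S, 4 ^ a i = ∑ j ∈ Finset.range m, (S.filter fun i => a i = j).card * 4 ^ j := by
    rw [← Finset.sum_fiberwise_of_maps_to (fun i hi => Finset.mem_range.mpr (hlt i hi))]
    refine Finset.sum_congr rfl fun j _ => ?_
    rw [Finset.sum_congr rfl fun i hi => by rw [(Finset.mem_filter.mp hi).2], Finset.sum_const,
      smul_eq_mul]
  have h2 : ∑ i ∈ S, 4 ^ a i ≤ c * ∑ j ∈ Finset.range m, 4 ^ j := by
    rw [h1, Finset.mul_sum]
    exact Finset.sum_le_sum fun j _ => Nat.mul_le_mul_right _ (hfib j)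
  have h3 : ∀ m : ℕ, 3 * ∑ j ∈ Finset.range m, 4 ^ j + 1 = 4 ^ m := by
    intro m
    induction m with
    | zero => simp
    | succ m ih => rw [Finset.sum_range_succ, pow_succ, ← ih]; omega
  rw [← h3 m]
  nlinarith

theorem commutator_eq_bot_of_sq_eq_one {P : Type*} [Group P] (h : ∀ x : P, x ^ 2 = 1) :
    commutator P = ⊥ := by
  rw [commutator_eq_bot_iff_center_eq_top, eq_top_iff]
  intro x _
  rw [Subgroup.mem_center_iff]
  intro y
  have hinv : ∀ z : P, z⁻¹ = z := fun z => inv_eq_of_mul_eq_one_left (by rw [← sq, h])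
  rw [← hinv (y * x), mul_inv_rev, hinv, hinv]

section

variable {L P : Type*} [Group L] [Group P] [MulDistribMulAction L P] [Finite P] [Finite L]
  [Nontrivial P]

theorem IsGaloisTransitive.exists_smul_mul_eq (hGT : IsGaloisTransitive L P)
    (hfpf : IsFixedPointFree L P) (hP : IsPGroup 2 P) (hpow : ∀ x : P, x ^ 2 ∈ commutator P)
    {x y : P} (hx : x ∉ commutator P) (hy : y ∉ commutator P) :
    ∃ l : L, ∃ d ∈ commutator P, l • x * d = y := by
  let _ := quotientAction (L := L) (commutator P) fun l n hn => smul_mem_of_characteristic _ l hn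
  have hfpf' : IsFixedPointFree L (P ⧸ commutator P) :=
    hfpf.of_surjective (QuotientGroup.mk' (commutator P)) (QuotientGroup.mk'_surjective _)
      fun l k => rfl
  obtain ⟨l, hl⟩ := hfpf'.exists_smul_eq (hGT.index_eq hfpf hP hpow) (x := (x : P ⧸ commutator P))
    (y := y) (by rwa [Ne, QuotientGroup.eq_one_iff]) (by rwa [Ne, QuotientGroup.eq_one_iff])
  refine ⟨l, (l • x)⁻¹ * y, QuotientGroup.eq.mp hl, mul_inv_cancel_left _ _⟩

theorem IsGaloisTransitive.exists_smul_eq_of_mem_commutator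
    (hc : commutator P ≤ Subgroup.center P) (hne : commutator P ≠ ⊥)
    (hGT : IsGaloisTransitive L P) (hfpf : IsFixedPointFree L P) (hP : IsPGroup 2 P)
    (hpow : ∀ x : P, x ^ 2 ∈ commutator P) {x y : P} (hx : x ∈ commutator P) (hy : y ∈ commutator P)
    (hx1 : x ≠ 1) (hy1 : y ≠ 1) : ∃ l : L, l • x = y := by
  let _ := restrictAction (L := L) (commutator P) fun l n hn => smul_mem_of_characteristic _ l hn
  have hfpf' : IsFixedPointFree L (commutator P) := fun l hl k hk =>
    Subtype.ext (hfpf l hl k (congrArg Subtype.val hk))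
  obtain ⟨l, hl⟩ := hfpf'.exists_smul_eq (hGT.card_commutator_eq hc hne hfpf hP hpow)
    (x := ⟨x, hx⟩) (y := ⟨y, hy⟩) (fun h => hx1 (congrArg Subtype.val h))
    (fun h => hy1 (congrArg Subtype.val h))
  exact ⟨l, congrArg Subtype.val hl⟩

/-- Squares depend only on the coset modulo `P'`, and `L` is transitive on the nontrivial cosets. So
one trivial square would make all squares trivial and `P` abelian. -/
theorem IsGaloisTransitive.sq_ne_one (hc : commutator P ≤ Subgroup.center P)
    (hne : commutator P ≠ ⊥) (hGT : IsGaloisTransitive L P) (hfpf : IsFixedPointFree L P)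
    (hP : IsPGroup 2 P) (hpow : ∀ x : P, x ^ 2 ∈ commutator P) {x : P} (hx : x ∉ commutator P) :
    x ^ 2 ≠ 1 := by
  obtain ⟨a, ha⟩ : ∃ a : P, a ^ 2 ≠ 1 := by
    by_contra! h
    exact hne (commutator_eq_bot_of_sq_eq_one h)
  obtain ⟨l, d, hd, rfl⟩ := hGT.exists_smul_mul_eq hfpf hP hpow
    (fun h => ha (pow_eq_one_of_mem_commutator hc hpow h)) hx
  have hcomm : Commute (l • a) d := Subgroup.mem_center_iff.mp (hc hd) _
  rw [hcomm.mul_pow, pow_eq_one_of_mem_commutator hc hpow hd, mul_one, ← smul_pow']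
  exact fun h => ha (smul_left_cancel l (h.trans (smul_one l).symm))

theorem IsGaloisTransitive.exists_sq_eq (hc : commutator P ≤ Subgroup.center P)
    (hne : commutator P ≠ ⊥) (hGT : IsGaloisTransitive L P) (hfpf : IsFixedPointFree L P)
    (hP : IsPGroup 2 P) (hpow : ∀ x : P, x ^ 2 ∈ commutator P) {y : P} (hy : y ∈ commutator P)
    (hy1 : y ≠ 1) : ∃ x, x ∉ commutator P ∧ x ^ 2 = y := by
  obtain ⟨a, ha⟩ : ∃ a : P, a ^ 2 ≠ 1 := by
    by_contra! h
    exact hne (commutator_eq_bot_of_sq_eq_one h)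
  obtain ⟨l, hl⟩ := hGT.exists_smul_eq_of_mem_commutator hc hne hfpf hP hpow (hpow a) hy ha hy1
  rw [smul_pow'] at hl
  exact ⟨l • a, fun h => hy1 (by rw [← hl]; exact pow_eq_one_of_mem_commutator hc hpow h), hl⟩

end

/-- A fixed-point-free group `L` acting on a `2`-group `Q`, transitively on characters, together
with a central subgroup `M` such that `Q ⧸ M` has class two and its commutator subgroup consists of
squares. -/
structure IsCentralExtensionOfClassTwo (L Q : Type*) [Group L] [Group Q] [MulDistribMulAction L Q]
    (M : Subgroup Q) : Prop where
  gt : IsGaloisTransitive L Q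
  fpf : IsFixedPointFree L Q
  isPGroup : IsPGroup 2 Q
  sq_mem : ∀ x : Q, x ^ 2 ∈ commutator Q
  le_center : M ≤ Subgroup.center Q
  le_commutator : M ≤ commutator Q
  comm_mem : ∀ w ∈ commutator Q, ∀ g : Q, ⁅g, w⁆ ∈ M
  smul_mem : ∀ l : L, ∀ m ∈ M, l • m ∈ M
  ne_bot : M ≠ ⊥
  sq_eq_one : ∀ m ∈ M, m ^ 2 = 1
  sq_mem_of_mem : ∀ w ∈ commutator Q, w ^ 2 ∈ M
  sq_notMem : ∀ x, x ∉ commutator Q → x ^ 2 ∉ M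
  exists_sq : ∀ y ∈ commutator Q, y ∉ M → ∃ x, x ∉ commutator Q ∧ ∃ m ∈ M, x ^ 2 * m = y
  index_commutator : (commutator Q).index = Nat.card L + 1
  relIndex : M.relIndex (commutator Q) = Nat.card L + 1

/-- The statements modulo `M` are the class-two results for `Q / M`. That `M` has exponent two
follows from `⁅w, g⁆ ^ 2 = ⁅w ^ 2, g⁆`, as `w ^ 2` lies in the central subgroup `M`. -/
theorem IsGaloisTransitive.isCentralExtensionOfClassTwo {L Q : Type*} [Group L] [Group Q]
    [MulDistribMulAction L Q] [Finite Q] [Finite L] [Nontrivial Q] (hGT : IsGaloisTransitive L Q)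
    (hfpf : IsFixedPointFree L Q) (hP : IsPGroup 2 Q) (hsq : ∀ x : Q, x ^ 2 ∈ commutator Q)
    (hM : ⁅commutator Q, (⊤ : Subgroup Q)⁆ ≠ ⊥)
    (hcen : ⁅commutator Q, (⊤ : Subgroup Q)⁆ ≤ Subgroup.center Q) :
    IsCentralExtensionOfClassTwo L Q ⁅commutator Q, (⊤ : Subgroup Q)⁆ := by
  set M := ⁅commutator Q, (⊤ : Subgroup Q)⁆ with hMdef
  have hMc : M.Characteristic := inferInstance
  have hML : ∀ l : L, ∀ m ∈ M, l • m ∈ M := fun l m hm => smul_mem_of_characteristic M l hm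
  have hle : M ≤ commutator Q := Subgroup.commutator_le_left _ _
  have hcm : ∀ w ∈ commutator Q, ∀ g : Q, ⁅g, w⁆ ∈ M := fun w hw g => by
    rw [hMdef, Subgroup.commutator_comm]
    exact Subgroup.commutator_mem_commutator (Subgroup.mem_top g) hw
  let _ := quotientAction M hML
  have hmk := QuotientGroup.mk'_surjective M
  have hGT' : IsGaloisTransitive L (Q ⧸ M) := hGT.of_surjective (QuotientGroup.mk' M) hmk
    fun l k => rfl
  have hfpf' : IsFixedPointFree L (Q ⧸ M) := hfpf.of_surjective (QuotientGroup.mk' M) hmk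
    fun l k => rfl
  have hP' := hP.to_quotient M
  have hmap : (commutator Q).map (QuotientGroup.mk' M) = commutator (Q ⧸ M) :=
    map_commutator_of_surjective _ hmk
  have hmem : ∀ x : Q, (x : Q ⧸ M) ∈ commutator (Q ⧸ M) ↔ x ∈ commutator Q := by
    intro x
    rw [← hmap]
    constructor
    · rintro ⟨w, hw, hwx⟩
      have : w⁻¹ * x ∈ M := QuotientGroup.eq.mp hwx
      have := mul_mem hw (hle this)
      rwa [mul_inv_cancel_left] at this
    · exact fun hx => ⟨x, hx, rfl⟩
  have hsq' : ∀ x : Q ⧸ M, x ^ 2 ∈ commutator (Q ⧸ M) := by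
    intro x
    obtain ⟨x, rfl⟩ := QuotientGroup.mk_surjective x
    rw [← QuotientGroup.mk_pow, hmem]
    exact hsq x
  have hc' : commutator (Q ⧸ M) ≤ Subgroup.center (Q ⧸ M) := by
    intro x hx
    obtain ⟨x, rfl⟩ := QuotientGroup.mk_surjective x
    rw [hmem] at hx
    rw [Subgroup.mem_center_iff]
    intro g
    obtain ⟨g, rfl⟩ := QuotientGroup.mk_surjective g
    rw [← commutatorElement_eq_one_iff_mul_comm]
    exact (QuotientGroup.eq_one_iff _).mpr (hcm x hx g)
  have hlt : ¬ commutator Q ≤ M := by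
    intro h
    apply hM
    rw [hMdef, Subgroup.commutator_eq_bot_iff_le_centralizer, Subgroup.coe_top,
      Subgroup.centralizer_univ]
    exact h.trans hcen
  have hne' : commutator (Q ⧸ M) ≠ ⊥ := by
    intro h
    apply hlt
    intro x hx
    rw [← hmem, h, Subgroup.mem_bot, QuotientGroup.eq_one_iff] at hx
    exact hx
  have : Nontrivial (Q ⧸ M) := by
    by_contra hcon
    rw [not_nontrivial_iff_subsingleton] at hcon
    exact hne' (Subsingleton.elim _ _)
  have hsqM : ∀ w ∈ commutator Q, w ^ 2 ∈ M := fun w hw => by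
    rw [← QuotientGroup.eq_one_iff, QuotientGroup.mk_pow]
    exact pow_eq_one_of_mem_commutator hc' hsq' ((hmem w).mpr hw)
  refine ⟨hGT, hfpf, hP, hsq, hcen, hle, hcm, hML, hM, ?_, hsqM, ?_, ?_,
    hGT.index_eq hfpf hP hsq, ?_⟩
  · let U : Subgroup Q :=
      { carrier := {z | z ∈ Subgroup.center Q ∧ z ^ 2 = 1}
        one_mem' := ⟨one_mem _, one_pow 2⟩
        mul_mem' := fun {a b} ha hb => ⟨mul_mem ha.1 hb.1, by
          have h : Commute a b := (Subgroup.mem_center_iff.mp hb.1 a)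
          rw [h.mul_pow, ha.2, hb.2, one_mul]⟩
        inv_mem' := fun {a} ha => ⟨inv_mem ha.1, by rw [inv_pow, ha.2, inv_one]⟩ }
    have key : M ≤ U := by
      rw [hMdef, Subgroup.commutator_le]
      intro w hw g _
      have hwg : ⁅w, g⁆ ∈ M := Subgroup.commutator_mem_commutator hw (Subgroup.mem_top g)
      refine ⟨hcen hwg, ?_⟩
      have h1 : w * ⁅w, g⁆ = ⁅w, g⁆ * w := Subgroup.mem_center_iff.mp (hcen hwg) w
      have h2 : ⁅w ^ 2, g⁆ = w * ⁅w, g⁆ * w⁻¹ * ⁅w, g⁆ := by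
        simp only [commutatorElement_def, sq]; group
      rw [h1, mul_inv_cancel_right, ← sq] at h2
      rw [← h2, commutatorElement_eq_one_iff_mul_comm]
      exact (Subgroup.mem_center_iff.mp (hcen (hsqM w hw)) g).symm
    exact fun m hm => (key hm).2
  · intro x hx h
    refine hGT'.sq_ne_one hc' hne' hfpf' hP' hsq' (x := x) (by rwa [hmem]) ?_
    rw [← QuotientGroup.mk_pow, QuotientGroup.eq_one_iff]
    exact h
  · intro y hy hyM
    obtain ⟨x, hx, hxy⟩ := hGT'.exists_sq_eq hc' hne' hfpf' hP' hsq' ((hmem y).mpr hy)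
      (by rwa [Ne, QuotientGroup.eq_one_iff])
    obtain ⟨x, rfl⟩ := QuotientGroup.mk_surjective x
    rw [hmem] at hx
    refine ⟨x, hx, (x ^ 2)⁻¹ * y, QuotientGroup.eq.mp hxy, mul_inv_cancel_left _ _⟩
  · rw [← hGT'.card_commutator_eq hc' hne' hfpf' hP' hsq', ← hmap]
    have h := Subgroup.relIndex_ker (commutator Q) (QuotientGroup.mk' M)
    rwa [QuotientGroup.ker_mk'] at h

end GaloisFrobenius

/-! ### Class three: the bracket of `Q` with `Q'`, and counting characters by degree -/

namespace GaloisFrobenius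

open scoped commutatorElement IsMulCommutative

namespace IsCentralExtensionOfClassTwo

variable {L Q : Type*} [Group L] [Group Q] [MulDistribMulAction L Q] {M : Subgroup Q}

/-- The homomorphism `w ↦ ⁅g, w⁆`. -/
def bracket (h : IsCentralExtensionOfClassTwo L Q M) (g : Q) : commutator Q →* M where
  toFun w := ⟨⁅g, (w : Q)⁆, h.comm_mem w w.2 g⟩
  map_one' := Subtype.ext (commutatorElement_one_right g)
  map_mul' w w' := by
    apply Subtype.ext
    change ⁅g, (w : Q) * w'⁆ = ⁅g, (w : Q)⁆ * ⁅g, (w' : Q)⁆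
    have h1 := Subgroup.mem_center_iff.mp (h.le_center (h.comm_mem w' w'.2 g)) w
    have h2 : ⁅g, (w : Q) * w'⁆ = ⁅g, (w : Q)⁆ * (w * ⁅g, (w' : Q)⁆ * (w : Q)⁻¹) := by
      simp only [commutatorElement_def]; group
    rw [h2, h1, mul_inv_cancel_right]

variable (h : IsCentralExtensionOfClassTwo L Q M)

theorem bracket_mul (g g' : Q) (w : commutator Q) :
    h.bracket (g * g') w = h.bracket g w * h.bracket g' w := by
  apply Subtype.ext
  change ⁅g * g', (w : Q)⁆ = ⁅g, (w : Q)⁆ * ⁅g', (w : Q)⁆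
  have h1 := Subgroup.mem_center_iff.mp (h.le_center (h.comm_mem w w.2 g'))
  have h2 : ⁅g * g', (w : Q)⁆ = g * ⁅g', (w : Q)⁆ * g⁻¹ * ⁅g, (w : Q)⁆ := by
    simp only [commutatorElement_def]; group
  rw [h2, h1, mul_inv_cancel_right, h1]

theorem bracket_one (w : commutator Q) : h.bracket 1 w = 1 :=
  Subtype.ext (commutatorElement_one_left (w : Q))

theorem bracket_eq_one_of_mem (g : Q) {w : commutator Q} (hw : (w : Q) ∈ M) : h.bracket g w = 1 :=
  Subtype.ext (commutatorElement_eq_one_iff_mul_comm.mpr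
    (Subgroup.mem_center_iff.mp (h.le_center hw) g))

theorem isMulCommutative (h : IsCentralExtensionOfClassTwo L Q M) : IsMulCommutative M :=
  ⟨⟨fun a b => Subtype.ext (Subgroup.mem_center_iff.mp (h.le_center b.2) a)⟩⟩

/-- The homomorphism `g ↦ ⁅g, w⁆`. -/
def bracketLeft (w : commutator Q) : Q →* M where
  toFun g := h.bracket g w
  map_one' := h.bracket_one w
  map_mul' g g' := h.bracket_mul g g' w

/-- For fixed `w` the bracket is a homomorphism into an abelian group. In consequence `Q'` is
abelian. -/
theorem bracket_of_mem_commutator {g : Q} (hg : g ∈ commutator Q) (w : commutator Q) :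
    h.bracket g w = 1 := by
  have := h.isMulCommutative
  exact MonoidHom.mem_ker.mp (Abelianization.commutator_subset_ker (h.bracketLeft w) hg)

theorem commute_of_mem (h : IsCentralExtensionOfClassTwo L Q M) {g w : Q} (hg : g ∈ commutator Q)
    (hw : w ∈ commutator Q) : Commute g w :=
  commutatorElement_eq_one_iff_mul_comm.mp
    (congrArg Subtype.val (h.bracket_of_mem_commutator hg ⟨w, hw⟩))

theorem exists_sq_mul_eq (h : IsCentralExtensionOfClassTwo L Q M) (g : Q) {d : Q}
    (hd : d ∈ commutator Q) : ∃ m ∈ M, (g * d) ^ 2 = g ^ 2 * m := by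
  refine ⟨⁅g⁻¹, d⁆ * d ^ 2, mul_mem (h.comm_mem d hd _) (h.sq_mem_of_mem d hd), ?_⟩
  simp only [commutatorElement_def, sq]
  group

theorem pow_four_mul_eq (h : IsCentralExtensionOfClassTwo L Q M) (g : Q) {d : Q}
    (hd : d ∈ commutator Q) : (g * d) ^ 4 = g ^ 4 := by
  obtain ⟨m, hm, hgd⟩ := h.exists_sq_mul_eq g hd
  have hc : Commute (g ^ 2) m := Subgroup.mem_center_iff.mp (h.le_center hm) _
  rw [show 4 = 2 * 2 from rfl, pow_mul, hgd, hc.mul_pow, h.sq_eq_one m hm, mul_one, ← pow_mul]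

theorem pow_four_mem (h : IsCentralExtensionOfClassTwo L Q M) (g : Q) : g ^ 4 ∈ M := by
  rw [show 4 = 2 * 2 from rfl, pow_mul]
  exact h.sq_mem_of_mem _ (h.sq_mem g)

theorem pow_eight (h : IsCentralExtensionOfClassTwo L Q M) (g : Q) : g ^ 8 = 1 := by
  rw [show 8 = 4 * 2 from rfl, pow_mul]
  exact h.sq_eq_one _ (h.pow_four_mem g)

theorem normal_of_le (h : IsCentralExtensionOfClassTwo L Q M) {N : Subgroup Q} (hMN : M ≤ N)
    (hN : N ≤ commutator Q) : N.Normal := ⟨fun n hn g => by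
  have : g * n * g⁻¹ = ⁅g, n⁆ * n := by rw [commutatorElement_def]; group
  rw [this]
  exact mul_mem (hMN (h.comm_mem n (hN hn) g)) hn⟩

theorem exists_ext [Finite Q] (h : IsCentralExtensionOfClassTwo L Q M) {N : Subgroup Q} (hMN : M ≤ N) (hN : N ≤ commutator Q)
    (lam : M →* ℂˣ) : ∃ ν : N →* ℂˣ, ∀ m, ν (Subgroup.inclusion hMN m) = lam m := by
  obtain ⟨ν, hν⟩ := exists_extension (M.subgroupOf N)
    (lam.comp (Subgroup.subgroupOfEquivOfLe hMN).toMonoidHom) (by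
      intro d hd
      have hbot : commutator N = ⊥ := by
        rw [commutator_eq_bot_iff]
        exact ⟨⟨fun a b => Subtype.ext (h.commute_of_mem (hN a.2) (hN b.2))⟩⟩
      rw [hbot, Subgroup.mem_bot] at hd
      rw [show d = 1 from Subtype.ext hd, map_one])
  exact ⟨ν, fun m => hν ⟨Subgroup.inclusion hMN m, m.2⟩⟩

theorem exists_finset [Finite Q] {N : Subgroup Q} (hMN : M ≤ N) (hN : N ≤ commutator Q)
    {lam : M →* ℂˣ} (hlam : ∀ g, ∀ n : N, lam (h.bracket g (Subgroup.inclusion hN n)) = 1)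
    {ν : N →* ℂˣ} (hν : ∀ m, ν (Subgroup.inclusion hMN m) = lam m) :
    ∃ S : Finset (Q → ℂ), (∀ χ ∈ S, IrrOver N ν χ) ∧ ∑ χ ∈ S, χ 1 ^ 2 = (N.index : ℂ) := by
  have := h.normal_of_le hMN hN
  refine IrrOver.exists_finset_sum_sq N ν fun g n => ?_
  have : MulAut.conjNormal g n =
      Subgroup.inclusion hMN (h.bracket g (Subgroup.inclusion hN n)) * n := by
    apply Subtype.ext
    change g * n * g⁻¹ = ⁅g, (n : Q)⁆ * n
    rw [commutatorElement_def]
    group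
  rw [this, map_mul, hν, hlam, one_mul]

/-- Transitivity over `M` supplies `l` and `t`. As `t` is odd, the power map is trivial on `M`, so
`l` fixes `lam`, and freeness leaves only `l = 1`. -/
theorem exists_pow_eq [Finite Q] {N : Subgroup Q} (h : IsCentralExtensionOfClassTwo L Q M)
    (hMN : M ≤ N) {lam : M →* ℂˣ} (hlam : lam ≠ 1)
    {ν ν' : N →* ℂˣ} (hν : ∀ m, ν (Subgroup.inclusion hMN m) = lam m)
    (hν' : ∀ m, ν' (Subgroup.inclusion hMN m) = lam m) {χ χ' : Q → ℂ} (hχ : IrrOver N ν χ)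
    (hχ' : IrrOver N ν' χ') (hdeg : χ 1 = χ' 1) :
    ∃ t : ℕ, Odd t ∧ (∀ g, χ' g = χ (g ^ t)) ∧ ∀ n, ν' n = ν n ^ t := by
  have hM : M.Normal := h.normal_of_le le_rfl h.le_commutator
  have hirr : ∀ {ν : N →* ℂˣ} {χ : Q → ℂ}, (∀ m, ν (Subgroup.inclusion hMN m) = lam m) →
      IrrOver N ν χ → IrrOver M lam χ := by
    intro ν χ hν hχ
    have := hχ.mono hMN
    rwa [show ν.comp (Subgroup.inclusion hMN) = lam from MonoidHom.ext hν] at this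
  obtain ⟨l, t, ht, hg⟩ := h.gt M hM h.smul_mem lam lam hlam hlam χ χ' (hirr hν hχ) (hirr hν' hχ')
    hdeg
  have h2 : 2 ∣ Nat.card Q := by
    have : Nontrivial Q := by
      by_contra hcon
      rw [not_nontrivial_iff_subsingleton] at hcon
      exact h.ne_bot (Subsingleton.elim _ _)
    obtain ⟨n, hn0, hn⟩ := h.isPGroup.nontrivial_iff_card.mp this
    rw [hn]
    exact dvd_pow_self 2 hn0.ne'
  have hodd : Odd t := Nat.coprime_two_right.mp (ht.coprime_dvd_right h2)
  have hmt : ∀ m ∈ M, m ^ t = m := by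
    intro m hm
    obtain ⟨k, rfl⟩ := hodd
    rw [pow_succ, pow_mul, h.sq_eq_one m hm, one_pow, one_mul]
  have hl : l = 1 := by
    apply h.fpf.twist_injective h.smul_mem hlam
    ext1 m
    have h3 := hg m
    rw [hmt m m.2, (hirr hν' hχ').apply_coe, ← hdeg] at h3
    have h4 := (hirr hν hχ).apply_coe ⟨l • (m : Q), h.smul_mem l m m.2⟩
    rw [h4] at h3
    rw [twist_apply, twist_apply]
    simp only [one_smul]
    exact Units.ext (mul_right_cancel₀ hχ.apply_one_ne_zero h3).symm
  subst hl
  have hχt : ∀ g, χ' g = χ (g ^ t) := fun g => by rw [hg, one_smul]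
  refine ⟨t, hodd, hχt, fun n => ?_⟩
  have h3 := hχt n
  rw [hχ'.apply_coe, ← Subgroup.coe_pow, hχ.apply_coe, map_pow, ← hdeg] at h3
  exact Units.ext (mul_right_cancel₀ hχ.apply_one_ne_zero h3)

theorem exists_degree_eq_two_pow [Finite Q] (h : IsCentralExtensionOfClassTwo L Q M)
    {N : Subgroup Q} {ν : N →* ℂˣ} {χ : Q → ℂ}
    (hχ : IrrOver N ν χ) : ∃ a : ℕ, χ 1 = 2 ^ a := by
  obtain ⟨n, hn⟩ := h.isPGroup.exists_card_eq
  obtain ⟨d, -, hd, hdvd⟩ := hχ.exists_degree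
  rw [hn, Nat.dvd_prime_pow Nat.prime_two] at hdvd
  obtain ⟨a, -, rfl⟩ := hdvd
  exact ⟨a, by rw [hd]; push_cast; rfl⟩

end IsCentralExtensionOfClassTwo

end GaloisFrobenius

namespace GaloisFrobenius

open scoped commutatorElement IsMulCommutative

namespace IsCentralExtensionOfClassTwo

variable {L Q : Type*} [Group L] [Group Q] [MulDistribMulAction L Q] {M : Subgroup Q}

theorem exists_index_eq [Finite Q] [Finite L] (h : IsCentralExtensionOfClassTwo L Q M) :
    ∃ k : ℕ, Nat.card L + 1 = 2 ^ (k + 1) := by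
  obtain ⟨n, hn⟩ := (h.isPGroup.to_quotient (commutator Q)).exists_card_eq
  rw [← Subgroup.index_eq_card, h.index_commutator] at hn
  rcases n with _ | k
  · have : 0 < Nat.card L := Nat.card_pos
    rw [pow_zero] at hn
    omega
  · exact ⟨k, hn⟩

theorem relIndex_sup_zpowers (h : IsCentralExtensionOfClassTwo L Q M) {y : Q}
    (hy : y ∈ commutator Q) (hyM : y ∉ M) : M.relIndex (M ⊔ Subgroup.zpowers y) = 2 := by
  have hM : M.Normal := h.normal_of_le le_rfl h.le_commutator
  have h1 := Subgroup.relIndex_ker (M ⊔ Subgroup.zpowers y) (QuotientGroup.mk' M)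
  rw [QuotientGroup.ker_mk', Subgroup.map_sup, QuotientGroup.map_mk'_self, bot_sup_eq,
    MonoidHom.map_zpowers, Nat.card_zpowers] at h1
  rw [h1]
  refine orderOf_eq_prime ?_ ?_
  · rw [← map_pow]
    exact (QuotientGroup.eq_one_iff _).mpr (h.sq_mem_of_mem y hy)
  · exact fun h2 => hyM ((QuotientGroup.eq_one_iff y).mp h2)

theorem index_sup_zpowers (h : IsCentralExtensionOfClassTwo L Q M) {y : Q}
    (hy : y ∈ commutator Q) (hyM : y ∉ M) {k : ℕ} (hk : Nat.card L + 1 = 2 ^ (k + 1)) :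
    (M ⊔ Subgroup.zpowers y).index = 2 * 4 ^ k := by
  have h1 := Subgroup.relIndex_mul_index h.le_commutator
  have h2 := Subgroup.relIndex_mul_index (le_sup_left : M ≤ M ⊔ Subgroup.zpowers y)
  rw [h.relIndex, h.index_commutator, hk] at h1
  rw [h.relIndex_sup_zpowers hy hyM, ← h1] at h2
  have h3 : 2 ^ (k + 1) * 2 ^ (k + 1) = 2 * (2 * 4 ^ k) := by
    rw [show 4 = 2 ^ 2 from rfl, ← pow_mul]; ring
  rw [h3] at h2
  exact Nat.eq_of_mul_eq_mul_left two_pos h2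

/-- Counting characters of each degree. -/
theorem three_mul_index_add_le [Finite Q] (h : IsCentralExtensionOfClassTwo L Q M) {N : Subgroup Q}
    {ν : N →* ℂˣ} {S : Finset (Q → ℂ)} (hS : ∀ χ ∈ S, IrrOver N ν χ)
    (hsum : ∑ χ ∈ S, χ 1 ^ 2 = (N.index : ℂ)) {c m : ℕ}
    (hfib : ∀ χ₀ ∈ S, ∀ T ⊆ S, (∀ χ ∈ T, χ 1 = χ₀ 1) → T.card ≤ c)
    (hlt : ∀ χ ∈ S, ∀ a, χ 1 = 2 ^ a → a < m) : 3 * N.index + c ≤ c * 4 ^ m := by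
  classical
  choose! a ha using fun χ (hχ : χ ∈ S) => h.exists_degree_eq_two_pow (hS χ hχ)
  have h1 : ∑ χ ∈ S, 4 ^ a χ = N.index := by
    have : ((∑ χ ∈ S, 4 ^ a χ : ℕ) : ℂ) = N.index := by
      rw [← hsum, Nat.cast_sum]
      refine Finset.sum_congr rfl fun χ hχ => ?_
      rw [ha χ hχ]
      push_cast
      rw [← pow_mul, mul_comm, pow_mul]
      norm_num
    exact_mod_cast this
  rw [← h1]
  refine three_mul_sum_four_pow_le S a c m (fun j => ?_) fun χ hχ => hlt χ hχ _ (ha χ hχ)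
  rcases (S.filter fun χ => a χ = j).eq_empty_or_nonempty with he | ⟨χ₀, hχ₀⟩
  · rw [he, Finset.card_empty]
    exact Nat.zero_le c
  · rw [Finset.mem_filter] at hχ₀
    refine hfib χ₀ hχ₀.1 _ (Finset.filter_subset _ _) fun χ hχ => ?_
    rw [Finset.mem_filter] at hχ
    rw [ha χ hχ.1, ha χ₀ hχ₀.1, hχ.2, hχ₀.2]

theorem degree_le {N : Subgroup Q} {S : Finset (Q → ℂ)}
    (hdeg : ∀ χ ∈ S, ∃ a : ℕ, χ 1 = 2 ^ a)
    (hsum : ∑ χ ∈ S, χ 1 ^ 2 = (N.index : ℂ)) {k : ℕ} (hk : N.index = 2 * 4 ^ k)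
    {χ : Q → ℂ} (hχ : χ ∈ S) {a : ℕ} (ha : χ 1 = 2 ^ a) : a ≤ k := by
  choose! b hb using hdeg
  have h1 : ∑ χ ∈ S, 4 ^ b χ = 2 * 4 ^ k := by
    have : ((∑ χ ∈ S, 4 ^ b χ : ℕ) : ℂ) = N.index := by
      rw [← hsum, Nat.cast_sum]
      refine Finset.sum_congr rfl fun χ hχ => ?_
      rw [hb χ hχ]
      push_cast
      rw [← pow_mul, mul_comm, pow_mul]
      norm_num
    rw [← hk]
    exact_mod_cast this
  have h2 : 4 ^ b χ ≤ 2 * 4 ^ k := by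
    rw [← h1]
    exact Finset.single_le_sum (f := fun χ => 4 ^ b χ) (fun _ _ => Nat.zero_le _) hχ
  have h3 : a = b χ := by
    rw [hb χ hχ] at ha
    have : (2 : ℕ) ^ b χ = 2 ^ a := by exact_mod_cast ha
    exact (Nat.pow_right_injective le_rfl this).symm
  rw [← h3] at h2
  by_contra hcon
  have : 4 ^ (k + 1) ≤ 4 ^ a := Nat.pow_le_pow_right (by norm_num) (by omega)
  rw [pow_succ] at this
  have : 0 < 4 ^ k := by positivity
  omega

theorem lam_bracket_eq_one (h : IsCentralExtensionOfClassTwo L Q M) {y : commutator Q}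
    {lam : M →* ℂˣ} (hlam : ∀ g, lam (h.bracket g y) = 1)
    (hN : M ⊔ Subgroup.zpowers (y : Q) ≤ commutator Q) (g : Q)
    (n : (M ⊔ Subgroup.zpowers (y : Q) : Subgroup Q)) :
    lam (h.bracket g (Subgroup.inclusion hN n)) = 1 := by
  have hle : M ⊔ Subgroup.zpowers (y : Q) ≤
      ((lam.comp (h.bracket g)).ker.map (commutator Q).subtype) := by
    rw [sup_le_iff, Subgroup.zpowers_le]
    refine ⟨fun m hm => ⟨⟨m, h.le_commutator hm⟩, ?_, rfl⟩, ⟨y, hlam g, rfl⟩⟩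
    change lam (h.bracket g _) = 1
    rw [h.bracket_eq_one_of_mem g (by exact hm), map_one]
  obtain ⟨w, hw, hwn⟩ := hle n.2
  rw [show Subgroup.inclusion hN n = w from Subtype.ext hwn.symm]
  exact hw

/-- Let `y = x ^ 2` and `N = M ⟨y⟩`, of index `2 * 4 ^ k`. If `lam (x ^ 4) = 1`, each extension `ν`
of `lam` to `N` has `ν y = ±1`, which odd powers do not change. But both extensions lie under
characters of degree `2 ^ k`, which would have to be conjugate by an odd power map. -/
theorem lam_sq_ne_one [Finite Q] [Finite L] (h : IsCentralExtensionOfClassTwo L Q M) {x : Q}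
    (hx : x ∉ commutator Q) {lam : M →* ℂˣ} (hlam1 : lam ≠ 1)
    (hlam : ∀ g, lam (h.bracket g ⟨x ^ 2, h.sq_mem x⟩) = 1) :
    lam ⟨x ^ 4, h.pow_four_mem x⟩ ≠ 1 := by
  intro hx4
  obtain ⟨k, hk⟩ := h.exists_index_eq
  have hyM := h.sq_notMem x hx
  have hyD := h.sq_mem x
  set y := x ^ 2 with hy
  set N := M ⊔ Subgroup.zpowers y with hNdef
  have hMN : M ≤ N := le_sup_left
  have hyN : y ∈ N := Subgroup.mem_sup_right (Subgroup.mem_zpowers y)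
  have hN : N ≤ commutator Q := sup_le h.le_commutator ((Subgroup.zpowers_le).mpr hyD)
  have hidx : N.index = 2 * 4 ^ k := h.index_sup_zpowers hyD hyM hk
  have hinv := h.lam_bracket_eq_one (y := ⟨y, hyD⟩) hlam hN
  obtain ⟨ν, hν⟩ := h.exists_ext hMN hN lam
  have hνy : ν ⟨y, hyN⟩ ^ 2 = 1 := by
    rw [← map_pow, ← hx4, ← hν]
    congr 1
    apply Subtype.ext
    change y ^ 2 = x ^ 4
    rw [hy, ← pow_mul]
  have hbot : commutator N = ⊥ := by
    rw [commutator_eq_bot_iff]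
    exact ⟨⟨fun a b => Subtype.ext (h.commute_of_mem (hN a.2) (hN b.2))⟩⟩
  have hnM : (M.subgroupOf N).Normal := (h.normal_of_le le_rfl h.le_commutator).subgroupOf N
  obtain ⟨ε, hεM, hε⟩ := exists_apply_ne_one (M.subgroupOf N) (by rw [hbot]; exact bot_le)
    (x := (⟨y, hyN⟩ : N)) hyM
  have hν' : ∀ m, (ν * ε) (Subgroup.inclusion hMN m) = lam m := fun m => by
    rw [MonoidHom.mul_apply, hν, hεM _ m.2, mul_one]
  have key : ∀ ν : N →* ℂˣ, (∀ m, ν (Subgroup.inclusion hMN m) = lam m) →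
      ∃ χ, IrrOver N ν χ ∧ χ 1 = 2 ^ k := by
    intro ν hν
    obtain ⟨S, hS, hsum⟩ := h.exists_finset hMN hN hinv hν
    have hle := fun χ hχ a ha => degree_le (fun χ hχ => h.exists_degree_eq_two_pow (hS χ hχ))
      hsum hidx (χ := χ) hχ (a := a) ha
    by_contra! hcon
    -- As `g ^ 8 = 1`, only the four odd classes mod `8` matter, so each degree occurs at most four
    -- times. Without degree `2 ^ k` this gives `3 * (2 * 4 ^ k) + 4 ≤ 4 * 4 ^ k`, which is false.
    have hcount := h.three_mul_index_add_le hS hsum (c := 4) (m := k) (fun χ₀ hχ₀ T hT hTdeg => by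
      classical
      have hsub : T ⊆ ({1, 3, 5, 7} : Finset ℕ).image fun t g => χ₀ (g ^ t) := by
        intro χ hχ
        obtain ⟨t, htodd, ht, -⟩ := h.exists_pow_eq hMN hlam1 hν hν (hS χ₀ hχ₀) (hS χ (hT hχ))
          (hTdeg χ hχ).symm
        rw [Finset.mem_image]
        refine ⟨t % 8, ?_, ?_⟩
        · have := htodd
          rw [Nat.odd_iff] at this
          simp only [Finset.mem_insert, Finset.mem_singleton]
          omega
        · ext g
          rw [ht]
          congr 1
          conv_rhs => rw [← Nat.mod_add_div t 8, pow_add, pow_mul, h.pow_eight, one_pow, mul_one]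
      exact (Finset.card_le_card hsub).trans (Finset.card_image_le.trans (by simp)))
      (fun χ hχ a ha => lt_of_le_of_ne (hle χ hχ a ha) (by
        rintro rfl
        exact hcon χ (hS χ hχ) ha))
    rw [hidx] at hcount
    have : 0 < 4 ^ k := by positivity
    omega
  obtain ⟨χ, hχ, hχd⟩ := key ν hν
  obtain ⟨χ', hχ', hχd'⟩ := key _ hν'
  obtain ⟨t, htodd, -, ht⟩ := h.exists_pow_eq hMN hlam1 hν hν' hχ hχ' (hχd.trans hχd'.symm)
  have h1 := ht ⟨y, hyN⟩
  obtain ⟨j, rfl⟩ := htodd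
  rw [MonoidHom.mul_apply, pow_succ, pow_mul, hνy, one_pow, one_mul] at h1
  exact hε (mul_eq_left.mp h1)

end IsCentralExtensionOfClassTwo

end GaloisFrobenius

/-! ### Class three: structure of `M`, conjugacy of `g` and `g ^ 5`, contradiction -/

namespace GaloisFrobenius

open scoped commutatorElement IsMulCommutative

namespace IsCentralExtensionOfClassTwo

variable {L Q : Type*} [Group L] [Group Q] [MulDistribMulAction L Q] {M : Subgroup Q} [Finite L]

theorem exists_notMem (h : IsCentralExtensionOfClassTwo L Q M) : ∃ x, x ∉ commutator Q := by
  by_contra! hcon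
  have h1 := h.index_commutator
  rw [show commutator Q = ⊤ from eq_top_iff.mpr fun x _ => hcon x, Subgroup.index_top] at h1
  have : 0 < Nat.card L := Nat.card_pos
  omega

variable [Finite Q]

theorem range_sup_zpowers_eq_top (h : IsCentralExtensionOfClassTwo L Q M) {x : Q}
    (hx : x ∉ commutator Q) : (h.bracketLeft ⟨x ^ 2, h.sq_mem x⟩).range ⊔
      Subgroup.zpowers ⟨x ^ 4, h.pow_four_mem x⟩ = ⊤ := by
  have := h.isMulCommutative
  have hbot : commutator M = ⊥ := (commutator_eq_bot_iff M).mpr this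
  by_contra hR
  set R := (h.bracketLeft ⟨x ^ 2, h.sq_mem x⟩).range ⊔
    Subgroup.zpowers (⟨x ^ 4, h.pow_four_mem x⟩ : M) with hRdef
  obtain ⟨z, hz⟩ : ∃ z, z ∉ R := by
    by_contra! hcon
    exact hR (eq_top_iff.mpr fun x _ => hcon x)
  have hn : R.Normal := Subgroup.Normal.of_commutator_le _ (by rw [hbot]; exact bot_le)
  obtain ⟨lam, hlam, h1⟩ := exists_apply_ne_one R (by rw [hbot]; exact bot_le) hz
  refine h.lam_sq_ne_one hx (lam := lam) (fun h => h1 (by rw [h, MonoidHom.one_apply]))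
    (fun g => ?_) ?_
  · exact hlam _ (Subgroup.mem_sup_left ⟨g, rfl⟩)
  · exact hlam _ (Subgroup.mem_sup_right (Subgroup.mem_zpowers _))

theorem card_le_card (h : IsCentralExtensionOfClassTwo L Q M) : Nat.card L + 1 ≤ Nat.card M := by
  let _ := restrictAction M h.smul_mem
  have h1 : IsFixedPointFree L M := fun l hl k hk =>
    Subtype.ext (h.fpf l hl k (congrArg Subtype.val hk))
  have : Nontrivial M := (Subgroup.nontrivial_iff_ne_bot _).mpr h.ne_bot
  have h2 : 1 < Nat.card M := Finite.one_lt_card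
  have := Nat.le_of_dvd (by omega) h1.card_dvd
  omega

/-- The kernel of `⁅·, x ^ 2⁆` contains `Q'` and also `x`, so its index in `Q` is at most `|Q : Q'|
/ 2`. The range has index at most two in `M`. As `|M| ≥ |L| + 1 = |Q : Q'|`, all these bounds are
equalities. -/
theorem card_eq_and_index_eq (h : IsCentralExtensionOfClassTwo L Q M) {x : Q}
    (hx : x ∉ commutator Q) : Nat.card M = Nat.card L + 1 ∧
      (h.bracketLeft ⟨x ^ 2, h.sq_mem x⟩).range.index = 2 ∧
      (commutator Q).relIndex (h.bracketLeft ⟨x ^ 2, h.sq_mem x⟩).ker = 2 := by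
  have := h.isMulCommutative
  set β := h.bracketLeft ⟨x ^ 2, h.sq_mem x⟩ with hβ
  have hn : β.range.Normal := inferInstance
  have hdvd : β.range.index ∣ 2 := index_dvd_of_sup_zpowers_eq_top _ _
    (h.range_sup_zpowers_eq_top hx) (Subtype.ext (h.sq_eq_one _ (h.pow_four_mem x)))
  have hle : commutator Q ≤ β.ker := fun g hg => h.bracket_of_mem_commutator hg _
  have hxker : x ∈ β.ker := by
    apply Subtype.ext
    change ⁅x, x ^ 2⁆ = 1
    rw [commutatorElement_eq_one_iff_mul_comm]
    exact (Commute.refl x).pow_right 2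
  have h1 := Subgroup.relIndex_mul_index hle
  rw [h.index_commutator] at h1
  have h2 := Subgroup.card_mul_index β.range
  rw [← Subgroup.index_ker] at h2
  have h3 := h.card_le_card
  have h4 : (commutator Q).relIndex β.ker ≠ 1 := fun h4 => hx (Subgroup.relIndex_eq_one.mp h4 hxker)
  have h5 : 0 < β.ker.index := Nat.pos_of_ne_zero Subgroup.index_ne_zero_of_finite
  have h6 : (commutator Q).relIndex β.ker ≠ 0 := by
    intro h6
    rw [h6, zero_mul] at h1
    omega
  have h7 : β.range.index ≤ 2 := Nat.le_of_dvd two_pos hdvd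
  have h8 : (commutator Q).relIndex β.ker ≤ β.range.index := by
    rw [← h1, ← h2, mul_comm] at h3
    exact Nat.le_of_mul_le_mul_left h3 h5
  have h9 : β.range.index = 2 := by omega
  have h10 : (commutator Q).relIndex β.ker = 2 := by omega
  refine ⟨?_, h9, h10⟩
  rw [← h1, ← h2, h9, h10, mul_comm]

theorem pow_four_ne_one (h : IsCentralExtensionOfClassTwo L Q M) {x : Q}
    (hx : x ∉ commutator Q) : x ^ 4 ≠ 1 := by
  intro hx4
  have h1 := h.range_sup_zpowers_eq_top hx
  have h2 := (h.card_eq_and_index_eq hx).2.1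
  rw [show (⟨x ^ 4, h.pow_four_mem x⟩ : M) = 1 from Subtype.ext hx4, Subgroup.zpowers_one_eq_bot,
    sup_bot_eq] at h1
  rw [h1, Subgroup.index_top] at h2
  omega

theorem inv_mul_mem_of_commute (h : IsCentralExtensionOfClassTwo L Q M) {x g : Q}
    (hx : x ∉ commutator Q) (hg : g ∉ commutator Q) (hgx : Commute g (x ^ 2)) :
    x⁻¹ * g ∈ commutator Q := by
  have h1 := (h.card_eq_and_index_eq hx).2.2
  set C := (h.bracketLeft ⟨x ^ 2, h.sq_mem x⟩).ker with hC
  have hxC : x ∈ C := Subtype.ext (commutatorElement_eq_one_iff_mul_comm.mpr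
    ((Commute.refl x).pow_right 2))
  have hgC : g ∈ C := Subtype.ext (commutatorElement_eq_one_iff_mul_comm.mpr hgx)
  have h2 := Subgroup.mul_mem_iff_of_index_two (H := (commutator Q).subgroupOf C) h1
    (a := (⟨x, hxC⟩ : C)⁻¹) (b := ⟨g, hgC⟩)
  rw [inv_mem_iff] at h2
  exact h2.mpr ⟨fun h3 => (hx h3).elim, fun h3 => (hg h3).elim⟩

theorem sq_ne_one_of_notMem (h : IsCentralExtensionOfClassTwo L Q M) {w : Q}
    (hw : w ∈ commutator Q) (hwM : w ∉ M) : w ^ 2 ≠ 1 := by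
  obtain ⟨x, hx, m, hm, rfl⟩ := h.exists_sq w hw hwM
  have hc : Commute (x ^ 2) m := Subgroup.mem_center_iff.mp (h.le_center hm) _
  rw [hc.mul_pow, h.sq_eq_one m hm, mul_one, ← pow_mul]
  exact h.pow_four_ne_one hx

/-- Modulo `M`, `w` is a square `x' ^ 2`. Since `x` commutes with `x' ^ 2`, it agrees with `x'`
modulo `Q'`, so their squares agree modulo `M`. -/
theorem inv_mul_mem_of_commute_of_mem (h : IsCentralExtensionOfClassTwo L Q M) {x w : Q}
    (hx : x ∉ commutator Q) (hw : w ∈ commutator Q) (hwM : w ∉ M) (hxw : Commute x w) :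
    (x ^ 2)⁻¹ * w ∈ M := by
  obtain ⟨x', hx', m, hm, rfl⟩ := h.exists_sq w hw hwM
  have hcm : Commute x m := Subgroup.mem_center_iff.mp (h.le_center hm) _
  have hcx : Commute x (x' ^ 2) := by
    have := hxw.mul_right hcm.inv_right
    rwa [mul_inv_cancel_right] at this
  have h1 := h.inv_mul_mem_of_commute hx' hx hcx
  obtain ⟨a, ha, h2⟩ := h.exists_sq_mul_eq x' h1
  rw [mul_inv_cancel_left] at h2
  rw [h2, mul_inv_rev, ← mul_assoc, inv_mul_cancel_right]
  exact mul_mem (inv_mem ha) hm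

/-- The squaring homomorphism from the commutator subgroup to `M`. -/
def sqHom (h : IsCentralExtensionOfClassTwo L Q M) : commutator Q →* M where
  toFun w := ⟨(w : Q) ^ 2, h.sq_mem_of_mem w w.2⟩
  map_one' := Subtype.ext (one_pow 2)
  map_mul' w w' := Subtype.ext ((h.commute_of_mem w.2 w'.2).mul_pow 2)

theorem ker_sqHom (h : IsCentralExtensionOfClassTwo L Q M) :
    h.sqHom.ker = M.subgroupOf (commutator Q) := by
  ext w
  rw [MonoidHom.mem_ker, Subgroup.mem_subgroupOf]
  refine ⟨fun h1 => ?_, fun h1 => Subtype.ext (h.sq_eq_one _ h1)⟩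
  by_contra hw
  exact h.sq_ne_one_of_notMem w.2 hw (congrArg Subtype.val h1)

theorem card_eq (h : IsCentralExtensionOfClassTwo L Q M) : Nat.card M = Nat.card L + 1 := by
  obtain ⟨x, hx⟩ := h.exists_notMem
  exact (h.card_eq_and_index_eq hx).1

theorem sqHom_surjective (h : IsCentralExtensionOfClassTwo L Q M) :
    Function.Surjective h.sqHom := by
  rw [← MonoidHom.range_eq_top]
  apply Subgroup.eq_top_of_card_eq
  rw [← Subgroup.index_ker, ker_sqHom, h.card_eq]
  exact h.relIndex

theorem relIndex_ker_bracket (h : IsCentralExtensionOfClassTwo L Q M) {x : Q}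
    (hx : x ∉ commutator Q) :
    (M.subgroupOf (commutator Q)).relIndex (h.bracket x).ker = 2 := by
  rw [Subgroup.relIndex_eq_two_iff_exists_notMem_and']
  have hcomm : h.bracket x ⟨x ^ 2, h.sq_mem x⟩ = 1 :=
    Subtype.ext (commutatorElement_eq_one_iff_mul_comm.mpr ((Commute.refl x).pow_right 2))
  refine ⟨(⟨x ^ 2, h.sq_mem x⟩ : commutator Q)⁻¹, inv_mem hcomm, ?_, fun w hw => ?_⟩
  · rw [inv_mem_iff]
    exact h.sq_notMem x hx
  · by_cases hwM : (w : Q) ∈ M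
    · exact Or.inr hwM
    · exact Or.inl (h.inv_mul_mem_of_commute_of_mem hx w.2 hwM
        (commutatorElement_eq_one_iff_mul_comm.mp (congrArg Subtype.val hw)))

theorem index_range_bracket (h : IsCentralExtensionOfClassTwo L Q M) {x : Q}
    (hx : x ∉ commutator Q) : (h.bracket x).range.index = 2 := by
  have h1 : M.subgroupOf (commutator Q) ≤ (h.bracket x).ker := fun w hw =>
    h.bracket_eq_one_of_mem x hw
  have h2 := Subgroup.relIndex_mul_index h1
  rw [h.relIndex_ker_bracket hx, Subgroup.index_ker] at h2
  have h3 := Subgroup.card_mul_index (h.bracket x).range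
  rw [h.card_eq, ← h.relIndex] at h3
  have h4 : 0 < Nat.card (h.bracket x).range := Nat.card_pos
  exact Nat.eq_of_mul_eq_mul_left h4 (h3.trans (h2.symm.trans (mul_comm _ _)))

/-- `exists_pairing_eq` with squaring `Q' → M` as `s`: the element `x ^ 2` commutes with `x`, and
its square `x ^ 4` is nontrivial. -/
theorem exists_bracket_eq [Nontrivial L] (h : IsCentralExtensionOfClassTwo L Q M) :
    ∃ x, x ∉ commutator Q ∧ ∃ w ∈ commutator Q, ⁅x, w⁆ = x ^ 4 := by
  have := h.isMulCommutative
  have : Nontrivial M := (Subgroup.nontrivial_iff_ne_bot _).mpr h.ne_bot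
  let b : Q →* (commutator Q →* M) :=
    { toFun := h.bracket
      map_one' := MonoidHom.ext h.bracket_one
      map_mul' := fun x y => MonoidHom.ext (h.bracket_mul x y) }
  obtain ⟨x, hx, w, hw⟩ := exists_pairing_eq (p := 2) (fun m : M => Subtype.ext (h.sq_eq_one m m.2))
    h.sq_mem h.sqHom h.sqHom_surjective b
    (fun x w hw => by
      rw [h.ker_sqHom] at hw
      exact h.bracket_eq_one_of_mem x hw)
    (by rw [h.card_eq, h.index_commutator])
    (fun x hx => by
      refine ⟨fun hb => ?_, h.index_range_bracket hx⟩
      have h1 := h.index_range_bracket hx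
      rw [show h.bracket x = 1 from hb, MonoidHom.range_one, Subgroup.index_bot, h.card_eq] at h1
      have : 1 < Nat.card L := Finite.one_lt_card
      omega)
    (fun x => ⟨x ^ 2, h.sq_mem x⟩)
    (fun x hx => by
      constructor
      · apply Subtype.ext
        change ⁅x, x ^ 2⁆ = 1
        rw [commutatorElement_eq_one_iff_mul_comm]
        exact (Commute.refl x).pow_right 2
      · intro h1
        have h2 : (x ^ 2) ^ 2 = 1 := congrArg Subtype.val h1
        rw [← pow_mul] at h2
        exact h.pow_four_ne_one hx h2)
  refine ⟨x, hx, w, w.2, ?_⟩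
  have h2 : ⁅x, (w : Q)⁆ = (x ^ 2) ^ 2 := congrArg Subtype.val hw
  rw [h2, ← pow_mul]

/-- The equation `⁅g, w⁆ = g ^ 4` depends only on `g` modulo `Q'`, where `L` is transitive on
nontrivial cosets, so a single solution spreads to all `g ∉ Q'`. Conjugation by `w` then multiplies
`g` by `g ^ (-4) = g ^ 4`. On `Q'` one has `g ^ 4 = 1`. -/
theorem isConj_pow_five [Nontrivial L] (h : IsCentralExtensionOfClassTwo L Q M) (g : Q) :
    IsConj g (g ^ 5) := by
  by_cases hg : g ∈ commutator Q
  · have : g ^ 4 = 1 := by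
      rw [show 4 = 2 * 2 from rfl, pow_mul]
      exact h.sq_eq_one _ (h.sq_mem_of_mem g hg)
    rw [pow_succ, this, one_mul]
  obtain ⟨x, hx, w, hw, hxw⟩ := h.exists_bracket_eq
  have : Nontrivial Q := ⟨x, 1, fun h1 => hx (h1 ▸ one_mem _)⟩
  obtain ⟨l, d, hd, rfl⟩ := h.gt.exists_smul_mul_eq h.fpf h.isPGroup h.sq_mem hx hg
  set g := l • x * d with hgdef
  have hlw : l • w ∈ commutator Q := smul_mem_of_characteristic _ l hw
  have h1 : ⁅g, l • w⁆ = g ^ 4 := by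
    have h2 := congrArg Subtype.val (h.bracket_mul (l • x) d ⟨l • w, hlw⟩)
    rw [h.bracket_of_mem_commutator hd, mul_one] at h2
    change ⁅g, l • w⁆ = ⁅l • x, l • w⁆ at h2
    rw [h2, hgdef, h.pow_four_mul_eq _ hd, ← smul_pow', ← hxw]
    simp only [commutatorElement_def, smul_mul', smul_inv']
  rw [isConj_iff]
  refine ⟨l • w, ?_⟩
  have h3 : l • w * g * (l • w)⁻¹ = ⁅g, l • w⁆⁻¹ * g := by
    rw [commutatorElement_def]; group
  rw [h3, h1, inv_mul_eq_iff_eq_mul, ← pow_add, pow_succ, h.pow_eight, one_mul]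

/-- Such a central extension does not exist. -/
theorem false [Nontrivial L] (h : IsCentralExtensionOfClassTwo L Q M) : False := by
  obtain ⟨x, hx⟩ := h.exists_notMem
  obtain ⟨k, hk⟩ := h.exists_index_eq
  have := h.isMulCommutative
  have hbot : commutator M = ⊥ := (commutator_eq_bot_iff M).mpr this
  obtain ⟨-, hR, -⟩ := h.card_eq_and_index_eq hx
  obtain ⟨z, hz⟩ : ∃ z, z ∉ (h.bracketLeft ⟨x ^ 2, h.sq_mem x⟩).range := by
    by_contra! hcon
    rw [Subgroup.index_eq_one.mpr (eq_top_iff.mpr fun x _ => hcon x)] at hR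
    omega
  obtain ⟨lam, hlamR, hlamz⟩ := exists_apply_ne_one (h.bracketLeft ⟨x ^ 2, h.sq_mem x⟩).range
    (by rw [hbot]; exact bot_le) hz
  have hlam : ∀ g, lam (h.bracket g ⟨x ^ 2, h.sq_mem x⟩) = 1 := fun g => hlamR _ ⟨g, rfl⟩
  have hlam1 : lam ≠ 1 := fun h => hlamz (by rw [h, MonoidHom.one_apply])
  have hx4 := h.lam_sq_ne_one hx hlam1 hlam
  have hyM := h.sq_notMem x hx
  have hyD := h.sq_mem x
  set y := x ^ 2 with hy
  set N := M ⊔ Subgroup.zpowers y with hNdef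
  have hMN : M ≤ N := le_sup_left
  have hyN : y ∈ N := Subgroup.mem_sup_right (Subgroup.mem_zpowers y)
  have hN : N ≤ commutator Q := sup_le h.le_commutator ((Subgroup.zpowers_le).mpr hyD)
  have hidx : N.index = 2 * 4 ^ k := h.index_sup_zpowers hyD hyM hk
  have hinv := h.lam_bracket_eq_one (y := ⟨y, hyD⟩) hlam hN
  obtain ⟨ν, hν⟩ := h.exists_ext hMN hN lam
  have hνy : ν ⟨y, hyN⟩ ^ 2 ≠ 1 := by
    intro h1
    apply hx4
    rw [← h1, ← map_pow, ← hν]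
    congr 1
    apply Subtype.ext
    change x ^ 4 = y ^ 2
    rw [hy, ← pow_mul]
  obtain ⟨S, hS, hsum⟩ := h.exists_finset hMN hN hinv hν
  have hcount := h.three_mul_index_add_le hS hsum (c := 1) (m := k + 1)
    (fun χ₀ hχ₀ T hT hTdeg => by
      rw [Finset.card_le_one]
      have : ∀ χ ∈ T, χ = χ₀ := by
        intro χ hχ
        obtain ⟨t, htodd, ht, hνt⟩ := h.exists_pow_eq hMN hlam1 hν hν (hS χ₀ hχ₀) (hS χ (hT hχ))
          (hTdeg χ hχ).symm
        -- `ν y` has order four, and `ν y ^ t = ν y` fixes `t` mod `4`. The two remaining classes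
        -- `1` and `5` mod `8` give the same character because `g` and `g ^ 5` are conjugate.
        have h4 : t % 4 = 1 := by
          by_contra h4
          obtain ⟨j, hj⟩ : ∃ j, t = 4 * j + 3 := ⟨t / 4, by
            rw [Nat.odd_iff] at htodd
            omega⟩
          have h5 := hνt ⟨y, hyN⟩
          have h6 : ν ⟨y, hyN⟩ ^ 4 = 1 := by
            rw [← map_pow, show (⟨y, hyN⟩ : N) ^ 4 = 1 from Subtype.ext (by
              change y ^ 4 = 1
              rw [hy, ← pow_mul, h.pow_eight]), map_one]
          rw [hj, pow_add, pow_mul, h6, one_pow, one_mul, pow_succ] at h5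
          exact hνy (mul_eq_right.mp h5.symm)
        ext g
        rw [ht]
        have h7 : t % 8 = 1 ∨ t % 8 = 5 := by omega
        have h8 : g ^ t = g ^ (t % 8) := by
          conv_lhs => rw [← Nat.mod_add_div t 8, pow_add, pow_mul, h.pow_eight, one_pow, mul_one]
        rw [h8]
        rcases h7 with h7 | h7 <;> rw [h7]
        · rw [pow_one]
        · obtain ⟨c, hc⟩ := isConj_iff.mp (h.isConj_pow_five g)
          rw [← hc, (hS χ₀ hχ₀).apply_conj]
      exact fun a ha b hb => (this a ha).trans (this b hb).symm)
    (fun χ hχ a ha => Nat.lt_succ_of_le (degree_le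
      (fun χ hχ => h.exists_degree_eq_two_pow (hS χ hχ)) hsum hidx hχ ha))
  -- At most one character of each degree would give `3 * (2 * 4 ^ k) + 1 ≤ 4 * 4 ^ k`.
  rw [hidx, pow_succ] at hcount
  have : 0 < 4 ^ k := by positivity
  omega

end IsCentralExtensionOfClassTwo

end GaloisFrobenius

/-! ### Reduction to class two and class three by lower central quotients -/

namespace GaloisFrobenius

theorem lowerCentralSeries_quotient_le_center {K : Type*} [Group K] (n : ℕ) :
    (⊤ : Subgroup (K ⧸ (⊤ : Subgroup K).lowerCentralSeries (n + 1))).lowerCentralSeries n ≤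
      Subgroup.center _ := by
  set N := (⊤ : Subgroup K).lowerCentralSeries (n + 1)
  rw [← Subgroup.centralizer_univ, ← Subgroup.coe_top,
    ← Subgroup.commutator_eq_bot_iff_le_centralizer, ← Subgroup.lowerCentralSeries_succ,
    ← Subgroup.map_top_of_surjective _ (QuotientGroup.mk'_surjective N),
    ← Subgroup.map_lowerCentralSeries]
  exact QuotientGroup.map_mk'_self N

theorem lowerCentralSeries_quotient_ne_bot {K : Type*} [Group K] [Group.IsNilpotent K] (n : ℕ)
    (hn : (⊤ : Subgroup K).lowerCentralSeries n ≠ ⊥) :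
    (⊤ : Subgroup (K ⧸ (⊤ : Subgroup K).lowerCentralSeries (n + 1))).lowerCentralSeries n ≠ ⊥ := by
  set N := (⊤ : Subgroup K).lowerCentralSeries (n + 1)
  rw [← Subgroup.map_top_of_surjective _ (QuotientGroup.mk'_surjective N),
    ← Subgroup.map_lowerCentralSeries, Ne, Subgroup.map_eq_bot_iff, QuotientGroup.ker_mk']
  intro hle
  have hstab : ∀ m, (⊤ : Subgroup K).lowerCentralSeries n ≤
      (⊤ : Subgroup K).lowerCentralSeries (n + m) := by
    intro m
    induction m with
    | zero => exact le_rfl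
    | succ m ih => exact hle.trans (Subgroup.commutator_mono ih le_rfl)
  obtain ⟨m, hm⟩ := Subgroup.nilpotent_iff_lowerCentralSeries.mp ‹Group.IsNilpotent K›
  apply hn
  rw [eq_bot_iff, ← hm]
  exact (hstab m).trans (Subgroup.lowerCentralSeries_antitone _ (Nat.le_add_left m n))

/-- Numbering from `0`, the quotient by term `n + 1` of the lower central series has term `n`
central and, if it was nontrivial in `K`, still nontrivial. The odd case is excluded at `n = 1`, and
class three for `p = 2` at `n = 2`. -/
theorem IsGaloisTransitive.exists_prime {L K : Type*} [Group L] [Group K]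
    [MulDistribMulAction L K] [Finite L] [Nontrivial L] [Finite K] [Nontrivial K]
    (hGT : IsGaloisTransitive L K) (hfpf : IsFixedPointFree L K) (hsol : Group.IsSolvable K) :
    ∃ p, p.Prime ∧ IsPGroup p K ∧ (∀ x : K, x ^ p ∈ commutator K) ∧
      (commutator K ≠ ⊥ → p = 2 ∧ commutator K ≤ Subgroup.center K) := by
  obtain ⟨p, hp, hpow⟩ := hGT.exists_prime_pow_mem
    (Group.IsSolvable.commutator_lt_top_of_nontrivial K).ne
  have := Fact.mk hp
  have hP : IsPGroup p K := isPGroup_of_isFixedPointFree (L := L) _ rfl hsol hfpf fun x =>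
    ⟨1, by rw [pow_one]; exact hpow x⟩
  have hnil : Group.IsNilpotent K := hP.isNilpotent
  refine ⟨p, hp, hP, hpow, fun hne => ?_⟩
  have hquot : ∀ n, (⊤ : Subgroup K).lowerCentralSeries n ≠ ⊥ →
      ∃ (_ : MulDistribMulAction L (K ⧸ (⊤ : Subgroup K).lowerCentralSeries (n + 1))),
        IsGaloisTransitive L (K ⧸ (⊤ : Subgroup K).lowerCentralSeries (n + 1)) ∧
        IsFixedPointFree L (K ⧸ (⊤ : Subgroup K).lowerCentralSeries (n + 1)) ∧
        (∀ x : K ⧸ (⊤ : Subgroup K).lowerCentralSeries (n + 1), x ^ p ∈ commutator _) ∧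
        Nontrivial (K ⧸ (⊤ : Subgroup K).lowerCentralSeries (n + 1)) := by
    intro n hn
    have hbot := lowerCentralSeries_quotient_ne_bot n hn
    set N := (⊤ : Subgroup K).lowerCentralSeries (n + 1) with hN
    have hmk := QuotientGroup.mk'_surjective N
    refine ⟨quotientAction N fun l m hm => smul_mem_of_characteristic N l hm, ?_, ?_, ?_, ?_⟩
    · exact @IsGaloisTransitive.of_surjective _ _ _ _ _ _ _ _ (_) hGT (QuotientGroup.mk' N) hmk
        fun l k => rfl
    · exact @IsFixedPointFree.of_surjective _ _ _ _ _ _ _ _ (_) hfpf (QuotientGroup.mk' N) hmk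
        fun l k => rfl
    · intro x
      obtain ⟨x, rfl⟩ := hmk x
      rw [← map_pow, ← map_commutator_of_surjective _ hmk]
      exact ⟨_, hpow x, rfl⟩
    · by_contra hcon
      rw [not_nontrivial_iff_subsingleton] at hcon
      exact hbot (Subsingleton.elim _ _)
  have h1 : (⊤ : Subgroup K).lowerCentralSeries 1 ≠ ⊥ := hne
  have hp2 : p = 2 := by
    by_contra hp2
    obtain ⟨_, hGT', hfpf', hpow', _⟩ := hquot 1 h1
    exact lowerCentralSeries_quotient_ne_bot 1 h1 (hGT'.commutator_eq_bot_of_odd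
      (lowerCentralSeries_quotient_le_center 1) hfpf' (hP.to_quotient _) hp2 hpow')
  subst hp2
  refine ⟨rfl, ?_⟩
  have h2 : (⊤ : Subgroup K).lowerCentralSeries 2 = ⊥ := by
    by_contra h2
    obtain ⟨_, hGT', hfpf', hpow', _⟩ := hquot 2 h2
    exact (hGT'.isCentralExtensionOfClassTwo hfpf' (hP.to_quotient _) hpow'
      (lowerCentralSeries_quotient_ne_bot 2 h2) (lowerCentralSeries_quotient_le_center 2)).false
  rw [Subgroup.lowerCentralSeries_succ, Subgroup.commutator_eq_bot_iff_le_centralizer,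
    Subgroup.coe_top, Subgroup.centralizer_univ] at h2
  exact h2

end GaloisFrobenius

/-! ### Groups of odd prime power order acting fixed-point-freely are cyclic -/

namespace GaloisFrobenius

open scoped commutatorElement IsMulCommutative

/-- An abelian group acting fixed-point-freely on a finite abelian group is cyclic. -/
theorem isCyclic_of_isMulCommutative {A V : Type*} [Group A] [Finite A] [IsMulCommutative A]
    [AddCommGroup V] [Finite V] [Nontrivial V] (ρ : A →* AddMonoid.End V)
    (hρ : ∀ a, a ≠ 1 → ∀ v, ρ a v = v → v = 0) : IsCyclic A := by
  -- `R` is a finite commutative ring in which `ρ a - 1` is a unit for `a ≠ 1`. So `A` embeds in the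
  -- units of a residue field of `R`.
  let R := Subring.closure (Set.range ρ)
  have : IsMulCommutative R := Subring.isMulCommutative_closure (by
    rintro _ ⟨a, rfl⟩ _ ⟨b, rfl⟩
    rw [← map_mul, ← map_mul, mul_comm' a b])
  have : Finite (AddMonoid.End V) := Finite.of_injective (fun f => (f : V → V)) DFunLike.coe_injective
  let f : A →* R := ρ.codRestrict R.toSubmonoid fun a => Subring.subset_closure ⟨a, rfl⟩
  have : Nontrivial R := by
    obtain ⟨v, hv⟩ := exists_ne (0 : V)
    exact ⟨1, 0, fun h => hv (DFunLike.congr_fun (congrArg Subtype.val h) v)⟩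
  obtain ⟨m, hm⟩ := Ideal.exists_maximal R
  refine isCyclic_of_injective_ringHom ((Ideal.Quotient.mk m : R →* R ⧸ m).comp f) ?_
  rw [injective_iff_map_eq_one]
  intro a ha
  by_contra hne
  have hmem : f a - 1 ∈ m := by
    rw [← Ideal.Quotient.eq_zero_iff_mem, map_sub, map_one, sub_eq_zero]
    exact ha
  have hinj : Function.Injective fun r : R => (f a - 1) * r := by
    intro r s hrs
    apply Subtype.ext
    ext v
    have h1 : ρ a (r.1 v) - r.1 v = ρ a (s.1 v) - s.1 v :=
      DFunLike.congr_fun (congrArg Subtype.val hrs) v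
    have h2 : ρ a (r.1 v - s.1 v) = r.1 v - s.1 v := by
      rw [map_sub, sub_eq_sub_iff_sub_eq_sub]
      exact h1
    exact sub_eq_zero.mp (hρ a hne _ h2)
  obtain ⟨r, hr⟩ := (Finite.injective_iff_surjective.mp hinj) 1
  exact hm.ne_top ((Ideal.eq_top_iff_one m).mpr (hr ▸ m.mul_mem_right r hmem))

theorem exists_normal_index_eq_prime {p : ℕ} [hp : Fact p.Prime] {P : Type*} [Group P] [Finite P]
    (hP : IsPGroup p P) (x : P) (hx : Subgroup.zpowers x ≠ ⊤) :
    ∃ M : Subgroup P, x ∈ M ∧ M.index = p ∧ M.Normal ∧ commutator P ≤ M := by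
  obtain ⟨n, hn⟩ := hP.exists_card_eq
  obtain ⟨k, hk⟩ := (hP.to_subgroup (Subgroup.zpowers x)).exists_card_eq
  have hlt : k < n := by
    rw [← Nat.pow_lt_pow_iff_right hp.out.one_lt, ← hk, ← hn]
    refine lt_of_le_of_ne (Subgroup.card_le_card_group _) fun h => hx (Subgroup.eq_top_of_card_eq _ h)
  obtain ⟨n, rfl⟩ := Nat.exists_eq_succ_of_ne_zero (Nat.ne_zero_of_lt hlt)
  obtain ⟨M, hM, hle⟩ := Sylow.exists_subgroup_card_pow_prime_le p
    (by rw [hn]; exact pow_dvd_pow p n.le_succ) (Subgroup.zpowers x) hk (Nat.lt_succ_iff.mp hlt)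
  have hidx : M.index = p := by
    have := M.card_mul_index
    rw [hM, hn, pow_succ] at this
    exact Nat.eq_of_mul_eq_mul_left (pow_pos hp.out.pos n) this
  have hnorm : M.Normal := Subgroup.normal_of_index_eq_minFac_card (by
    rw [hidx, hn, hp.out.pow_minFac n.succ_ne_zero])
  refine ⟨M, hle (Subgroup.mem_zpowers x), hidx, hnorm, ?_⟩
  have : IsCyclic (P ⧸ M) := isCyclic_of_prime_card (p := p) hidx
  have hcomm : IsMulCommutative (P ⧸ M) := IsCyclic.isMulCommutative
  exact Subgroup.Normal.quotient_commutative_iff_commutator_le.mp hcomm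

/-- In a minimal counterexample proper subgroups are cyclic and `P` is nonabelian. Subgroups `M₁`,
`M₂` of index `p` through noncommuting `x`, `y` meet in a central subgroup containing `P'` and all
`p`-th powers. As `p` is odd, `g ↦ g ^ p` is a homomorphism, and its kernel has order more than `p`,
so is not cyclic and must be `P`. Then `|M₁| ≤ p`, so `M₁ ⊓ M₂`, and with it `P'`, is trivial. -/
theorem isCyclic_of_isPGroup_of_odd {p : ℕ} [hp : Fact p.Prime] (hp2 : p ≠ 2) {V : Type*}
    [AddCommGroup V] [Finite V] [Nontrivial V] : ∀ (n : ℕ) {P : Type*} [Group P] [Finite P],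
    Nat.card P = n → IsPGroup p P → ∀ ρ : P →* AddMonoid.End V,
    (∀ a, a ≠ 1 → ∀ v, ρ a v = v → v = 0) → IsCyclic P := by
  intro n
  induction n using Nat.strong_induction_on with
  | _ n ih =>
  intro P _ _ hcard hP ρ hρ
  by_contra hcyc
  have hsub : ∀ H : Subgroup P, H ≠ ⊤ → IsCyclic H := by
    intro H hH
    refine ih (Nat.card H) ?_ rfl (hP.to_subgroup H) (ρ.comp H.subtype) fun a ha v hv =>
      hρ a (fun h => ha (Subtype.ext h)) v hv
    rw [← hcard]
    exact lt_of_le_of_ne (Subgroup.card_le_card_group _) fun h => hH (Subgroup.eq_top_of_card_eq _ h)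
  have hsubc : ∀ H : Subgroup P, H ≠ ⊤ → ∀ a ∈ H, ∀ b ∈ H, a * b = b * a := by
    intro H hH a ha b hb
    have := hsub H hH
    have : IsMulCommutative H := IsCyclic.isMulCommutative
    exact congrArg Subtype.val (mul_comm' (⟨a, ha⟩ : H) ⟨b, hb⟩)
  obtain ⟨x, y, hxy⟩ : ∃ x y : P, x * y ≠ y * x := by
    by_contra! hcon
    have : IsMulCommutative P := ⟨⟨hcon⟩⟩
    exact hcyc (isCyclic_of_isMulCommutative ρ hρ)
  have hz : ∀ g : P, Subgroup.zpowers g ≠ ⊤ := fun g hg =>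
    hcyc ⟨g, fun h => by
    have : h ∈ Subgroup.zpowers g := hg ▸ Subgroup.mem_top h
    exact this⟩
  obtain ⟨M₁, hx, hi₁, hn₁, hc₁⟩ := exists_normal_index_eq_prime hP x (hz x)
  obtain ⟨M₂, hy, hi₂, hn₂, hc₂⟩ := exists_normal_index_eq_prime hP y (hz y)
  have hne : ∀ M : Subgroup P, M.index = p → M ≠ ⊤ := fun M hM h => by
    rw [h, Subgroup.index_top] at hM
    exact hp.out.one_lt.ne hM
  have hM₁ := hne M₁ hi₁
  have hM₂ := hne M₂ hi₂
  have hle : ¬ M₁ ≤ M₂ := fun hle => hxy (hsubc M₂ hM₂ x (hle hx) y hy)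
  have hrel : 1 < (M₁ ⊓ M₂).relIndex M₁ := by
    have h1 : (M₁ ⊓ M₂).relIndex M₁ ≠ 1 := fun h => hle ((Subgroup.relIndex_eq_one.mp h).trans
      inf_le_right)
    have h2 : (M₁ ⊓ M₂).relIndex M₁ ≠ 0 := Subgroup.index_ne_zero_of_finite
    omega
  have hidx : p < (M₁ ⊓ M₂).index := by
    rw [← Subgroup.relIndex_mul_index (inf_le_left : M₁ ⊓ M₂ ≤ M₁), hi₁]
    exact lt_mul_of_one_lt_left hp.out.pos hrel
  have hcen : M₁ ⊓ M₂ ≤ Subgroup.center P := by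
    intro z hz
    have h1 : M₁ ≤ Subgroup.centralizer {z} := fun g hg => by
      rw [Subgroup.mem_centralizer_singleton_iff]
      exact hsubc M₁ hM₁ _ hg _ hz.1
    have h2 : M₂ ≤ Subgroup.centralizer {z} := fun g hg => by
      rw [Subgroup.mem_centralizer_singleton_iff]
      exact hsubc M₂ hM₂ _ hg _ hz.2
    have h3 : Subgroup.centralizer {z} = ⊤ := by
      by_contra hne
      exact hxy (hsubc _ hne x (h1 hx) y (h2 hy))
    rw [Subgroup.mem_center_iff]
    intro g
    have : g ∈ Subgroup.centralizer {z} := h3 ▸ Subgroup.mem_top g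
    exact Subgroup.mem_centralizer_singleton_iff.mp this
  have hc : commutator P ≤ Subgroup.center P := (le_inf hc₁ hc₂).trans hcen
  have hpow : ∀ g : P, g ^ p ∈ M₁ ⊓ M₂ := fun g =>
    ⟨by rw [← hi₁]; exact M₁.pow_index_mem g, by rw [← hi₂]; exact M₂.pow_index_mem g⟩
  let φ : P →* P :=
    { toFun := fun g => g ^ p
      map_one' := one_pow p
      map_mul' := fun a b => by
        have h1 := mul_pow_of_commutatorElement_central a b (fun z =>
          (Subgroup.mem_center_iff.mp (hc (commutatorHom hc b a).2) z).symm) p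
        obtain ⟨k, hk⟩ : p ∣ p.choose 2 := hp.out.dvd_choose_self two_ne_zero
          (lt_of_le_of_ne hp.out.two_le (Ne.symm hp2))
        have h2 := congrArg Subtype.val (map_pow (commutatorHom hc b) a p)
        rw [Subgroup.coe_pow, coe_commutatorHom, coe_commutatorHom,
          commutatorElement_eq_one_iff_mul_comm.mpr
            (Subgroup.mem_center_iff.mp (hcen (hpow a)) b)] at h2
        rw [h1, hk, pow_mul, ← h2, one_pow, mul_one] }
  have hrange : φ.range ≤ M₁ ⊓ M₂ := by
    rintro _ ⟨g, rfl⟩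
    exact hpow g
  have hcyclic : ∀ H : Subgroup P, H ≠ ⊤ → H ≤ φ.ker → Nat.card H ≤ p := by
    intro H hH hHk
    have := hsub H hH
    obtain ⟨g, hg⟩ := IsCyclic.exists_generator (α := H)
    rw [← orderOf_eq_card_of_forall_mem_zpowers hg]
    exact Nat.le_of_dvd hp.out.pos (orderOf_dvd_of_pow_eq_one (Subtype.ext (hHk g.2)))
  have hker : p < Nat.card φ.ker := by
    have h1 := Subgroup.card_mul_index φ.ker
    have h2 := Subgroup.card_mul_index (M₁ ⊓ M₂)
    rw [Subgroup.index_ker] at h1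
    have h3 : Nat.card φ.range ≤ Nat.card (M₁ ⊓ M₂ : Subgroup P) :=
      Nat.le_of_dvd Nat.card_pos (Subgroup.card_dvd_of_le hrange)
    have h4 : 0 < Nat.card (M₁ ⊓ M₂ : Subgroup P) := Nat.card_pos
    by_contra! hcon
    nlinarith
  have htop : φ.ker = ⊤ := by
    by_contra hne
    exact absurd (hcyclic _ hne le_rfl) (not_le.mpr hker)
  have hM₁p := hcyclic M₁ hM₁ (htop ▸ le_top)
  have hbot : M₁ ⊓ M₂ = ⊥ := by
    obtain ⟨j, hj⟩ := (hP.to_subgroup (M₁ ⊓ M₂)).exists_card_eq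
    have h1 := Subgroup.card_mul_index M₁
    have h2 := Subgroup.card_mul_index (M₁ ⊓ M₂)
    rw [← h1, hi₁] at h2
    have h3 : Nat.card (M₁ ⊓ M₂ : Subgroup P) < p := by
      by_contra! hcon
      have := hp.out.pos
      nlinarith
    rw [hj] at h3
    rcases j with _ | j
    · rw [pow_zero] at hj
      exact Subgroup.card_eq_one.mp hj
    · exact absurd h3 (not_lt.mpr (Nat.le_self_pow j.succ_ne_zero p))
  have h1 := le_inf hc₁ hc₂ (commutatorHom hc x y).2
  rw [hbot, Subgroup.mem_bot, coe_commutatorHom, commutatorElement_eq_one_iff_mul_comm] at h1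
  exact hxy h1

end GaloisFrobenius

/-! ### Cyclic complements; Frobenius groups as semidirect products; the nilpotent residual -/

namespace GaloisFrobenius

theorem isCyclic_of_isNilpotent_of_odd {L V : Type*} [Group L] [Finite L] [Group.IsNilpotent L]
    [AddCommGroup V] [Finite V] [Nontrivial V] (hodd : ¬ 2 ∣ Nat.card L) (ρ : L →* AddMonoid.End V)
    (hρ : ∀ a, a ≠ 1 → ∀ v, ρ a v = v → v = 0) : IsCyclic L := by
  have : IsZGroup L := by
    refine ⟨fun p hp P => ?_⟩
    have := Fact.mk hp
    rcases subsingleton_or_nontrivial P with hs | hnt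
    · infer_instance
    refine isCyclic_of_isPGroup_of_odd (p := p) ?_ _ rfl P.isPGroup'
      (ρ.comp (P : Subgroup L).subtype) fun a ha v hv => hρ a (fun h => ha (Subtype.ext h)) v hv
    rintro rfl
    obtain ⟨n, hn0, hn⟩ := P.isPGroup'.nontrivial_iff_card.mp hnt
    apply hodd
    refine dvd_trans ?_ (Subgroup.card_subgroup_dvd_card (P : Subgroup L))
    rw [hn]
    exact dvd_pow_self 2 hn0.ne'
  infer_instance

theorem isGCStar_of_mulEquiv {G H : Type*} [Group G] [Group H] (e : G ≃* H) (h : IsGCStar G) :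
    IsGCStar H := by
  have hirr : ∀ χ : H → ℂ, IsIrreducibleCharacter χ → IsIrreducibleCharacter (χ ∘ e) := by
    rintro χ ⟨n, ρ, hρ, rfl⟩
    exact ⟨n, ρ.comp e.toMonoidHom, isIrreducible_comp ρ hρ e.toMonoidHom e.surjective, rfl⟩
  intro χ ψ hχ hψ h1 h2 h12
  obtain ⟨n, hn, hdvd, α, hα⟩ := h _ _ (hirr χ hχ) (hirr ψ hψ) (by simpa using h1)
    (by simpa using h2) (by simpa using h12)
  refine ⟨n, hn, by rwa [← Nat.card_congr e.toEquiv], α, fun x => ?_⟩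
  obtain ⟨z, hz1, hz2⟩ := hα (e.symm x)
  exact ⟨z, by simpa using hz1, by simpa using hz2⟩

section Frobenius

variable {G : Type*} [Group G] {K L : Subgroup G}

theorem _root_.IsFrobeniusGroup.disjoint (h : IsFrobeniusGroup K L) : Disjoint K L := by
  rw [disjoint_iff, eq_bot_iff]
  rintro x ⟨hxK, hxL⟩
  rcases (h.mem_kernel x).mp hxK with rfl | hx
  · exact one_mem _
  · exact (hx 1 ⟨x, hxL, by simp⟩).elim

/-- Elements outside `K` are conjugates of nontrivial elements of `L`, by coset representatives of
`L`; there are at most `|G : L| (|L| - 1)` of them. Frobenius's theorem is not needed: `K` is a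
subgroup by hypothesis, and normal as the nilpotent residual. -/
theorem _root_.IsFrobeniusGroup.index_le_card [Finite G] (h : IsFrobeniusGroup K L) :
    L.index ≤ Nat.card K := by
  let f : (G ⧸ L) × ({1}ᶜ : Set L) → G := fun c => c.1.out * (c.2.1 : G) * c.1.out⁻¹
  have hsub : (K : Set G)ᶜ ⊆ Set.range f := by
    intro x hx
    have hx' : ¬ (x = 1 ∨ ∀ g : G, x ∉ L.map (MulAut.conj g).toMonoidHom) := fun h' =>
      hx ((h.mem_kernel x).mpr h')
    push Not at hx'
    obtain ⟨hx1, g, l, hl, hgl⟩ := hx'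
    obtain ⟨m, hm⟩ := QuotientGroup.mk_out_eq_mul L g
    have hgl' : x = g * l * g⁻¹ := hgl.symm
    refine ⟨((g : G ⧸ L), ⟨m⁻¹ * ⟨l, hl⟩ * m, fun h1 => hx1 ?_⟩), ?_⟩
    · have h2 : m⁻¹ * ⟨l, hl⟩ * m = (1 : L) := h1
      have h3 : (⟨l, hl⟩ : L) = 1 := by
        have := congrArg (fun z => m * z * m⁻¹) h2
        simpa [mul_assoc] using this
      have h4 : l = 1 := congrArg Subtype.val h3
      rw [hgl', h4, mul_one, mul_inv_cancel]
    · change (g : G ⧸ L).out * ((m⁻¹ * ⟨l, hl⟩ * m : L) : G) * ((g : G ⧸ L).out)⁻¹ = x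
      rw [hm, hgl']
      push_cast
      group
  have h1 := Set.ncard_le_ncard hsub
  have h2 : (Set.range f).ncard ≤ L.index * (Nat.card L - 1) := by
    rw [← Nat.card_coe_set_eq]
    refine (Finite.card_range_le f).trans ?_
    rw [Nat.card_prod, Nat.card_coe_set_eq ({1}ᶜ : Set L), Set.ncard_compl, Set.ncard_singleton]
    rfl
  have h3 := Set.ncard_add_ncard_compl (K : Set G)
  have h4 := L.card_mul_index
  have h5 : 0 < Nat.card L := Nat.card_pos
  have h6 : L.index * (Nat.card L - 1) + L.index = Nat.card G := by
    rw [← h4, ← Nat.mul_succ, Nat.succ_eq_add_one, Nat.sub_add_cancel h5, mul_comm]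
  have h7 : (K : Set G).ncard = Nat.card K := (Nat.card_coe_set_eq _).symm
  omega

theorem _root_.IsFrobeniusGroup.isComplement' [Finite G] (h : IsFrobeniusGroup K L) :
    K.IsComplement' L := by
  refine Subgroup.isComplement'_of_card_mul_and_disjoint (le_antisymm ?_ ?_) h.disjoint
  · rw [← Nat.card_prod]
    exact Nat.card_le_card_of_injective _ (Subgroup.mul_injective_of_disjoint h.disjoint)
  · rw [← L.card_mul_index, mul_comm]
    exact Nat.mul_le_mul_right _ h.index_le_card

/-- The conjugation action on a normal subgroup. -/
abbrev conjAction (K L : Subgroup G) [K.Normal] : MulDistribMulAction L K where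
  smul l k := MulAut.conjNormal (l : G) k
  one_smul k := by
    change MulAut.conjNormal ((1 : L) : G) k = k
    rw [Subgroup.coe_one, map_one, MulAut.one_apply]
  mul_smul a b k := by
    change MulAut.conjNormal ((a * b : L) : G) k = MulAut.conjNormal (a : G) (MulAut.conjNormal (b : G) k)
    rw [Subgroup.coe_mul, map_mul, MulAut.mul_apply]
  smul_one l := map_one (MulAut.conjNormal (l : G) : MulAut K)
  smul_mul l := map_mul (MulAut.conjNormal (l : G) : MulAut K)

theorem _root_.IsFrobeniusGroup.isFixedPointFree [K.Normal] (h : IsFrobeniusGroup K L) :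
    @IsFixedPointFree L K _ _ (conjAction K L) := by
  let _ := conjAction K L
  intro l hl k hk
  by_contra hk1
  have hk' : (l : G) * k * (l : G)⁻¹ = k := congrArg Subtype.val hk
  have hkL : (k : G) ∉ L := fun hkL => hk1 (Subtype.ext
    (Subgroup.disjoint_def.mp h.disjoint k.2 hkL))
  have hmem : (l : G) ∈ L ⊓ L.map (MulAut.conj (k : G)).toMonoidHom := by
    refine ⟨l.2, l, l.2, ?_⟩
    change (k : G) * l * (k : G)⁻¹ = l
    rw [mul_inv_eq_iff_eq_mul] at hk' ⊢
    exact hk'.symm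
  rw [h.inf_conj k hkL, Subgroup.mem_bot] at hmem
  exact hl (Subtype.ext hmem)

theorem _root_.IsFrobeniusGroup.isGaloisTransitive [Finite G] [K.Normal] (h : IsFrobeniusGroup K L)
    (hGC : IsGCStar G) : @IsGaloisTransitive L K _ _ (conjAction K L) := by
  let _ := conjAction K L
  have : Nontrivial L := (Subgroup.nontrivial_iff_ne_bot _).mpr h.ne_bot
  let f : K ⋊[MulDistribMulAction.toMulAut L K] L →* G :=
    SemidirectProduct.lift K.subtype L.subtype fun l => by ext k; rfl
  have hf : Function.Bijective f :=
    (show Function.Bijective fun x : K × L => (x.1 : G) * x.2 from h.isComplement').comp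
      SemidirectProduct.equivProd.bijective
  exact isGaloisTransitive_of_isGCStar h.isFixedPointFree
    (isGCStar_of_mulEquiv (MulEquiv.ofBijective f hf).symm hGC)

end Frobenius

theorem exists_lowerCentralSeries_eq {G : Type*} [Group G] [Finite G] :
    ∃ n, (⊤ : Subgroup G).lowerCentralSeries n = nilpotentResidual G := by
  obtain ⟨n, hn⟩ : ∃ n, ∀ m, Nat.card ((⊤ : Subgroup G).lowerCentralSeries n) ≤
      Nat.card ((⊤ : Subgroup G).lowerCentralSeries m) := by
    obtain ⟨_, ⟨n, rfl⟩, hn⟩ := WellFounded.has_min (wellFounded_lt (α := ℕ))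
      (Set.range fun n => Nat.card ((⊤ : Subgroup G).lowerCentralSeries n)) ⟨_, 0, rfl⟩
    exact ⟨n, fun m => not_lt.mp (hn _ ⟨m, rfl⟩)⟩
  refine ⟨n, le_antisymm (le_iInf fun m => ?_) (iInf_le _ n)⟩
  rcases le_total m n with hmn | hmn
  · exact Subgroup.lowerCentralSeries_antitone _ hmn
  · exact (Subgroup.eq_of_le_of_card_ge (Subgroup.lowerCentralSeries_antitone _ hmn) (hn m)).ge

theorem isNilpotent_of_disjoint_nilpotentResidual {G : Type*} [Group G] [Finite G] (L : Subgroup G)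
    (h : Disjoint (nilpotentResidual G) L) : Group.IsNilpotent L := by
  obtain ⟨n, hn⟩ := exists_lowerCentralSeries_eq (G := G)
  rw [Subgroup.nilpotent_iff_lowerCentralSeries]
  refine ⟨n, ?_⟩
  have h1 : ((⊤ : Subgroup L).lowerCentralSeries n).map L.subtype ≤ nilpotentResidual G ⊓ L := by
    refine le_inf ?_ (Subgroup.map_subtype_le _)
    rw [← hn, Subgroup.top_subtype_lowerCentralSeries]
    exact Subgroup.lowerCentralSeries_mono n le_top
  rw [h.eq_bot, le_bot_iff, Subgroup.map_eq_bot_iff_of_injective _ L.subtype_injective] at h1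
  exact h1

instance nilpotentResidual_normal {G : Type*} [Group G] [Finite G] :
    (nilpotentResidual G).Normal := by
  obtain ⟨n, hn⟩ := exists_lowerCentralSeries_eq (G := G)
  rw [← hn]
  infer_instance

end GaloisFrobenius

/-! ### The Suzuki case and the conclusion -/

namespace GaloisFrobenius

open scoped commutatorElement IsMulCommutative

section

variable {L K : Type*} [Group L] [Group K] [MulDistribMulAction L K] [Finite L] [Finite K]

theorem IsGaloisTransitive.isSuzukiTwoGroup [Nontrivial L] [Nontrivial K] (hL : Group.IsSolvable L)
    (hGT : IsGaloisTransitive L K) (hfpf : IsFixedPointFree L K) (hK : IsPGroup 2 K)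
    (hpow : ∀ x : K, x ^ 2 ∈ commutator K) (hne : commutator K ≠ ⊥)
    (hc : commutator K ≤ Subgroup.center K) : IsSuzukiTwoGroup K where
  isPGroup := hK
  nonabelian := by
    by_contra! hcon
    exact hne ((commutator_eq_bot_iff K).mpr ⟨⟨hcon⟩⟩)
  involutions := by
    have h1 := hGT.card_commutator_eq hc hne hfpf hK hpow
    have h2 : 1 < Nat.card L := Finite.one_lt_card
    obtain ⟨x, y, hx, hy, hxy⟩ : ∃ x y : commutator K, x ≠ 1 ∧ y ≠ 1 ∧ x ≠ y := by
      have := Fintype.ofFinite (commutator K)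
      rw [Nat.card_eq_fintype_card] at h1
      obtain ⟨a, b, c, hab, hac, hbc⟩ := Fintype.two_lt_card_iff.mp
        (show 2 < Fintype.card (commutator K) by omega)
      by_cases ha : a = 1
      · exact ⟨b, c, ha ▸ hab.symm, ha ▸ hac.symm, hbc⟩
      · by_cases hb : b = 1
        · exact ⟨a, c, ha, hb ▸ hbc.symm, hac⟩
        · exact ⟨a, b, ha, hb, hab⟩
    refine ⟨x, y, ?_, ?_, fun h => hxy (Subtype.ext h)⟩
    · exact orderOf_eq_prime (pow_eq_one_of_mem_commutator hc hpow x.2)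
        fun h => hx (Subtype.ext h)
    · exact orderOf_eq_prime (pow_eq_one_of_mem_commutator hc hpow y.2)
        fun h => hy (Subtype.ext h)
  transitive := by
    refine ⟨(MulDistribMulAction.toMulAut L K).range,
      Group.isSolvable_of_surjective (MulDistribMulAction.toMulAut L K).rangeRestrict_surjective,
      fun x y hx hy => ?_⟩
    -- No element outside `K'` squares to `1`, so transitivity is only needed on the nontrivial
    -- elements of `K'`, of which there are `|L|`.
    have key : ∀ x : K, orderOf x = 2 → x ≠ 1 ∧ x ∈ commutator K := by
      intro x hx
      refine ⟨fun h => by rw [h, orderOf_one] at hx; omega, ?_⟩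
      by_contra hxK
      exact hGT.sq_ne_one hc hne hfpf hK hpow hxK (hx ▸ pow_orderOf_eq_one x)
    obtain ⟨l, hl⟩ := hGT.exists_smul_eq_of_mem_commutator hc hne hfpf hK hpow (key x hx).2
      (key y hy).2 (key x hx).1 (key y hy).1
    exact ⟨_, ⟨l, rfl⟩, hl⟩

theorem IsGaloisTransitive.card_eq_sq [Nontrivial K]
    (hGT : IsGaloisTransitive L K) (hfpf : IsFixedPointFree L K) (hK : IsPGroup 2 K)
    (hpow : ∀ x : K, x ^ 2 ∈ commutator K) (hne : commutator K ≠ ⊥)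
    (hc : commutator K ≤ Subgroup.center K) : Nat.card K = Nat.card (commutator K) ^ 2 := by
  rw [← (commutator K).card_mul_index, hGT.index_eq hfpf hK hpow,
    ← hGT.card_commutator_eq hc hne hfpf hK hpow, sq]

theorem IsFixedPointFree.isCyclic [Group.IsNilpotent L] (hfpf : IsFixedPointFree L K)
    (hne : commutator K ≠ ⊥) (hc : commutator K ≤ Subgroup.center K) : IsCyclic L := by
  have : IsMulCommutative (commutator K) :=
    (commutator_eq_bot_iff _).mp (commutator_commutator_eq_bot hc)
  have : Nontrivial (commutator K) := (Subgroup.nontrivial_iff_ne_bot _).mpr hne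
  let _ := restrictAction (L := L) (commutator K) fun l n hn => smul_mem_of_characteristic _ l hn
  let ρ : L →* AddMonoid.End (Additive (commutator K)) :=
    { toFun := fun l => MonoidHom.toAdditive (MulDistribMulAction.toMonoidHom (commutator K) l)
      map_one' := AddMonoidHom.ext fun x => one_smul L x.toMul
      map_mul' := fun a b => AddMonoidHom.ext fun x => mul_smul a b x.toMul }
  refine isCyclic_of_isNilpotent_of_odd (hfpf.odd_card hne) ρ fun l hl v hv => ?_
  exact congrArg Additive.ofMul (Subtype.ext (hfpf l hl (v.toMul : commutator K)
    (congrArg (fun v => ((Additive.toMul v : commutator K) : K)) hv)) : v.toMul = 1)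

end

end GaloisFrobenius

theorem theorem3p6 {G : Type*} [Group G] [Finite G] (hsol : Group.IsSolvable G)
    (hGC : IsGCStar G) (K L : Subgroup G) (hfrob : IsFrobeniusGroup K L)
    (hK : K = nilpotentResidual G) :
    (∃ q : ℕ, q.Prime ∧ IsElementaryAbelian q K) ∨
      (IsSuzukiTwoGroup K ∧ Nat.card K = Nat.card (commutator K) ^ 2 ∧
        IsCyclic L ∧ Nat.card L = Nat.card (commutator K) - 1) := by
  have hKn : K.Normal := by
    rw [hK]
    infer_instance
  have hLnil : Group.IsNilpotent L :=
    GaloisFrobenius.isNilpotent_of_disjoint_nilpotentResidual L (hK ▸ hfrob.disjoint)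
  have hLnt : Nontrivial L := (Subgroup.nontrivial_iff_ne_bot _).mpr hfrob.ne_bot
  have hKnt : Nontrivial K := by
    rw [← Finite.one_lt_card_iff_nontrivial]
    refine lt_of_lt_of_le ?_ hfrob.index_le_card
    have h0 : L.index ≠ 0 := Subgroup.index_ne_zero_of_finite
    have h1 : L.index ≠ 1 := fun h => hfrob.ne_top (Subgroup.index_eq_one.mp h)
    omega
  let _ := GaloisFrobenius.conjAction K L
  have hfpf : GaloisFrobenius.IsFixedPointFree L K := hfrob.isFixedPointFree
  have hGT : GaloisFrobenius.IsGaloisTransitive L K := hfrob.isGaloisTransitive hGC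
  obtain ⟨p, hp, hP, hpow, htwo⟩ := hGT.exists_prime hfpf inferInstance
  by_cases hne : commutator K = ⊥
  · left
    refine ⟨p, hp, fun x y => ?_, fun x => ?_⟩
    · have := (commutator_eq_bot_iff K).mp hne
      exact mul_comm' x y
    · have := hpow x
      rwa [hne, Subgroup.mem_bot] at this
  · right
    obtain ⟨rfl, hc⟩ := htwo hne
    refine ⟨hGT.isSuzukiTwoGroup inferInstance hfpf hP hpow hne hc,
      hGT.card_eq_sq hfpf hP hpow hne hc, hfpf.isCyclic hne hc, ?_⟩
    rw [hGT.card_commutator_eq hc hne hfpf hP hpow, Nat.add_sub_cancel]
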